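/- Let $N\ge 1$ and let $a=[a_{ij}]\in\mathbb R^{N\times N}$ be the weighted adjacency matrix ($a_{ij}=a_{ji}\ge 0$, $a_{ii}=0$) of an undirected connected graph, $d_i=\sum_j a_{ji}$ the degrees, $L=\mathrm{diag}(d_1,\dots,d_N)-a$ the Laplacian and $\lambda_N$ its largest eigenvalue. Consider $N$ linear agents $$\dot x_i=A_ix_i+B_iu_i,\qquad y_i=C_ix_i,\qquad x_i\in\mathbb R^{n_i},\ u_i\in\mathbb R^{p_i},\ y_i\in\mathbb R^q,$$ with $(A_i,B_i)$ controllable and $\operatorname{rank}(C_iB_i)=q$. Let $f_i:\mathbb R^q\to\mathbb R$ be differentiable such that, for all $u,v\in\mathbb R^q$, $\|\nabla f_i(u)-\nabla f_i(v)\|\le w_i\|u-v\|$ and $(u-v)^\top(\nabla f_i(u)-\nabla f_i(v))\ge m_i\|u-v\|^2$, where $w_i,m_i>0$; put $\overline w=\max_i w_i$ and $\underline m=\min_i m_i$. Let $K_{\alpha_i},K_{\beta_i}$ satisfy $C_iB_iK_{\alpha_i}=C_iA_i$ and $C_iB_iK_{\beta_i}=I_q$. Let $$\xi>\frac{4\overline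 w^2+2\lambda_N^2+1}{8\underline m},\quad \epsilon=\frac1{2\sqrt{2(\xi^2+(\xi-1)^2)}},\quad \tau_0=\frac1{\overline w+1}\ln\Bigl(1+\frac{(\overline w+1)\epsilon}{\overline w+1+\sqrt2\lambda_N+\sqrt2\lambda_N\epsilon}\Bigr),$$ $$\Delta\in(0,\tau_0],\qquad \kappa>\max\Bigl\{\frac{\overline w^2}{4\underline m},\frac12\Bigr\}.$$ Agent $i$ broadcasts its output at instants $0=t_0^i<t_1^i<\cdots$ (finitely or infinitely many); $\hat y_i(t)=y_i(t_k^i)$ for $t\in[t_k^i,t_{k+1}^i)$ is its last broadcast value and $e_i=\hat y_i-y_i$. The agents are driven by $$u_i=-K_{\alpha_i}x_i+K_{\beta_i}\Bigl(-\nabla f_i(y_i)-\sum_j a_{ij}(\hat y_i-\hat y_j)-\eta_i\Bigr),\qquad \dot\eta_i=\sum_j a_{ij}(\hat y_i-\hat y_j),\quad \eta_i(0)=0,$$ and the broadcast instants obey $t_{k+1}^i=t_k^i+\max\{\tau_k^i,\Delta\}$, where $t_k^i+\tau_k^i$ is the first time after $t_k^i$ at which $\|e_i\|^2$ (with $\hat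 y_i=y_i(t_k^i)$ kept fixed) reaches or exceeds the threshold $$\frac1{4(d_i+\kappa)}\sum_{j}a_{ij}\|\hat y_i-\hat y_j\|^2 .$$ Here $\tau_k^i=0$ if the threshold vanishes at $t_k^i$, $\tau_k^i=\infty$ (no further broadcast) if the threshold is never reached, and at an instant at which some neighbors broadcast, each of them may be counted in the threshold with its old or with its new value. Then the problem $\min\sum_i f_i(y_i)$ subject to $y_1=\dots=y_N$ has a unique solution $y_1=\dots=y_N=y^*$, and there is a rate $c>0$, independent of the initial states, such that for every solution of the closed loop on $[0,\infty)$ there is a constant $M$ with $\|y_i(t)-y^*\|\le Me^{-ct}$ for all $t\ge0$ and all $i$. Moreover consecutive broadcasts of every agent are at least $\Delta$ apart, so that each agent broadcasts only finitely often in any bounded time interval (no Zeno behavior). -/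

import Mathlib

open Filter Topology
open scoped ENNReal

noncomputable section

namespace OptimalConsensus

/-- `ℝ^n` with its Euclidean norm. -/
abbrev Vec (n : ℕ) : Type := EuclideanSpace ℝ (Fin n)

/-! ### The communication graph -/

/-- `a` is the adjacency matrix of an undirected connected graph with positive edge weights and
without self-loops; `i` and `j` are joined by an edge iff `0 < a i j`. -/
structure IsConnectedAdjacency {N : ℕ} (a : Matrix (Fin N) (Fin N) ℝ) : Prop where
  symm : a.IsSymm
  nonneg : ∀ i j, 0 ≤ a i j
  no_loop : ∀ i, a i i = 0
  connected : (SimpleGraph.fromRel fun i j => 0 < a i j).Connected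

/-- Out-degree `d_i = ∑_j a_ji`. -/
def outDegree {N : ℕ} (a : Matrix (Fin N) (Fin N) ℝ) (i : Fin N) : ℝ := ∑ j, a j i

/-- Laplacian `L = D - a`. -/
def laplacian {N : ℕ} (a : Matrix (Fin N) (Fin N) ℝ) : Matrix (Fin N) (Fin N) ℝ :=
  Matrix.diagonal (outDegree a) - a

/-- The largest eigenvalue `λ_N` of the (symmetric) Laplacian. -/
def maxLaplacianEigenvalue {N : ℕ} (a : Matrix (Fin N) (Fin N) ℝ) : ℝ :=
  sSup (spectrum ℝ (laplacian a))

/-! ### The agents -/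

/-- The data of `N` heterogeneous linear agents `x_i' = A_i x_i + B_i u_i`, `y_i = C_i x_i` with
outputs in `ℝ^q`. -/
structure Agents (N q : ℕ) where
  n : Fin N → ℕ
  p : Fin N → ℕ
  A : (i : Fin N) → Matrix (Fin (n i)) (Fin (n i)) ℝ
  B : (i : Fin N) → Matrix (Fin (n i)) (Fin (p i)) ℝ
  C : (i : Fin N) → Matrix (Fin q) (Fin (n i)) ℝ

/-- Kalman's controllability matrix `[B, AB, …, A^{n-1}B]`. -/
def controllabilityMatrix {n p : ℕ} (A : Matrix (Fin n) (Fin n) ℝ) (B : Matrix (Fin n) (Fin p) ℝ) :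
    Matrix (Fin n) (Fin n × Fin p) ℝ :=
  Matrix.of fun r kc => (A ^ (kc.1 : ℕ) * B) r kc.2

/-- `(A, B)` is controllable. -/
def IsControllable {n p : ℕ} (A : Matrix (Fin n) (Fin n) ℝ) (B : Matrix (Fin n) (Fin p) ℝ) : Prop :=
  (controllabilityMatrix A B).rank = n

/-- Output `C_i x_i(t)`. -/
def Agents.output {N q : ℕ} (S : Agents N q) (x : (i : Fin N) → ℝ → Vec (S.n i)) (i : Fin N)
    (t : ℝ) : Vec q :=
  Matrix.toEuclideanLin (S.C i) (x i t)

/-! ### The optimization problem -/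

/-- `Y = (y_1, …, y_N)` minimizes `∑ f_i(y_i)` subject to `y_1 = ⋯ = y_N`. -/
def IsOptimalConsensus {N q : ℕ} (f : Fin N → Vec q → ℝ) (Y : Fin N → Vec q) : Prop :=
  IsMinOn (fun Z : Fin N → Vec q => ∑ i, f i (Z i)) {Z | ∀ i j, Z i = Z j} Y ∧ ∀ i j, Y i = Y j

/-! ### The parameters -/

/-- `ε = 1 / (2 √(2 (ξ² + (ξ - 1)²)))`. -/
def epsilon (ξ : ℝ) : ℝ := 1 / (2 * √(2 * (ξ ^ 2 + (ξ - 1) ^ 2)))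

/-- `τ₀ = (w + 1)⁻¹ ln (1 + (w + 1) ε / (w + 1 + √2 Λ + √2 Λ ε))`. -/
def tauZero (w Λ ε : ℝ) : ℝ :=
  1 / (w + 1) * Real.log (1 + (w + 1) * ε / (w + 1 + √2 * Λ + √2 * Λ * ε))

/-! ### Event-triggered closed loop -/

/-- `∑_j a_ij (ŷ_i(t) - ŷ_j(t))`. -/
def disagreement {N q : ℕ} (a : Matrix (Fin N) (Fin N) ℝ) (yhat : Fin N → ℝ → Vec q)
    (i : Fin N) (t : ℝ) : Vec q :=
  ∑ j, a i j • (yhat i t - yhat j t)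

/-- The control input
`u_i = -K_{α_i} x_i + K_{β_i} (-∇f_i(y_i) - ∑_j a_ij (ŷ_i - ŷ_j) - η_i)`. -/
def control {N q : ℕ} (S : Agents N q) (f : Fin N → Vec q → ℝ) (a : Matrix (Fin N) (Fin N) ℝ)
    (Kα : (i : Fin N) → Matrix (Fin (S.p i)) (Fin (S.n i)) ℝ)
    (Kβ : (i : Fin N) → Matrix (Fin (S.p i)) (Fin q) ℝ)
    (x : (i : Fin N) → ℝ → Vec (S.n i)) (η yhat : Fin N → ℝ → Vec q) (i : Fin N) (t : ℝ) :
    Vec (S.p i) :=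
  -Matrix.toEuclideanLin (Kα i) (x i t) +
    Matrix.toEuclideanLin (Kβ i)
      (-gradient (f i) (S.output x i t) - disagreement a yhat i t - η i t)

/-- The threshold `(4 (d_i + κ))⁻¹ ∑_j a_ij ‖v - c_j‖²`, where `v` is the value that agent `i`
broadcast last and `c_j` the value that agent `j` broadcast last. -/
def threshold {N q : ℕ} (a : Matrix (Fin N) (Fin N) ℝ) (κ : ℝ) (i : Fin N) (v : Vec q)
    (c : Fin N → Vec q) : ℝ :=
  1 / (4 * (outDegree a i + κ)) * ∑ j, a i j * ‖v - c j‖ ^ 2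

/-- Agent `i`, which broadcast last at time `s`, sees its squared error `‖y_i(s) - y_i(t)‖²` reach
the threshold at time `t`. If some neighbors broadcast exactly at time `t`, then the threshold jumps
at `t`, and each of these neighbors may be counted with its value just before `t` or with its new
value. -/
def ReachesThreshold {N q : ℕ} (a : Matrix (Fin N) (Fin N) ℝ) (κ : ℝ)
    (y yhat : Fin N → ℝ → Vec q) (i : Fin N) (s t : ℝ) : Prop :=
  ∃ c : Fin N → Vec q,
    (∀ j, c j = yhat j t ∨ (s < t ∧ Tendsto (yhat j) (𝓝[<] t) (𝓝 (c j)))) ∧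
      threshold a κ i (y i s) c ≤ ‖y i s - y i t‖ ^ 2

/-- `τ` is the time that elapses after the broadcast of agent `i` at time `s` until its squared
error first reaches the threshold (`τ = ∞` if it never does; `τ = 0` if the threshold is `0` at
time `s`). -/
def IsFirstReach {N q : ℕ} (a : Matrix (Fin N) (Fin N) ℝ) (κ : ℝ)
    (y yhat : Fin N → ℝ → Vec q) (i : Fin N) (s : ℝ) (τ : ℝ≥0∞) : Prop :=
  (∀ t, s < t → ENNReal.ofReal (t - s) < τ →
      ‖y i s - y i t‖ ^ 2 < threshold a κ i (y i s) fun j => yhat j t) ∧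
    (τ ≠ ∞ → ReachesThreshold a κ y yhat i s (s + τ.toReal))

/-- `(x, η, ŷ)` with broadcast instants `T i 0, T i 1, …` is a run of the event-triggered closed
loop on `[0, ∞)`; `T i k = ∞` means that agent `i` broadcasts fewer than `k + 1` times. As `ŷ` is
right-continuous and piecewise constant, the differential equations hold for the right
derivatives at every time. -/
structure IsEventTriggeredRun {N q : ℕ} (S : Agents N q) (f : Fin N → Vec q → ℝ)
    (a : Matrix (Fin N) (Fin N) ℝ)
    (Kα : (i : Fin N) → Matrix (Fin (S.p i)) (Fin (S.n i)) ℝ)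
    (Kβ : (i : Fin N) → Matrix (Fin (S.p i)) (Fin q) ℝ) (κ Δ : ℝ)
    (x : (i : Fin N) → ℝ → Vec (S.n i)) (η yhat : Fin N → ℝ → Vec q)
    (T : Fin N → ℕ → ℝ≥0∞) : Prop where
  x_cont : ∀ i, ContinuousOn (x i) (Set.Ici 0)
  η_cont : ∀ i, ContinuousOn (η i) (Set.Ici 0)
  x_deriv : ∀ i t, 0 ≤ t →
    HasDerivWithinAt (x i)
      (Matrix.toEuclideanLin (S.A i) (x i t) +
        Matrix.toEuclideanLin (S.B i) (control S f a Kα Kβ x η yhat i t)) (Set.Ici t) t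
  η_deriv : ∀ i t, 0 ≤ t → HasDerivWithinAt (η i) (disagreement a yhat i t) (Set.Ici t) t
  η_zero : ∀ i, η i 0 = 0
  T_zero : ∀ i, T i 0 = 0
  hold : ∀ i k t, 0 ≤ t → T i k ≤ ENNReal.ofReal t → ENNReal.ofReal t < T i (k + 1) →
    yhat i t = S.output x i (T i k).toReal
  T_top : ∀ i k, T i k = ∞ → T i (k + 1) = ∞
  T_succ : ∀ i k, T i k ≠ ∞ →
    ∃ τ : ℝ≥0∞, IsFirstReach a κ (S.output x) yhat i (T i k).toReal τ ∧
      T i (k + 1) = T i k + max τ (ENNReal.ofReal Δ)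

end OptimalConsensus

end

/-!
Shift the optimum to the origin. With `h_i` the increment of `∇f_i`, `ŷ` the broadcast values and
`η` the deviation of the integrators from their equilibrium, the errors satisfy
`y' = -h - η - L ŷ`, `η' = L ŷ` and `∑ η_i = 0`. Along the eigenvectors of `L` this splits into
scalar modes, and the Lyapunov function is a sum of mode energies `y² / 2 + b y η + g η² / 2`.

An agent whose next broadcast does not come after exactly `Δ` respects its threshold. Summed over
these agents the thresholds give `∑ (κ + d_i) ‖e_i‖² ≤ ŷᵀ L ŷ / 2`. An agent in a dwell interval of
length `Δ` is paid for by an additional storage `φ(s) ‖e_i‖²`, where `s` is the time since its last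
broadcast and `φ` solves a Riccati inequality; the storage vanishes at broadcasts.

It remains to see that in each mode the dissipation, a quadratic form in `y`, `h`, `η`, `z = ŷ` and
the part `e` of `ŷ - y` that obeys the thresholds, is positive definite for some choice of `g`. The
weight `g` only enters through a multiple of `η z`, so by Dines' argument a suitable `g` exists as
soon as the form is positive definite on the two hyperplanes `η = 0` and `z = 0`. This is where the
bounds on `ξ`, `Δ` and `κ` come in.
-/

namespace OptimalConsensus

/-! ### Right derivatives -/

section RightDerivative

variable {g g' : ℝ → ℝ} {b : ℝ}

theorem image_le_left_of_right_deriv_nonpos (hg : LowerSemicontinuousOn g (Set.Icc 0 b))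
    (hd : ∀ t ∈ Set.Ico 0 b, HasDerivWithinAt g (g' t) (Set.Ici t) t)
    (hneg : ∀ t ∈ Set.Ico 0 b, g' t ≤ 0) {t : ℝ} (ht : t ∈ Set.Icc 0 b) : g t ≤ g 0 := by
  suffices h : ∀ ε > 0, Set.Icc 0 b ⊆ {t | g t + -(ε * t) ≤ g 0} by
    have hlim : Tendsto (fun ε => g t + -(ε * t)) (𝓝[>] 0) (𝓝 (g t + -(0 * t))) :=
      (by fun_prop : Continuous fun ε => g t + -(ε * t)).continuousAt.mono_left nhdsWithin_le_nhds
    rw [zero_mul, neg_zero, add_zero] at hlim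
    exact le_of_tendsto hlim (eventually_mem_nhdsWithin.mono fun ε hε => h ε hε ht)
  intro ε hε
  have hlsc : LowerSemicontinuousOn (fun t => g t + -(ε * t)) (Set.Icc 0 b) :=
    hg.add (by fun_prop : Continuous fun t => -(ε * t)).continuousOn.lowerSemicontinuousOn
  refine IsClosed.Icc_subset_of_forall_exists_gt ?_ (by simp) fun t ⟨ht, ht0, htb⟩ u hu => ?_
  · rw [Set.inter_comm]
    exact (hlsc.isCompact_inter_preimage_Iic isCompact_Icc (g 0)).isClosed
  · have hslope := (hasDerivWithinAt_iff_tendsto_slope' (by simp)).1 (hd t ⟨ht0, htb⟩).Ioi_of_Ici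
    obtain ⟨s, hs, hts⟩ := ((hslope.eventually_lt_const ((hneg t ⟨ht0, htb⟩).trans_lt hε)).and
      (Ioc_mem_nhdsGT hu)).exists
    rw [slope_def_field, div_lt_iff₀ (sub_pos.2 hts.1)] at hs
    refine ⟨s, ?_, hts⟩
    have ht : g t + -(ε * t) ≤ g 0 := ht
    change g s + -(ε * s) ≤ g 0
    linarith

theorem le_mul_exp_of_right_deriv_le {γ : ℝ} (hg : LowerSemicontinuousOn g (Set.Icc 0 b))
    (hd : ∀ t ∈ Set.Ico 0 b, HasDerivWithinAt g (g' t) (Set.Ici t) t)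
    (hle : ∀ t ∈ Set.Ico 0 b, g' t ≤ -γ * g t) {t : ℝ} (ht : t ∈ Set.Icc 0 b) :
    g t ≤ g 0 * Real.exp (-γ * t) := by
  have hexp : ∀ t, HasDerivAt (fun t => Real.exp (γ * t)) (Real.exp (γ * t) * (γ * 1)) t :=
    fun t => ((hasDerivAt_id t).const_mul γ).exp
  have hlsc : LowerSemicontinuousOn (fun t => Real.exp (γ * t) * g t) (Set.Icc 0 b) := by
    intro t ht y hy
    have hcont : ContinuousOn (fun s => -(Real.exp (-(γ * s)) * y)) (Set.Icc 0 b) := by fun_prop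
    have hpos : 0 < g t + -(Real.exp (-(γ * t)) * y) := by
      rw [Real.exp_neg, ← div_eq_inv_mul, ← sub_eq_add_neg, sub_pos, div_lt_iff₀' (Real.exp_pos _)]
      exact hy
    filter_upwards [hg.add hcont.lowerSemicontinuousOn t ht 0 hpos] with s hs
    change 0 < g s + -(Real.exp (-(γ * s)) * y) at hs
    rwa [Real.exp_neg, ← div_eq_inv_mul, ← sub_eq_add_neg, sub_pos,
      div_lt_iff₀' (Real.exp_pos _)] at hs
  have key := image_le_left_of_right_deriv_nonpos hlsc
    (fun t ht => (hexp t).hasDerivWithinAt.fun_mul (hd t ht))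
    (fun t ht => by
      have := mul_le_mul_of_nonneg_left (hle t ht) (Real.exp_pos (γ * t)).le
      linarith) ht
  simp only [mul_zero, Real.exp_zero, one_mul] at key
  rwa [neg_mul, Real.exp_neg, ← div_eq_mul_inv, le_div_iff₀' (Real.exp_pos _)]

end RightDerivative

section Gradient

variable {E : Type*} [NormedAddCommGroup E] [InnerProductSpace ℝ E] {F : E → ℝ} {G : E → E}
  {m w : ℝ}

theorem inner_le_of_lipschitz (hLip : ∀ u v, ‖G u - G v‖ ≤ w * ‖u - v‖) (u v : E) :
    inner ℝ (u - v) (G u - G v) ≤ w * ‖u - v‖ ^ 2 := by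
  calc inner ℝ (u - v) (G u - G v) ≤ ‖u - v‖ * ‖G u - G v‖ := real_inner_le_norm _ _
    _ ≤ ‖u - v‖ * (w * ‖u - v‖) := by gcongr; exact hLip u v
    _ = w * ‖u - v‖ ^ 2 := by ring

theorem le_of_strongly_monotone_of_lipschitz [Nontrivial E]
    (hm : ∀ u v, m * ‖u - v‖ ^ 2 ≤ inner ℝ (u - v) (G u - G v))
    (hLip : ∀ u v, ‖G u - G v‖ ≤ w * ‖u - v‖) : m ≤ w := by
  obtain ⟨u, hu⟩ := exists_ne (0 : E)
  have hpos : 0 < ‖u - 0‖ ^ 2 := by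
    rw [sub_zero]
    positivity
  exact le_of_mul_le_mul_right ((hm u 0).trans (inner_le_of_lipschitz hLip u 0)) hpos

variable [CompleteSpace E]

theorem hasDerivAt_comp_line_of_hasGradientAt (hF : ∀ x, HasGradientAt F (G x) x) (x d : E)
    (t : ℝ) : HasDerivAt (fun t : ℝ => F (x + t • d)) (inner ℝ (G (x + t • d)) d) t := by
  have hline : HasDerivAt (fun t : ℝ => x + t • d) d t := by
    simpa using ((hasDerivAt_id t).smul_const d).const_add x
  exact (hF (x + t • d)).hasFDerivAt.comp_hasDerivAt t hline

theorem quadratic_lower_bound_of_strongly_monotone (hF : ∀ x, HasGradientAt F (G x) x)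
    (hm : ∀ u v, m * ‖u - v‖ ^ 2 ≤ inner ℝ (u - v) (G u - G v)) (x y : E) :
    F x + inner ℝ (G x) (y - x) + m / 2 * ‖y - x‖ ^ 2 ≤ F y := by
  set d := y - x with hd
  have hderiv (t : ℝ) : HasDerivAt
      (fun t : ℝ => F (x + t • d) - (t * inner ℝ (G x) d + m / 2 * t ^ 2 * ‖d‖ ^ 2))
      (inner ℝ (G (x + t • d)) d - (inner ℝ (G x) d + m * t * ‖d‖ ^ 2)) t := by
    have hquad := (((hasDerivAt_id t).fun_pow 2).const_mul (m / 2)).mul_const (‖d‖ ^ 2)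
    refine ((hasDerivAt_comp_line_of_hasGradientAt hF x d t).sub
      (((hasDerivAt_id t).mul_const (inner ℝ (G x) d)).add hquad)).congr_deriv ?_
    simp only [id]
    ring
  have hmono := monotoneOn_of_hasDerivWithinAt_nonneg (convex_Ici 0)
    (fun t _ => (hderiv t).continuousAt.continuousWithinAt)
    (fun t _ => (hderiv t).hasDerivWithinAt) (fun t ht => by
      rw [interior_Ici, Set.mem_Ioi] at ht
      have hmt := hm (x + t • d) x
      rw [add_sub_cancel_left, real_inner_smul_left, norm_smul, mul_pow, Real.norm_eq_abs, sq_abs,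
        real_inner_comm, inner_sub_left] at hmt
      refine nonneg_of_mul_nonneg_right (a := t) ?_ ht
      linarith)
  have := hmono Set.self_mem_Ici (Set.mem_Ici.2 zero_le_one) (zero_le_one' ℝ)
  simp only [zero_smul, one_smul, hd, add_zero, add_sub_cancel] at this
  linarith

theorem quadratic_upper_bound_of_inner_le (hF : ∀ x, HasGradientAt F (G x) x)
    (hw : ∀ u v, inner ℝ (u - v) (G u - G v) ≤ w * ‖u - v‖ ^ 2) (x y : E) :
    F y ≤ F x + inner ℝ (G x) (y - x) + w / 2 * ‖y - x‖ ^ 2 := by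
  have hneg : ∀ x, HasGradientAt (-F) (-G x) x := fun x => by
    rw [hasGradientAt_iff_hasFDerivAt, map_neg]
    exact (hF x).hasFDerivAt.neg
  have := quadratic_lower_bound_of_strongly_monotone (m := -w) hneg (fun u v => by
    rw [neg_sub_neg, ← neg_sub (G u), inner_neg_right]
    linarith [hw u v]) x y
  simp only [Pi.neg_apply, inner_neg_left] at this
  linarith

-- Both quadratic bounds are compared at the minimizer `u - (w - m)⁻¹ • r` of their difference.
theorem norm_sq_div_le_bregman (hF : ∀ x, HasGradientAt F (G x) x) (hmw : m < w)
    (hm : ∀ u v, m * ‖u - v‖ ^ 2 ≤ inner ℝ (u - v) (G u - G v))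
    (hw : ∀ u v, inner ℝ (u - v) (G u - G v) ≤ w * ‖u - v‖ ^ 2) (u v : E) :
    ‖G u - G v - m • (u - v)‖ ^ 2 / (2 * (w - m)) ≤
      F u - F v - inner ℝ (G v) (u - v) - m / 2 * ‖u - v‖ ^ 2 := by
  have hp : 0 < w - m := sub_pos.2 hmw
  set d := u - v with hd
  set r := G u - G v - m • d with hr
  set s := (w - m)⁻¹ with hs
  have hlow := quadratic_lower_bound_of_strongly_monotone hF hm v (u - s • r)
  have hupp := quadratic_upper_bound_of_inner_le hF hw u (u - s • r)
  have hGu : inner ℝ (G u) r = inner ℝ (G v) r + m * inner ℝ d r + ‖r‖ ^ 2 := by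
    rw [show G u = G v + m • d + r by rw [hr]; abel, inner_add_left, inner_add_left,
      real_inner_smul_left, real_inner_self_eq_norm_sq]
  rw [sub_right_comm, ← hd, inner_sub_right, norm_sub_sq_real, real_inner_smul_right,
    real_inner_smul_right, norm_smul, mul_pow, Real.norm_eq_abs, sq_abs] at hlow
  rw [sub_sub_cancel_left, inner_neg_right, norm_neg, real_inner_smul_right, hGu, norm_smul,
    mul_pow, Real.norm_eq_abs, sq_abs] at hupp
  have hsp : s * (w - m) = 1 := inv_mul_cancel₀ hp.ne'
  have hsq : ‖r‖ ^ 2 / (2 * (w - m)) = s * ‖r‖ ^ 2 - (s * (w - m)) * s / 2 * ‖r‖ ^ 2 := by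
    rw [hsp, hs]
    field_simp
    ring
  rw [hsq]
  linarith

theorem sector_of_strongly_monotone (hF : ∀ x, HasGradientAt F (G x) x) (hmw : m < w)
    (hm : ∀ u v, m * ‖u - v‖ ^ 2 ≤ inner ℝ (u - v) (G u - G v))
    (hw : ∀ u v, inner ℝ (u - v) (G u - G v) ≤ w * ‖u - v‖ ^ 2) (u v : E) :
    ‖G u - G v - m • (u - v)‖ ^ 2 ≤
      (w - m) * inner ℝ (u - v) (G u - G v - m • (u - v)) := by
  have hp : 0 < w - m := sub_pos.2 hmw
  have huv := norm_sq_div_le_bregman hF hmw hm hw u v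
  have hvu := norm_sq_div_le_bregman hF hmw hm hw v u
  rw [show G v - G u - m • (v - u) = -(G u - G v - m • (u - v)) by
    rw [smul_sub, smul_sub]; abel, norm_neg, norm_sub_rev v u, ← neg_sub u v,
    inner_neg_right] at hvu
  rw [← div_le_iff₀' hp]
  have hhalf (c : ℝ) : c / (w - m) = c / (2 * (w - m)) + c / (2 * (w - m)) := by
    field_simp
    ring
  rw [hhalf, inner_sub_right, inner_sub_right, real_inner_smul_right, real_inner_self_eq_norm_sq,
    real_inner_comm (G u), real_inner_comm (G v)]
  linarith

theorem exists_gradient_eq_zero_of_strongly_monotone [ProperSpace E]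
    (hF : ∀ x, HasGradientAt F (G x) x) (h0 : 0 < m)
    (hm : ∀ u v, m * ‖u - v‖ ^ 2 ≤ inner ℝ (u - v) (G u - G v)) : ∃ x, G x = 0 := by
  have hcoercive : Tendsto F (cocompact E) atTop := by
    have hlow (x : E) : F 0 + ‖x‖ * (m / 2 * ‖x‖ - ‖G 0‖) ≤ F x := by
      have hquad := quadratic_lower_bound_of_strongly_monotone hF hm 0 x
      rw [sub_zero] at hquad
      linarith [neg_le_of_abs_le (abs_real_inner_le_norm (G 0) x)]
    have hnorm := tendsto_norm_cocompact_atTop (E := E)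
    refine tendsto_atTop_mono hlow (tendsto_atTop_add_const_left _ _ (hnorm.atTop_mul_atTop₀ ?_))
    exact tendsto_atTop_add_const_right _ _ (hnorm.const_mul_atTop (half_pos h0))
  have hcont : Continuous F := continuous_iff_continuousAt.2 fun x => (hF x).continuousAt
  obtain ⟨x, hx⟩ := hcont.exists_forall_le hcoercive
  refine ⟨x, ?_⟩
  have hmin : IsLocalMin F x := Eventually.of_forall hx
  simpa using hmin.hasFDerivAt_eq_zero (hF x).hasFDerivAt

end Gradient

section Optimum

variable {N q : ℕ} {f : Fin N → Vec q → ℝ} {m : Fin N → ℝ}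

theorem sum_quadratic_lower_bound (hf : ∀ i, Differentiable ℝ (f i))
    (hconv : ∀ i u v, m i * ‖u - v‖ ^ 2 ≤ inner ℝ (u - v) (gradient (f i) u - gradient (f i) v))
    {y : Vec q} (hy : ∑ i, gradient (f i) y = 0) (z : Vec q) :
    ∑ i, f i y + (∑ i, m i) / 2 * ‖z - y‖ ^ 2 ≤ ∑ i, f i z := by
  calc ∑ i, f i y + (∑ i, m i) / 2 * ‖z - y‖ ^ 2
      = ∑ i, (f i y + inner ℝ (gradient (f i) y) (z - y) + m i / 2 * ‖z - y‖ ^ 2) := by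
        rw [Finset.sum_add_distrib, Finset.sum_add_distrib, ← sum_inner, hy, inner_zero_left,
          add_zero, ← Finset.sum_mul, ← Finset.sum_div]
    _ ≤ ∑ i, f i z := Finset.sum_le_sum fun i _ =>
        quadratic_lower_bound_of_strongly_monotone (fun x => (hf i x).hasGradientAt) (hconv i) y z

theorem exists_sum_gradient_eq_zero (hf : ∀ i, Differentiable ℝ (f i)) (hm : 0 < ∑ i, m i)
    (hconv : ∀ i u v, m i * ‖u - v‖ ^ 2 ≤
      inner ℝ (u - v) (gradient (f i) u - gradient (f i) v)) :
    ∃ y : Vec q, ∑ i, gradient (f i) y = 0 := by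
  refine exists_gradient_eq_zero_of_strongly_monotone (F := fun y => ∑ i, f i y)
    (G := fun y => ∑ i, gradient (f i) y) (fun x => ?_) hm fun u v => ?_
  · rw [hasGradientAt_iff_hasFDerivAt, map_sum]
    exact HasFDerivAt.fun_sum fun i _ => (hf i x).hasGradientAt.hasFDerivAt
  · rw [← Finset.sum_sub_distrib, inner_sum, Finset.sum_mul]
    exact Finset.sum_le_sum fun i _ => hconv i u v

theorem isOptimalConsensus_iff_of_sum_gradient_eq_zero [Nonempty (Fin N)]
    (hf : ∀ i, Differentiable ℝ (f i)) (hm : 0 < ∑ i, m i)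
    (hconv : ∀ i u v, m i * ‖u - v‖ ^ 2 ≤ inner ℝ (u - v) (gradient (f i) u - gradient (f i) v))
    {y : Vec q} (hy : ∑ i, gradient (f i) y = 0) (Y : Fin N → Vec q) :
    IsOptimalConsensus f Y ↔ Y = fun _ => y := by
  obtain ⟨i₀⟩ := ‹Nonempty (Fin N)›
  have hlow := sum_quadratic_lower_bound hf hconv hy
  constructor
  · rintro ⟨hmin, hcons⟩
    obtain ⟨z, rfl⟩ : ∃ z, Y = fun _ => z := ⟨Y i₀, funext fun i => hcons i i₀⟩
    have hle : ∑ i, f i z ≤ ∑ i, f i y := isMinOn_iff.1 hmin (fun _ => y) fun _ _ => rfl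
    have hsq : ‖z - y‖ ^ 2 ≤ 0 :=
      nonpos_of_mul_nonpos_right (by linarith [hlow z]) (half_pos hm)
    rw [sq_nonpos_iff, norm_eq_zero, sub_eq_zero] at hsq
    rw [hsq]
  · rintro rfl
    refine ⟨isMinOn_iff.2 fun Z hZ => ?_, fun _ _ => rfl⟩
    obtain ⟨z, rfl⟩ : ∃ z, Z = fun _ => z := ⟨Z i₀, funext fun i => hZ i i₀⟩
    exact (le_add_of_nonneg_right (by positivity)).trans (hlow z)

end Optimum

/-! ### Quadratic forms nonnegative on hyperplanes -/

section QuadraticForm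

theorem quadraticForm_smul_add_smul {E : Type*} [AddCommGroup E] [Module ℝ E]
    (Q : QuadraticForm ℝ E) (x y : E) (t s : ℝ) :
    Q (t • x + s • y) + t * s * Q (x - y) = (t + s) * (t * Q x + s * Q y) := by
  rw [sub_eq_add_neg, QuadraticMap.map_add Q, QuadraticMap.map_add Q, QuadraticMap.map_smul,
    QuadraticMap.map_smul, QuadraticMap.map_neg, QuadraticMap.polar_smul_left,
    QuadraticMap.polar_smul_right, QuadraticMap.polar_neg_right]
  simp only [smul_eq_mul]
  ring

theorem exists_mul_norm_sq_le_of_posDef {E : Type*} [NormedAddCommGroup E] [NormedSpace ℝ E]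
    [FiniteDimensional ℝ E] {Q : QuadraticForm ℝ E} (hQ : Q.PosDef) :
    ∃ δ > 0, ∀ x, δ * ‖x‖ ^ 2 ≤ Q x := by
  rcases subsingleton_or_nontrivial E with hE | hE
  · exact ⟨1, one_pos, fun x => by simp [Subsingleton.elim x 0]⟩
  have : ProperSpace E := FiniteDimensional.proper_real E
  have hcont : Continuous Q := by
    have hpolar : Continuous fun x => (2 : ℝ)⁻¹ * Q.polarBilin.toContinuousBilinearMap x x := by
      fun_prop
    refine hpolar.congr fun x => ?_
    rw [LinearMap.toContinuousBilinearMap_apply, QuadraticMap.polarBilin_apply_apply,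
      QuadraticMap.polar_self, two_smul, ← two_mul, inv_mul_cancel_left₀ two_ne_zero]
  obtain ⟨x₀, hx₀, hmin⟩ := (isCompact_sphere (0 : E) 1).exists_isMinOn
    (NormedSpace.sphere_nonempty.2 zero_le_one) hcont.continuousOn
  refine ⟨Q x₀, hQ x₀ (ne_zero_of_mem_unit_sphere ⟨x₀, hx₀⟩), fun x => ?_⟩
  rcases eq_or_ne x 0 with rfl | hx
  · simp
  have hx' : 0 < ‖x‖ := norm_pos_iff.2 hx
  have hle : Q x₀ ≤ Q (‖x‖⁻¹ • x) := hmin (by simp [norm_smul, hx'.ne'])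
  rw [QuadraticMap.map_smul, smul_eq_mul, ← mul_inv, ← sq, ← div_eq_inv_mul,
    le_div_iff₀ (by positivity)] at hle
  exact hle

variable {E : Type*} [AddCommGroup E] [Module ℝ E] {Q : QuadraticForm ℝ E} {u v : E →ₗ[ℝ] ℝ}

-- Both points satisfy `u = 1`, so `x - y ∈ ker u`; the multiple `-v y • x + v x • y` of a point of
-- the segment between them lies in `ker v`.
theorem div_le_div_of_nonneg_on_ker_of_eq_one (hu : ∀ x, u x = 0 → 0 ≤ Q x)
    (hv : ∀ x, v x = 0 → 0 ≤ Q x) {x y : E} (hx : u x = 1) (hy : u y = 1) (hvx : 0 < v x)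
    (hvy : v y < 0) : Q y / v y ≤ Q x / v x := by
  have hker_u : 0 ≤ Q (x - y) := hu _ (by rw [map_sub, hx, hy, sub_self])
  have hker_v : 0 ≤ Q (-v y • x + v x • y) := hv _ (by
    rw [map_add, map_smul, map_smul, smul_eq_mul, smul_eq_mul]
    ring)
  have hid := quadraticForm_smul_add_smul Q x y (-v y) (v x)
  have hvy' : 0 < -v y := neg_pos.2 hvy
  have hsum : 0 ≤ -v y * Q x + v x * Q y := by
    refine nonneg_of_mul_nonneg_right (a := -v y + v x) ?_ (by positivity)
    rw [← hid]
    positivity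
  rw [← neg_div_neg_eq, div_le_div_iff₀ hvy' hvx]
  linarith

theorem div_le_div_of_nonneg_on_ker (hu : ∀ x, u x = 0 → 0 ≤ Q x) (hv : ∀ x, v x = 0 → 0 ≤ Q x)
    {x y : E} (hx : 0 < u x * v x) (hy : u y * v y < 0) :
    Q y / (u y * v y) ≤ Q x / (u x * v x) := by
  have hux : u x ≠ 0 := left_ne_zero_of_mul hx.ne'
  have huy : u y ≠ 0 := left_ne_zero_of_mul hy.ne
  have hscale {z : E} (hz : u z ≠ 0) :
      Q ((u z)⁻¹ • z) / v ((u z)⁻¹ • z) = Q z / (u z * v z) := by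
    rw [QuadraticMap.map_smul, map_smul, smul_eq_mul, smul_eq_mul, mul_assoc,
      mul_div_mul_left _ _ (inv_ne_zero hz), ← div_eq_inv_mul, div_div]
  have hv_scale {z : E} (hz : u z ≠ 0) : v ((u z)⁻¹ • z) = (u z * v z) / u z ^ 2 := by
    rw [map_smul, smul_eq_mul]
    field_simp
  have hu_scale {z : E} (hz : u z ≠ 0) : u ((u z)⁻¹ • z) = 1 := by
    rw [map_smul, smul_eq_mul, inv_mul_cancel₀ hz]
  rw [← hscale hux, ← hscale huy]
  refine div_le_div_of_nonneg_on_ker_of_eq_one hu hv (hu_scale hux) (hu_scale huy) ?_ ?_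
  · rw [hv_scale hux]
    exact div_pos hx (by positivity)
  · rw [hv_scale huy]
    exact div_neg_of_neg_of_pos hy (by positivity)

theorem exists_mul_le_of_nonneg_on_ker (hu : ∀ x, u x = 0 → 0 ≤ Q x)
    (hv : ∀ x, v x = 0 → 0 ≤ Q x) (hpos : ∃ x, 0 < u x * v x) (hneg : ∃ x, u x * v x < 0) :
    ∃ c : ℝ, ∀ x, c * (u x * v x) ≤ Q x := by
  set ratio : E → ℝ := fun x => Q x / (u x * v x)
  obtain ⟨c, hc_neg, hc_pos⟩ := exists_between_of_forall_le
    (s := ratio '' {x | u x * v x < 0}) (t := ratio '' {x | 0 < u x * v x})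
    (Set.Nonempty.image ratio hneg) (Set.Nonempty.image ratio hpos) (by
      rintro _ ⟨y, hy, rfl⟩ _ ⟨x, hx, rfl⟩
      exact div_le_div_of_nonneg_on_ker hu hv hx hy)
  refine ⟨c, fun x => ?_⟩
  rcases lt_trichotomy (u x * v x) 0 with h | h | h
  · exact (div_le_iff_of_neg h).1 (hc_neg ⟨x, h, rfl⟩)
  · rw [h, mul_zero]
    exact (mul_eq_zero.1 h).elim (hu x) (hv x)
  · exact (le_div_iff₀ h).1 (hc_pos ⟨x, h, rfl⟩)

theorem exists_mul_add_norm_sq_le_of_posDef_ker {E : Type*} [NormedAddCommGroup E]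
    [InnerProductSpace ℝ E] [FiniteDimensional ℝ E] {Q : QuadraticForm ℝ E} {u v : E →ₗ[ℝ] ℝ}
    (hu : ∀ x, u x = 0 → x ≠ 0 → 0 < Q x) (hv : ∀ x, v x = 0 → x ≠ 0 → 0 < Q x)
    (hpos : ∃ x, 0 < u x * v x) (hneg : ∃ x, u x * v x < 0) :
    ∃ c : ℝ, ∃ δ > 0, ∀ x, c * (u x * v x) + δ * ‖x‖ ^ 2 ≤ Q x := by
  have hker {f : E →ₗ[ℝ] ℝ} (hf : ∀ x, f x = 0 → x ≠ 0 → 0 < Q x) :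
      ∃ δ > 0, ∀ x, f x = 0 → δ * ‖x‖ ^ 2 ≤ Q x := by
    obtain ⟨δ, hδ, h⟩ := exists_mul_norm_sq_le_of_posDef (Q := Q.restrict (LinearMap.ker f))
      fun x hx => hf x x.2 (by simpa using hx)
    exact ⟨δ, hδ, fun x hx => h ⟨x, hx⟩⟩
  obtain ⟨δu, hδu, hQu⟩ := hker hu
  obtain ⟨δv, hδv, hQv⟩ := hker hv
  have hbelow {δ' : ℝ} (hδ' : min δu δv ≤ δ') (x : E) (hx : δ' * ‖x‖ ^ 2 ≤ Q x) :
      0 ≤ (Q - min δu δv • LinearMap.BilinMap.toQuadraticMap (innerₗ E)) x := by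
    rw [sub_apply, smul_apply, LinearMap.BilinMap.toQuadraticMap_apply,
      innerₗ_apply_apply, real_inner_self_eq_norm_sq, smul_eq_mul, sub_nonneg]
    exact (mul_le_mul_of_nonneg_right hδ' (sq_nonneg _)).trans hx
  obtain ⟨c, hc⟩ := exists_mul_le_of_nonneg_on_ker
    (Q := Q - min δu δv • LinearMap.BilinMap.toQuadraticMap (innerₗ E))
    (fun x hx => hbelow (min_le_left δu δv) x (hQu x hx))
    (fun x hx => hbelow (min_le_right δu δv) x (hQv x hx)) hpos hneg
  refine ⟨c, min δu δv, lt_min hδu hδv, fun x => le_sub_iff_add_le.1 ?_⟩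
  rw [← real_inner_self_eq_norm_sq]
  exact hc x

end QuadraticForm

/-! ### Dissipation in a single Laplacian mode -/

section ModeDissipation

theorem exists_mul_sq_add_sq_le {A B C : ℝ} (hA : 0 < A) (hB : B ^ 2 < 4 * A * C) :
    ∃ μ > 0, ∀ x y : ℝ, μ * (x ^ 2 + y ^ 2) ≤ A * x ^ 2 + B * x * y + C * y ^ 2 := by
  have hC : 0 < C := by
    refine pos_of_mul_pos_right (a := 4 * A) ?_ (by positivity)
    exact (sq_nonneg B).trans_lt hB
  refine ⟨(4 * A * C - B ^ 2) / (4 * (A + C)), div_pos (sub_pos.2 hB) (by positivity),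
    fun x y => ?_⟩
  rw [div_mul_eq_mul_div, div_le_iff₀ (by positivity)]
  linarith [sq_nonneg (2 * A * x + B * y), sq_nonneg (B * x + 2 * C * y)]

theorem eq_zero_of_sq_add_sq_add_binary_nonpos {α β A B C : ℝ} (hα : 0 < α) (hβ : 0 < β)
    (hA : 0 < A) (hB : B ^ 2 < 4 * A * C) {r s x y : ℝ}
    (h : α * r ^ 2 + β * s ^ 2 + (A * x ^ 2 + B * x * y + C * y ^ 2) ≤ 0) :
    r = 0 ∧ s = 0 ∧ x = 0 ∧ y = 0 := by
  obtain ⟨μ, hμ, hlower⟩ := exists_mul_sq_add_sq_le hA hB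
  have hxy := hlower x y
  have hr : 0 ≤ α * r ^ 2 := by positivity
  have hs : 0 ≤ β * s ^ 2 := by positivity
  have hx : 0 ≤ μ * x ^ 2 := by positivity
  have hy : 0 ≤ μ * y ^ 2 := by positivity
  have hzero {a t : ℝ} (ha : 0 < a) (hle : a * t ^ 2 ≤ 0) : t = 0 :=
    pow_eq_zero_iff two_ne_zero |>.1 <|
      le_antisymm (nonpos_of_mul_nonpos_right hle ha) (sq_nonneg t)
  exact ⟨hzero hα (by linarith), hzero hβ (by linarith), hzero hμ (by linarith),
    hzero hμ (by linarith)⟩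

/-- The gain `a / (1 - a b)` of the feedback interconnection of the gains `a` and `b`: eliminating
one of two quadratically coupled variables replaces the gain of the other one in this way. -/
noncomputable def feedbackGain (a b : ℝ) : ℝ := a / (1 - a * b)

theorem feedbackGain_eq_add_mul {a b : ℝ} (h : a * b < 1) :
    feedbackGain a b = a + a * b * feedbackGain a b := by
  have : 1 - a * b ≠ 0 := (sub_pos.2 h).ne'
  unfold feedbackGain
  field_simp
  ring

theorem feedbackGain_swap {a b : ℝ} (h : a * b < 1) :
    feedbackGain b a = b + b ^ 2 * feedbackGain a b := by
  have hden : 1 - b * a ≠ 0 := (sub_pos.2 (mul_comm a b ▸ h)).ne'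
  unfold feedbackGain
  rw [mul_comm a b]
  field_simp
  ring

theorem feedbackGain_pos {a b : ℝ} (ha : 0 < a) (h : a * b < 1) : 0 < feedbackGain a b :=
  div_pos ha (sub_pos.2 h)

/-- The series connection `a b / (a + b)` of the gains `a` and `b`, that is the minimum of
`a s² + b (1 - s)²` over `s`. -/
noncomputable def seriesGain (a b : ℝ) : ℝ := a * b / (a + b)

theorem mul_sq_add_mul_sub_sq {K ρ : ℝ} (h : 0 < K + ρ) (x e : ℝ) :
    K * e ^ 2 + ρ * (x - e) ^ 2 =
      (K + ρ) * (e - ρ * x / (K + ρ)) ^ 2 + seriesGain K ρ * x ^ 2 := by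
  unfold seriesGain
  field_simp
  ring

theorem sq_div_add_mul_sub_mul_sq {p ν : ℝ} (hp : 0 < p) (h : p * ν < 1) (x r s : ℝ) :
    x ^ 2 / p + r * x - ν * (x + s) ^ 2 =
      1 / feedbackGain p ν * (x - feedbackGain p ν * (ν * s - r / 2)) ^ 2
        - feedbackGain p ν * (ν * s - r / 2) ^ 2 - ν * s ^ 2 := by
  have : 1 - p * ν ≠ 0 := (sub_pos.2 h).ne'
  unfold feedbackGain
  field_simp
  ring

/-- The part of the dissipation in one Laplacian mode with eigenvalue `l` that does not depend on
the weight of `η z` in the derivative of the Lyapunov function. Here `y, η, z` are the components of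
the output error, of the integrator error and of the broadcast output error, `h` is that of the
gradient minus `m y`, and `e` is that of the broadcast error of the agents below their threshold, so
that `z - y - e` belongs to the agents that broadcast less than `Δ` ago. -/
noncomputable def modeDissipation (m p K ρ ν b l y h η e z : ℝ) : ℝ :=
  m * y ^ 2 + h ^ 2 / p + (1 - b) * l * y * z + (1 + b * m) * y * η + b * η * h + b * η ^ 2
    - l / 2 * z ^ 2 + K * e ^ 2 + ρ * (z - y - e) ^ 2 - ν * (h + m * y + η + l * z) ^ 2

theorem modeDissipation_le_of_le {K K' : ℝ} (hK : K ≤ K') (m p ρ ν b l y h η e z : ℝ) :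
    modeDissipation m p K ρ ν b l y h η e z ≤ modeDissipation m p K' ρ ν b l y h η e z := by
  unfold modeDissipation
  gcongr

/-- The coefficient of `y²` after elimination of `h` and `e` from the mode dissipation at `η = 0`,
written in the variables `y` and `z - y`. -/
noncomputable def outputGain (m l b D : ℝ) : ℝ := m + l / 2 - b * l - D * (m + l) ^ 2

/-- The coefficient of `-y (z - y)` after elimination of `h` and `e` from the mode dissipation at
`η = 0`, written in the variables `y` and `z - y`. -/
noncomputable def couplingGain (m l b D : ℝ) : ℝ := b * l + 2 * D * l * (m + l)

/-- The coefficient of `(z - y)²` after elimination of `h` and `e` from the mode dissipation at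
`η = 0`, written in the variables `y` and `z - y`. -/
noncomputable def errorGain (k l D : ℝ) : ℝ := k - l / 2 - D * l ^ 2

theorem modeDissipation_of_integrator_eq_zero {m p K ρ ν b l : ℝ} (hp : 0 < p) (hpν : p * ν < 1)
    (hKρ : 0 < K + ρ) (y h e z : ℝ) :
    modeDissipation m p K ρ ν b l y h 0 e z =
      (K + ρ) * (e - ρ * (z - y) / (K + ρ)) ^ 2
        + 1 / feedbackGain p ν * (h - feedbackGain p ν * (ν * (m * y + l * z))) ^ 2
        + (outputGain m l b (feedbackGain ν p) * y ^ 2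
          + -couplingGain m l b (feedbackGain ν p) * y * (z - y)
          + errorGain (seriesGain K ρ) l (feedbackGain ν p) * (z - y) ^ 2) := by
  have he := mul_sq_add_mul_sub_sq hKρ (z - y) e
  have hh := sq_div_add_mul_sub_mul_sq hp hpν h 0 (m * y + l * z)
  rw [zero_div, sub_zero] at hh
  unfold modeDissipation outputGain couplingGain errorGain
  rw [feedbackGain_swap hpν]
  linear_combination he + hh

theorem eq_zero_of_modeDissipation_nonpos_of_integrator_eq_zero {m p K ρ ν b l : ℝ} (hp : 0 < p)
    (hpν : p * ν < 1) (hKρ : 0 < K + ρ) (hA : 0 < outputGain m l b (feedbackGain ν p))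
    (hdisc : couplingGain m l b (feedbackGain ν p) ^ 2 <
      4 * outputGain m l b (feedbackGain ν p) *
        errorGain (seriesGain K ρ) l (feedbackGain ν p))
    {y h e z : ℝ} (hle : modeDissipation m p K ρ ν b l y h 0 e z ≤ 0) :
    y = 0 ∧ h = 0 ∧ e = 0 ∧ z = 0 := by
  rw [modeDissipation_of_integrator_eq_zero hp hpν hKρ] at hle
  obtain ⟨he, hh, rfl, hz⟩ := eq_zero_of_sq_add_sq_add_binary_nonpos hKρ
    (one_div_pos.2 (feedbackGain_pos hp hpν)) hA (by rwa [neg_sq]) hle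
  obtain rfl : z = 0 := by simpa using hz
  simpa using And.intro hh he

theorem modeDissipation_of_broadcast_eq_zero {m p K ρ ν b l : ℝ} (hp : 0 < p) (hpν : p * ν < 1)
    (hKρ : 0 < K + ρ) (y h η e : ℝ) :
    modeDissipation m p K ρ ν b l y h η e 0 =
      (K + ρ) * (e - ρ * (0 - y) / (K + ρ)) ^ 2
        + 1 / feedbackGain p ν *
          (h - feedbackGain p ν * (ν * (m * y + η) - b * η / 2)) ^ 2
        + ((m - feedbackGain ν p * m ^ 2 + seriesGain K ρ) * y ^ 2
          + (1 + b * m - ν * m * (2 - feedbackGain p ν * (b - 2 * ν))) * y * η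
          + (b - ν - feedbackGain p ν / 4 * (b - 2 * ν) ^ 2) * η ^ 2) := by
  have he := mul_sq_add_mul_sub_sq hKρ (0 - y) e
  have hh := sq_div_add_mul_sub_mul_sq hp hpν h (b * η) (m * y + η)
  unfold modeDissipation
  rw [feedbackGain_swap hpν]
  linear_combination he + hh

theorem integrator_discriminant_lt {m ν b q A : ℝ} (hm : 0 ≤ m) (hν : 0 ≤ ν) (hbν : 2 * ν ≤ b)
    (hq : 0 ≤ q) (hqb : q * b ≤ 2) (hA : 0 ≤ A)
    (hdisc : (1 + b * m) ^ 2 < A * (4 * b - 4 * ν - q * b ^ 2)) :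
    (1 + b * m - ν * m * (2 - q * (b - 2 * ν))) ^ 2 <
      4 * A * (b - ν - q / 4 * (b - 2 * ν) ^ 2) := by
  have hbm : 2 * ν * m ≤ b * m := mul_le_mul_of_nonneg_right hbν hm
  have hqbν : 0 ≤ q * (b - 2 * ν) := mul_nonneg hq (sub_nonneg.2 hbν)
  have hqν : 0 ≤ q * ν := by positivity
  have hfactor : 0 ≤ 2 - q * (b - 2 * ν) := by linarith
  have hdrop : 0 ≤ ν * m * (2 - q * (b - 2 * ν)) := by positivity
  have hdrop_le : ν * m * (2 - q * (b - 2 * ν)) ≤ ν * m * 2 :=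
    mul_le_mul_of_nonneg_left (by linarith) (by positivity)
  have hcross : (1 + b * m - ν * m * (2 - q * (b - 2 * ν))) ^ 2 ≤ (1 + b * m) ^ 2 :=
    pow_le_pow_left₀ (by linarith) (by linarith) 2
  have hsq : q * (b - 2 * ν) ^ 2 ≤ q * b ^ 2 := by
    gcongr
    linarith
  calc _ ≤ (1 + b * m) ^ 2 := hcross
    _ < A * (4 * b - 4 * ν - q * b ^ 2) := hdisc
    _ ≤ A * (4 * b - 4 * ν - q * (b - 2 * ν) ^ 2) := by gcongr
    _ = _ := by ring

theorem eq_zero_of_modeDissipation_nonpos_of_broadcast_eq_zero {m p K ρ ν b l : ℝ} (hp : 0 < p)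
    (hm : 0 ≤ m) (hν : 0 ≤ ν) (hpν : p * ν < 1) (hKρ : 0 < K + ρ) (hbν : 2 * ν ≤ b)
    (hqb : feedbackGain p ν * b ≤ 2) (hA : 0 < m - feedbackGain ν p * m ^ 2 + seriesGain K ρ)
    (hdisc : (1 + b * m) ^ 2 < (m - feedbackGain ν p * m ^ 2 + seriesGain K ρ) *
      (4 * b - 4 * ν - feedbackGain p ν * b ^ 2))
    {y h η e : ℝ} (hle : modeDissipation m p K ρ ν b l y h η e 0 ≤ 0) :
    y = 0 ∧ h = 0 ∧ η = 0 ∧ e = 0 := by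
  rw [modeDissipation_of_broadcast_eq_zero hp hpν hKρ] at hle
  have hq := feedbackGain_pos hp hpν
  obtain ⟨he, hh, rfl, rfl⟩ := eq_zero_of_sq_add_sq_add_binary_nonpos hKρ (one_div_pos.2 hq) hA
    (integrator_discriminant_lt hm hν hbν hq.le hqb hA.le hdisc) hle
  simpa using And.intro hh he

end ModeDissipation

section Polynomials

/-- The polynomial in the Lipschitz constant `w` and the eigenvalue `l` that bounds the dwell time
through `Δ * dwellPoly w l ≤ 2.83 * m`. It is the product of the numerator in the condition on `ξ`
and the denominator in `τ₀`, with `√2` rounded down to `1.4`. -/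
noncomputable def dwellPoly (w l : ℝ) : ℝ := (1 + 4 * w ^ 2 + 2 * l ^ 2) * (1 + w + 1.4 * l)

variable {w l : ℝ}

theorem dwellPoly_pos (hw : 0 ≤ w) (hl : 0 ≤ l) : 0 < dwellPoly w l := by
  unfold dwellPoly
  positivity

theorem sq_le_dwellPoly (hw : 0 ≤ w) (hl : 0 ≤ l) : 9.76 * w ^ 2 ≤ dwellPoly w l := by
  calc 9.76 * w ^ 2 ≤ (1 + 4 * w ^ 2) * (1 + w) := by
        nlinarith [mul_nonneg hw (sq_nonneg (w - 0.88)), sq_nonneg (w - 0.88)]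
    _ ≤ dwellPoly w l := by
        unfold dwellPoly
        exact mul_le_mul (by linarith [sq_nonneg l]) (by linarith) (by positivity) (by positivity)

theorem mul_le_dwellPoly (hw : 0 ≤ w) (hl : 0 ≤ l) :
    2.83 * (w * l) ≤ 0.14 * dwellPoly w l := by
  unfold dwellPoly
  nlinarith [mul_nonneg hw (sq_nonneg (w - 0.56)), mul_nonneg hl (sq_nonneg (w - 0.56)),
    mul_nonneg hw (sq_nonneg (l - 0.7)), mul_nonneg hl (sq_nonneg (l - 0.7)), mul_nonneg hl hw,
    sq_nonneg (w - 0.56), sq_nonneg (l - 0.7), sq_nonneg (w - 0.8 * l)]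

theorem mul_one_add_le_dwellPoly (hw : 0 ≤ w) (hl : 0 ≤ l) :
    5.66 * (w * (1 + l)) ≤ dwellPoly w l := by
  unfold dwellPoly
  nlinarith [mul_nonneg hw (sq_nonneg (w - 0.42)), sq_nonneg (w - 0.42),
    mul_nonneg hl (sq_nonneg (w - 0.42)), mul_nonneg hw (sq_nonneg (l - 0.5)),
    mul_nonneg hl (sq_nonneg (l - 0.5)), mul_nonneg hl hw, sq_nonneg (w - l),
    sq_nonneg (w - 0.42 - l), mul_nonneg hl (sq_nonneg (w - 0.6))]

theorem sq_add_mul_le_dwellPoly (hw : 0 ≤ w) (hl : 0 ≤ l) :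
    2.83 * (w ^ 2 + 2 * w * l) ≤ dwellPoly w l := by
  unfold dwellPoly
  nlinarith [mul_nonneg hw (sq_nonneg (w - 0.42)), sq_nonneg (w - l),
    mul_nonneg hl (sq_nonneg (w - 0.5)), mul_nonneg hw (sq_nonneg (l - 1)),
    mul_nonneg hl (sq_nonneg (l - 0.5)), mul_nonneg hl hw]

theorem mul_one_add_mul_le_dwellPoly (hw : 0 ≤ w) (hl : 0 ≤ l) :
    5.66 * (w * (1 + l)) * (0.85 + 0.684 * (w + l)) ≤ 1.3 * dwellPoly w l := by
  unfold dwellPoly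
  nlinarith [mul_nonneg hw (sq_nonneg (w - 0.5)), sq_nonneg (w - 0.45),
    mul_nonneg hl (sq_nonneg (w - 0.42)), mul_nonneg hw (sq_nonneg (l - 0.5)),
    mul_nonneg hl (sq_nonneg (l - 0.5)), mul_nonneg hl hw, sq_nonneg (w - l),
    sq_nonneg (w - 0.42 - l), mul_nonneg hl (sq_nonneg (w - l)),
    mul_nonneg hl (sq_nonneg (w - 0.6)), mul_nonneg hw (sq_nonneg (w - l)),
    mul_nonneg hw (sq_nonneg (w - 0.5 - l)), mul_nonneg hl (sq_nonneg (w - 0.5 - l))]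

theorem sq_add_mul_mul_le_dwellPoly (hw : 0 ≤ w) (hl : 0 ≤ l) :
    2.83 * (w ^ 2 + 2 * w * l) * (0.85 + 0.684 * (w + l)) ≤ 1.3 * dwellPoly w l := by
  unfold dwellPoly
  nlinarith [mul_nonneg hw (sq_nonneg (w - 0.5)), sq_nonneg (w - 0.45),
    mul_nonneg hl (sq_nonneg (w - 0.42)), mul_nonneg hw (sq_nonneg (l - 0.5)),
    mul_nonneg hl (sq_nonneg (l - 0.5)), mul_nonneg hl hw, sq_nonneg (w - l),
    sq_nonneg (w - 0.42 - l), mul_nonneg hl (sq_nonneg (w - l)),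
    mul_nonneg hl (sq_nonneg (w - 0.6)), mul_nonneg hw (sq_nonneg (w - l)),
    mul_nonneg hw (sq_nonneg (w - 0.5 - l)), mul_nonneg hl (sq_nonneg (w - 0.5 - l))]

theorem add_sq_le_dwellPoly (hw : 0 ≤ w) (hl : 0 ≤ l) :
    2.83 * (0.85 * l + 0.342 * (w + l) ^ 2) ≤ 0.59 * dwellPoly w l := by
  unfold dwellPoly
  nlinarith [mul_nonneg hw (sq_nonneg (w - 0.56)), mul_nonneg hl (sq_nonneg (w - 0.56)),
    mul_nonneg hw (sq_nonneg (l - 0.5)), mul_nonneg hl (sq_nonneg (l - 0.5)), mul_nonneg hl hw,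
    sq_nonneg (w - 0.56), sq_nonneg (l - 0.5), sq_nonneg (w - 0.8 * l),
    mul_nonneg hl (sq_nonneg w), mul_nonneg hw (sq_nonneg l)]

theorem mul_add_sq_mul_le_dwellPoly_of_le (hw : 0 ≤ w) (hl : 0 ≤ l) (h2 : w ≤ 2) :
    2.83 * (0.877 * (w * l) + 0.7805 * (l ^ 2 * (2 * w))) ≤ 0.4 * dwellPoly w l := by
  unfold dwellPoly
  nlinarith [mul_nonneg hl (sq_nonneg (w - 0.5 * l)), mul_nonneg hw (sq_nonneg (w - 0.5 * l)),
    mul_nonneg hl hw, mul_nonneg (mul_nonneg hl hw) (sub_nonneg.2 h2),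
    mul_nonneg (mul_nonneg hl hl) (sub_nonneg.2 h2), mul_nonneg hl (sq_nonneg (l - 4)),
    mul_nonneg hl (sq_nonneg (w - 2)), sq_nonneg (w - 0.5 * l)]

theorem mul_add_sq_mul_le_dwellPoly_of_ge (hl : 0 ≤ l) (h2 : 2 ≤ w) :
    2.83 * (0.877 * (w * l) + 0.7805 * (l ^ 2 * 4)) ≤ 0.4 * dwellPoly w l := by
  have hw : 0 ≤ w := zero_le_two.trans h2
  unfold dwellPoly
  nlinarith [mul_nonneg hl (sq_nonneg (w - 0.5 * l)), mul_nonneg hw (sq_nonneg (w - 0.5 * l)),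
    mul_nonneg hl hw, mul_nonneg (mul_nonneg hl hw) (sub_nonneg.2 h2),
    mul_nonneg (mul_nonneg hl hl) (sub_nonneg.2 h2), mul_nonneg hl (sq_nonneg (l - 4)),
    mul_nonneg hl (sq_nonneg (w - 2)), sq_nonneg (w - 0.5 * l)]

theorem coupling_poly_le (hw : 0 ≤ w) (hl : 0 ≤ l) :
    (4.5 + 3.27 * (w + l)) * l ^ 2 * (5.66 * (w * (1 + l))) ≤
      (0.3 * (0.9 + l) * (5.66 * (w * (1 + l))) + (0.728 + 1.92 * l) * l ^ 2) *
        dwellPoly w l := by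
  unfold dwellPoly
  have hlw := mul_nonneg hl hw
  have hl2 := mul_nonneg hl hl
  have hl3 := mul_nonneg hl2 hl
  nlinarith [mul_nonneg hlw (sq_nonneg (l - 0.7)), mul_nonneg hlw (sq_nonneg (w - 0.33)),
    mul_nonneg hl3 (sq_nonneg (w - 0.33)), mul_nonneg hl2 (sq_nonneg (w - 0.33)),
    mul_nonneg hl2 (sq_nonneg (l - 0.7)), mul_nonneg (mul_nonneg hl2 hw) (sq_nonneg (l - 0.7)),
    mul_nonneg (mul_nonneg hl3 hw) (sq_nonneg (l - 0.7)), mul_nonneg hl2 (sq_nonneg (w - 0.5 * l)),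
    mul_nonneg hl3 (sq_nonneg (w - 0.5 * l)), mul_nonneg hlw (sq_nonneg (w - 0.5 * l)),
    mul_nonneg hl2 hw, mul_nonneg hl3 hw, mul_nonneg hlw hlw, mul_nonneg hlw hw,
    mul_nonneg hw (sq_nonneg (l - 0.7)), mul_nonneg hw (sq_nonneg (w - 0.33)),
    mul_nonneg (mul_nonneg hl3 hw) (sq_nonneg (w - 0.5 * l)),
    mul_nonneg (mul_nonneg hl2 hw) (sq_nonneg (w - 0.5 * l)),
    mul_nonneg hl3 (mul_nonneg hlw hw), mul_nonneg hl2 (mul_nonneg hlw hw)]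

theorem coupling_poly_le_of_two_le (hl : 0 ≤ l) (h2 : 2 ≤ w) :
    (4.5 + 3.27 * (w + l)) * l ^ 2 ≤ 0.3 * (0.9 + l) * dwellPoly w l := by
  have hw : 0 ≤ w := zero_le_two.trans h2
  unfold dwellPoly
  nlinarith [mul_nonneg hl (sq_nonneg (w - 0.5 * l)), mul_nonneg hw (sq_nonneg (w - 0.5 * l)),
    mul_nonneg hl hw, mul_nonneg (mul_nonneg hl hw) (sub_nonneg.2 h2),
    mul_nonneg (mul_nonneg hl hl) (sub_nonneg.2 h2),
    mul_nonneg (mul_nonneg hl hl) (sq_nonneg (l - 3.2)), mul_nonneg hl (sq_nonneg (l - 3.2)),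
    mul_nonneg hl (sq_nonneg (w - 2)), sq_nonneg (w - 0.5 * l),
    mul_nonneg (mul_nonneg hl hl) (mul_nonneg hl hw),
    mul_nonneg (mul_nonneg hl hw) (mul_nonneg hl hw)]

theorem one_add_mul_one_add_mul_sq_le {u a : ℝ} (hu : 0 ≤ u) (hu1 : u ≤ 1) (ha : 0 ≤ a)
    (hua : u * a ≤ 1.3) :
    (1 + 0.4445 * u) * (1 + u * a) ^ 2 ≤ 1 + u * (0.4445 + 4.768 * a) := by
  have hua0 : 0 ≤ u * a := mul_nonneg hu ha
  have hsq : (u * a) * (u * a) ≤ 1.3 * (u * a) := mul_le_mul_of_nonneg_right hua hua0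
  have hmul : (u * a) * u ≤ (u * a) * 1 := mul_le_mul_of_nonneg_left hu1 hua0
  have hcube : (u * a) * (u * a) * u ≤ 1.3 * (u * a) * u := mul_le_mul_of_nonneg_right hsq hu
  linarith

end Polynomials

/-- The relations between the convexity constant `m`, the Lipschitz constant `w`, the trigger
parameter `κ`, an eigenvalue `l` and the dwell time `Δ` that make the mode dissipation definite. By
`tight`, the parameter `κ` is the smallest one that `half_le` and `sq_le` allow. -/
structure GainBounds (m w κ l Δ : ℝ) : Prop where
  m_pos : 0 < m
  m_lt : m < w
  half_le : 1 / 2 ≤ κ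
  sq_le : w ^ 2 ≤ 4 * m * κ
  tight : κ = 1 / 2 ∨ 4 * m * κ = w ^ 2
  l_nonneg : 0 ≤ l
  Δ_pos : 0 < Δ
  dwell : Δ * dwellPoly w l ≤ 2.83 * m

/-- The reciprocal of the cross weight of the Lyapunov function in the limit `Δ → 0`. -/
noncomputable def crossGain (m w κ l : ℝ) : ℝ := 4 * κ + 2 * l - 0.4 * (w - m)

/-- The weight `b` of the product `y η` of output and integrator errors in the Lyapunov function of
a mode with eigenvalue `l`. -/
noncomputable def crossWeight (m w κ l Δ : ℝ) : ℝ := 1 / crossGain m w κ l + 0.85 * Δ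

namespace GainBounds

variable {m w κ l Δ : ℝ}

theorem w_pos (H : GainBounds m w κ l Δ) : 0 < w := H.m_pos.trans H.m_lt

theorem κ_pos (H : GainBounds m w κ l Δ) : 0 < κ := one_half_pos.trans_le H.half_le

theorem w_sub_m_pos (H : GainBounds m w κ l Δ) : 0 < w - m := sub_pos.2 H.m_lt

theorem dwellPoly_pos (H : GainBounds m w κ l Δ) : 0 < dwellPoly w l :=
  OptimalConsensus.dwellPoly_pos H.w_pos.le H.l_nonneg

theorem sub_le (H : GainBounds m w κ l Δ) : w - m ≤ κ := by
  have h : 4 * m * (w - m) ≤ 4 * m * κ := by linarith [H.sq_le, sq_nonneg (w - 2 * m)]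
  exact le_of_mul_le_mul_left h (by linarith [H.m_pos])

theorem crossGain_ge (H : GainBounds m w κ l Δ) : 3.6 * κ + 2 * l ≤ crossGain m w κ l := by
  unfold crossGain
  linarith [H.sub_le]

theorem crossGain_pos (H : GainBounds m w κ l Δ) : 0 < crossGain m w κ l := by
  linarith [H.crossGain_ge, H.half_le, H.l_nonneg]

theorem le_crossGain (H : GainBounds m w κ l Δ) : w ≤ crossGain m w κ l := by
  have h : m * w ≤ m * (4 * κ - 0.4 * (w - m)) := by
    nlinarith [H.sq_le, mul_pos H.w_pos H.w_sub_m_pos, mul_pos H.w_sub_m_pos H.w_sub_m_pos]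
  have := le_of_mul_le_mul_left h H.m_pos
  unfold crossGain
  linarith [H.l_nonneg]

theorem crossWeight_pos (H : GainBounds m w κ l Δ) : 0 < crossWeight m w κ l Δ := by
  have := H.crossGain_pos
  have := H.Δ_pos
  unfold crossWeight
  positivity

theorem dwell_mul_le (H : GainBounds m w κ l Δ) {a c : ℝ} (ha : 0 ≤ a)
    (h : 2.83 * (m * a) ≤ c * dwellPoly w l) : Δ * a ≤ c := by
  refine le_of_mul_le_mul_right ?_ H.dwellPoly_pos
  linarith [mul_le_mul_of_nonneg_right H.dwell ha]

theorem dwell_mul_sub_le (H : GainBounds m w κ l Δ) : Δ * (w - m) ≤ 0.073 := by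
  refine H.dwell_mul_le H.w_sub_m_pos.le ?_
  linarith [sq_nonneg (w - 2 * m), sq_nonneg w, sq_le_dwellPoly H.w_pos.le H.l_nonneg]

theorem dwell_mul_w_le (H : GainBounds m w κ l Δ) : Δ * w ≤ 0.29 := by
  refine H.dwell_mul_le H.w_pos.le ?_
  linarith [sq_nonneg w, mul_le_mul_of_nonneg_right H.m_lt.le H.w_pos.le,
    sq_le_dwellPoly H.w_pos.le H.l_nonneg]

theorem dwell_mul_m_le (H : GainBounds m w κ l Δ) : Δ * m ≤ 0.29 :=
  (mul_le_mul_of_nonneg_left H.m_lt.le H.Δ_pos.le).trans H.dwell_mul_w_le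

theorem dwell_mul_l_le (H : GainBounds m w κ l Δ) : Δ * l ≤ 0.14 := by
  refine H.dwell_mul_le H.l_nonneg ?_
  linarith [mul_le_mul_of_nonneg_right H.m_lt.le H.l_nonneg,
    mul_le_dwellPoly H.w_pos.le H.l_nonneg]

theorem m_mul_crossGain_le (H : GainBounds m w κ l Δ) :
    m * crossGain m w κ l ≤ 2 * (w * (1 + l)) ∧ w ≤ 2 ∨
      m * crossGain m w κ l ≤ w ^ 2 + 2 * w * l := by
  have hm := H.m_pos
  have hw := H.w_pos
  have hl := H.l_nonneg
  have hmp : 0 ≤ m * (w - m) := mul_nonneg hm.le H.w_sub_m_pos.le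
  have hlp : 0 ≤ l * (w - m) := mul_nonneg hl H.w_sub_m_pos.le
  unfold crossGain
  rcases H.tight with rfl | htight
  · refine .inl ⟨by linarith [H.m_lt], ?_⟩
    have hsq : w * w ≤ w * 2 := by linarith [H.sq_le, H.m_lt]
    exact le_of_mul_le_mul_left hsq hw
  · exact .inr (by linarith)

theorem m_mul_crossGain_le_of_le_two (H : GainBounds m w κ l Δ) (hw2 : w ≤ 2) :
    m * crossGain m w κ l ≤ 2 * (w * (1 + l)) := by
  rcases H.m_mul_crossGain_le with ⟨h, -⟩ | h
  · exact h
  · linarith [mul_le_mul_of_nonneg_left hw2 H.w_pos.le]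

theorem dwell_mul_crossGain_mul_le (H : GainBounds m w κ l Δ) {a c : ℝ} (ha : 0 ≤ a)
    (hsmall : 5.66 * (w * (1 + l)) * a ≤ c * dwellPoly w l)
    (hlarge : 2.83 * (w ^ 2 + 2 * w * l) * a ≤ c * dwellPoly w l) :
    Δ * (crossGain m w κ l * a) ≤ c := by
  refine H.dwell_mul_le (mul_nonneg H.crossGain_pos.le ha) ?_
  rcases H.m_mul_crossGain_le with ⟨h, -⟩ | h <;>
    linarith [mul_le_mul_of_nonneg_right h ha]

theorem dwell_mul_crossGain_le (H : GainBounds m w κ l Δ) : Δ * crossGain m w κ l ≤ 1 := by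
  have hw := H.w_pos.le
  simpa only [mul_one] using H.dwell_mul_crossGain_mul_le zero_le_one
    (by simpa only [mul_one, one_mul] using mul_one_add_le_dwellPoly hw H.l_nonneg)
    (by simpa only [mul_one, one_mul] using sq_add_mul_le_dwellPoly hw H.l_nonneg)

theorem dwell_mul_crossGain_mul_add_le (H : GainBounds m w κ l Δ) :
    Δ * crossGain m w κ l * (0.85 + 0.684 * (m + l)) ≤ 1.3 := by
  have hw := H.w_pos.le
  have hl := H.l_nonneg
  have hΔg : 0 ≤ Δ * crossGain m w κ l := (mul_pos H.Δ_pos H.crossGain_pos).le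
  calc Δ * crossGain m w κ l * (0.85 + 0.684 * (m + l))
      ≤ Δ * crossGain m w κ l * (0.85 + 0.684 * (w + l)) := by
        gcongr
        exact H.m_lt.le
    _ = Δ * (crossGain m w κ l * (0.85 + 0.684 * (w + l))) := mul_assoc _ _ _
    _ ≤ 1.3 := H.dwell_mul_crossGain_mul_le (by positivity)
        (mul_one_add_mul_le_dwellPoly hw hl) (sq_add_mul_mul_le_dwellPoly hw hl)

theorem dwell_mul_drift_le (H : GainBounds m w κ l Δ) :
    Δ * (0.85 * l + 0.342 * (m + l) ^ 2) ≤ 0.59 * m := by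
  have hm := H.m_pos
  have hl := H.l_nonneg
  refine H.dwell_mul_le (by positivity) ?_
  have hmono : (m + l) ^ 2 ≤ (w + l) ^ 2 := by
    gcongr
    exact H.m_lt.le
  have hpoly : 2.83 * (0.85 * l + 0.342 * (m + l) ^ 2) ≤ 0.59 * dwellPoly w l := by
    linarith [add_sq_le_dwellPoly H.w_pos.le hl]
  linarith [mul_le_mul_of_nonneg_left hpoly hm.le]

theorem dwell_mul_error_le (H : GainBounds m w κ l Δ) :
    Δ * (0.877 * κ * l + 0.7805 * l ^ 2) ≤ 0.4 * κ := by
  have hw := H.w_pos.le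
  have hl := H.l_nonneg
  have hm := H.m_pos
  have hκ := H.κ_pos
  refine H.dwell_mul_le (by positivity) ?_
  have hml := mul_le_mul_of_nonneg_left (mul_le_mul_of_nonneg_right H.m_lt.le hl) hκ.le
  rcases le_total w 2 with h2 | h2
  · have hmκ : m ≤ κ * (2 * w) := by
      linarith [H.m_lt, mul_le_mul_of_nonneg_right H.half_le hw]
    linarith [mul_le_mul_of_nonneg_right hmκ (sq_nonneg l),
      mul_le_mul_of_nonneg_left (mul_add_sq_mul_le_dwellPoly_of_le hw hl h2) hκ.le]
  · have hmκ : m ≤ κ * 4 := by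
      refine le_of_mul_le_mul_left ?_ hm
      linarith [H.sq_le, pow_le_pow_left₀ hm.le H.m_lt.le 2]
    linarith [mul_le_mul_of_nonneg_right hmκ (sq_nonneg l),
      mul_le_mul_of_nonneg_left (mul_add_sq_mul_le_dwellPoly_of_ge hl h2) hκ.le]

theorem dwell_mul_crossGain_mul_dwellPoly_le (H : GainBounds m w κ l Δ) :
    Δ * crossGain m w κ l * dwellPoly w l ≤ 2.83 * (m * crossGain m w κ l) := by
  linarith [mul_le_mul_of_nonneg_right H.dwell H.crossGain_pos.le]

theorem dwell_mul_crossGain_mul_coupling_le (H : GainBounds m w κ l Δ) :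
    Δ * crossGain m w κ l * ((4.5 + 3.27 * (m + l)) * l ^ 2) ≤
      0.3 * (0.9 + l) * (Δ * crossGain m w κ l * dwellPoly w l)
        + (0.728 + 1.92 * l) * l ^ 2 := by
  have hw := H.w_pos
  have hl := H.l_nonneg
  have hrest : 0 ≤ (0.728 + 1.92 * l) * l ^ 2 := by positivity
  have hu : 0 ≤ Δ * crossGain m w κ l := (mul_pos H.Δ_pos H.crossGain_pos).le
  have hmono : (4.5 + 3.27 * (m + l)) * l ^ 2 ≤ (4.5 + 3.27 * (w + l)) * l ^ 2 := by
    gcongr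
    exact H.m_lt.le
  refine (mul_le_mul_of_nonneg_left hmono hu).trans ?_
  rcases le_total w 2 with h2 | h2
  · have hpoly : Δ * crossGain m w κ l * dwellPoly w l ≤ 5.66 * (w * (1 + l)) := by
      linarith [H.dwell_mul_crossGain_mul_dwellPoly_le, H.m_mul_crossGain_le_of_le_two h2]
    have hpos : 0 < 5.66 * (w * (1 + l)) := by positivity
    refine le_of_mul_le_mul_right ?_ hpos
    linarith [mul_le_mul_of_nonneg_left (coupling_poly_le hw.le hl) hu,
      mul_le_mul_of_nonneg_left hpoly hrest]
  · linarith [mul_le_mul_of_nonneg_left (coupling_poly_le_of_two_le hl h2) hu]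

theorem one_add_dwell_mul_coupling_lt (H : GainBounds m w κ l Δ) :
    (1 + Δ * crossGain m w κ l * (4.5 + 3.27 * (m + l))) * l ^ 2 <
      2.4 * (0.9 + l) * (0.354 * (m * crossGain m w κ l) + 0.8 * l ^ 2) := by
  have hl := H.l_nonneg
  have hmg : 0 < m * crossGain m w κ l := mul_pos H.m_pos H.crossGain_pos
  have hdwell : 0.3 * (Δ * crossGain m w κ l * dwellPoly w l) <
      0.8496 * (m * crossGain m w κ l) := by
    linarith [H.dwell_mul_crossGain_mul_dwellPoly_le]
  have hscaled := mul_lt_mul_of_pos_left hdwell (by linarith : 0 < 0.9 + l)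
  linarith [H.dwell_mul_crossGain_mul_coupling_le]

end GainBounds

theorem seriesGain_pos {a b : ℝ} (ha : 0 < a) (hb : 0 < b) : 0 < seriesGain a b := by
  unfold seriesGain
  positivity

theorem seriesGain_mul_inv_add_inv {a b : ℝ} (ha : 0 < a) (hb : 0 < b) :
    seriesGain a b * (1 / a + 1 / b) = 1 := by
  unfold seriesGain
  field_simp
  ring

namespace GainBounds

variable {m w κ l Δ : ℝ}

theorem add_half_pos (H : GainBounds m w κ l Δ) : 0 < κ + l / 2 := by
  linarith [H.κ_pos, H.l_nonneg]

theorem inv_crossGain_pos (H : GainBounds m w κ l Δ) : 0 < 1 / crossGain m w κ l :=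
  one_div_pos.2 H.crossGain_pos

theorem sub_mul_inv_le (H : GainBounds m w κ l Δ) :
    (w - m) * (1 / crossGain m w κ l) ≤ 0.278 := by
  rw [mul_one_div, div_le_iff₀ H.crossGain_pos]
  linarith [H.crossGain_ge, H.sub_le, H.l_nonneg, H.half_le]

theorem Δ_le_inv (H : GainBounds m w κ l Δ) : Δ ≤ 1 / crossGain m w κ l :=
  (le_div_iff₀ H.crossGain_pos).2 H.dwell_mul_crossGain_le

theorem sub_mul_third_lt_one (H : GainBounds m w κ l Δ) : (w - m) * (Δ / 3) < 1 := by
  linarith [H.dwell_mul_sub_le]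

theorem sectorGain_pos (H : GainBounds m w κ l Δ) : 0 < feedbackGain (w - m) (Δ / 3) :=
  feedbackGain_pos H.w_sub_m_pos H.sub_mul_third_lt_one

theorem sectorGain_le (H : GainBounds m w κ l Δ) :
    feedbackGain (w - m) (Δ / 3) ≤ 1.025 * (w - m) := by
  unfold feedbackGain
  rw [div_le_iff₀ (sub_pos.2 H.sub_mul_third_lt_one)]
  linarith [mul_le_mul_of_nonneg_left H.dwell_mul_sub_le H.w_sub_m_pos.le, H.w_sub_m_pos]

theorem sectorGain_mul_third_le (H : GainBounds m w κ l Δ) :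
    feedbackGain (w - m) (Δ / 3) * (Δ / 3) ≤ 0.025 := by
  linarith [mul_le_mul_of_nonneg_right H.sectorGain_le H.Δ_pos.le, H.dwell_mul_sub_le]

theorem sectorGain_le_add_sq (H : GainBounds m w κ l Δ) :
    feedbackGain (w - m) (Δ / 3) ≤ (w - m) + 0.342 * Δ * (w - m) ^ 2 := by
  have hpΔ : 0 ≤ (w - m) * (Δ / 3) := mul_nonneg H.w_sub_m_pos.le (by linarith [H.Δ_pos])
  calc feedbackGain (w - m) (Δ / 3)
      = (w - m) + (w - m) * (Δ / 3) * feedbackGain (w - m) (Δ / 3) :=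
        feedbackGain_eq_add_mul H.sub_mul_third_lt_one
    _ ≤ (w - m) + (w - m) * (Δ / 3) * (1.025 * (w - m)) := by
        gcongr
        exact H.sectorGain_le
    _ ≤ (w - m) + 0.342 * Δ * (w - m) ^ 2 := by
        linarith [mul_nonneg hpΔ H.w_sub_m_pos.le]

theorem dwellGain_eq (H : GainBounds m w κ l Δ) :
    feedbackGain (Δ / 3) (w - m) =
      Δ / 3 * (1 + feedbackGain (w - m) (Δ / 3) * (Δ / 3)) := by
  rw [feedbackGain_swap H.sub_mul_third_lt_one]
  ring

theorem dwellGain_pos (H : GainBounds m w κ l Δ) : 0 < feedbackGain (Δ / 3) (w - m) :=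
  feedbackGain_pos (by linarith [H.Δ_pos]) (by linarith [H.sub_mul_third_lt_one])

theorem dwellGain_le (H : GainBounds m w κ l Δ) :
    feedbackGain (Δ / 3) (w - m) ≤ 0.342 * Δ := by
  rw [H.dwellGain_eq]
  linarith [mul_le_mul_of_nonneg_left H.sectorGain_mul_third_le H.Δ_pos.le, H.Δ_pos]

theorem dwellGain_mul_m_le (H : GainBounds m w κ l Δ) :
    feedbackGain (Δ / 3) (w - m) * m ≤ 0.1 := by
  linarith [mul_le_mul_of_nonneg_right H.dwellGain_le H.m_pos.le, H.dwell_mul_m_le]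

theorem crossWeight_mul_sub_le (H : GainBounds m w κ l Δ) :
    crossWeight m w κ l Δ * (w - m) ≤ 0.3401 := by
  unfold crossWeight
  linarith [H.sub_mul_inv_le, H.dwell_mul_sub_le]

theorem inv_sq_mul_sub_le (H : GainBounds m w κ l Δ) :
    1.436 * ((w - m) * (1 / crossGain m w κ l)) * (1 / crossGain m w κ l) ≤
      4 * (1 / crossGain m w κ l) - 1 / (κ + l / 2) := by
  have hbpos := H.inv_crossGain_pos
  have hz0 : 0 ≤ (w - m) * (1 / crossGain m w κ l) := mul_nonneg H.w_sub_m_pos.le hbpos.le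
  have hkpos : 0 < 1 / (κ + l / 2) := one_div_pos.2 H.add_half_pos
  have hKk : (κ + l / 2) * (1 / (κ + l / 2)) = 1 := mul_one_div_cancel H.add_half_pos.ne'
  have hgb : crossGain m w κ l * (1 / crossGain m w κ l) = 1 :=
    mul_one_div_cancel H.crossGain_pos.ne'
  have hz := H.sub_mul_inv_le
  generalize 1 / crossGain m w κ l = b at *
  generalize 1 / (κ + l / 2) = k at *
  have hrel : k = 4 * b - 0.4 * ((w - m) * b) * k := by
    unfold crossGain at hgb
    linear_combination 4 * b * hKk - k * hgb
  have hk : 3.59 * b ≤ k := by linarith [mul_le_mul_of_nonneg_right hz hkpos.le]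
  linarith [mul_le_mul_of_nonneg_left hk hz0]

theorem sectorGain_mul_crossWeight_sq_le (H : GainBounds m w κ l Δ) :
    feedbackGain (w - m) (Δ / 3) * crossWeight m w κ l Δ ^ 2 ≤
      (w - m) * (1 / crossGain m w κ l) * (1 / crossGain m w κ l)
        + 1.75 * ((w - m) * (1 / crossGain m w κ l) * Δ) + 0.081 * Δ := by
  have hb := H.inv_crossGain_pos
  have hΔ := H.Δ_pos
  have hz0 : 0 ≤ (w - m) * (1 / crossGain m w κ l) := mul_nonneg H.w_sub_m_pos.le hb.le
  have hz := H.sub_mul_inv_le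
  unfold crossWeight
  generalize 1 / crossGain m w κ l = b at *
  have hzz : (w - m) * b * ((w - m) * b) ≤ 0.278 * 0.278 := mul_le_mul hz hz hz0 (by norm_num)
  have hqb : feedbackGain (w - m) (Δ / 3) * b ≤ 1.025 * ((w - m) * b) := by
    linarith [mul_le_mul_of_nonneg_right H.sectorGain_le hb.le]
  linarith [mul_nonneg hz0 hΔ.le,
    mul_le_mul_of_nonneg_right H.sectorGain_le_add_sq (sq_nonneg b),
    mul_le_mul_of_nonneg_right hzz hΔ.le, mul_le_mul_of_nonneg_right hqb hΔ.le,
    mul_le_mul_of_nonneg_right H.sectorGain_mul_third_le hΔ.le]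

theorem integrator_gain_lt (H : GainBounds m w κ l Δ) :
    1 / (κ + l / 2) + 1.6 * Δ <
      4 * crossWeight m w κ l Δ - 4 * (Δ / 3)
        - feedbackGain (w - m) (Δ / 3) * crossWeight m w κ l Δ ^ 2 := by
  have hb := H.inv_crossGain_pos
  have hΔ := H.Δ_pos
  have hz0 : 0 ≤ (w - m) * (1 / crossGain m w κ l) := mul_nonneg H.w_sub_m_pos.le hb.le
  have hzΔ := mul_le_mul_of_nonneg_left H.Δ_le_inv hz0
  have hzΔ' := mul_le_mul_of_nonneg_right H.sub_mul_inv_le hΔ.le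
  have hcw : crossWeight m w κ l Δ = 1 / crossGain m w κ l + 0.85 * Δ := rfl
  linarith [H.inv_sq_mul_sub_le, H.sectorGain_mul_crossWeight_sq_le]

theorem crossWeight_mul_add_sectorGain_le (H : GainBounds m w κ l Δ) :
    crossWeight m w κ l Δ * (m + feedbackGain (w - m) (Δ / 3)) ≤
      1 / crossGain m w κ l * w + 0.2551 := by
  have hB := H.crossWeight_pos.le
  have hmono := mul_le_mul_of_nonneg_left H.sectorGain_le_add_sq hB
  have hsq : crossWeight m w κ l Δ * (w - m) * (Δ * (w - m)) ≤ 0.3401 * 0.073 :=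
    mul_le_mul H.crossWeight_mul_sub_le H.dwell_mul_sub_le
      (mul_nonneg H.Δ_pos.le H.w_sub_m_pos.le) (by norm_num)
  have hw : crossWeight m w κ l Δ * w ≤ 1 / crossGain m w κ l * w + 0.2465 := by
    unfold crossWeight
    linarith [H.dwell_mul_w_le]
  linarith

theorem crossWeight_loss_le (H : GainBounds m w κ l Δ) :
    4 * (Δ / 3) ≤ crossWeight m w κ l Δ *
      (2 - crossWeight m w κ l Δ * (m + feedbackGain (w - m) (Δ / 3))
        - 4 * (feedbackGain (Δ / 3) (w - m) * m)) := by
  have hb := H.inv_crossGain_pos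
  have hbw : 1 / crossGain m w κ l * w ≤ 1 := by
    rw [one_div_mul_eq_div, div_le_one H.crossGain_pos]
    exact H.le_crossGain
  have hDm : feedbackGain (Δ / 3) (w - m) * m ≤ 0.0992 := by
    linarith [mul_le_mul_of_nonneg_right H.dwellGain_le H.m_pos.le, H.dwell_mul_m_le]
  have hcw : crossWeight m w κ l Δ = 1 / crossGain m w κ l + 0.85 * Δ := rfl
  calc 4 * (Δ / 3)
      ≤ crossWeight m w κ l Δ * (1.348 - 1 / crossGain m w κ l * w) := by
        rw [hcw]
        linarith [mul_nonneg (sub_nonneg.2 hbw) (sub_nonneg.2 H.Δ_le_inv),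
          mul_nonneg (sub_nonneg.2 hbw) H.Δ_pos.le,
          mul_le_mul_of_nonneg_left H.dwell_mul_w_le hb.le, H.Δ_le_inv, H.Δ_pos]
    _ ≤ _ := mul_le_mul_of_nonneg_left
        (by linarith [H.crossWeight_mul_add_sectorGain_le]) H.crossWeight_pos.le

end GainBounds

namespace GainBounds

variable {m w κ l Δ : ℝ}

theorem dwellRate_pos (H : GainBounds m w κ l Δ) : 0 < 5 / (8 * Δ) :=
  div_pos (by norm_num) (by linarith [H.Δ_pos])

theorem one_lt_seriesGain_mul (H : GainBounds m w κ l Δ) :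
    1 < seriesGain (κ + l / 2) (5 / (8 * Δ)) *
      (4 * crossWeight m w κ l Δ - 4 * (Δ / 3)
        - feedbackGain (w - m) (Δ / 3) * crossWeight m w κ l Δ ^ 2) := by
  have hinv : 1 / (5 / (8 * Δ)) = 1.6 * Δ := by
    rw [one_div_div]
    ring
  rw [← seriesGain_mul_inv_add_inv H.add_half_pos H.dwellRate_pos, hinv]
  exact mul_lt_mul_of_pos_left H.integrator_gain_lt
    (seriesGain_pos H.add_half_pos H.dwellRate_pos)

theorem one_add_crossWeight_mul_sq_lt (H : GainBounds m w κ l Δ) :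
    (1 + crossWeight m w κ l Δ * m) ^ 2 <
      (m - feedbackGain (Δ / 3) (w - m) * m ^ 2 + seriesGain (κ + l / 2) (5 / (8 * Δ))) *
        (4 * crossWeight m w κ l Δ - 4 * (Δ / 3)
          - feedbackGain (w - m) (Δ / 3) * crossWeight m w κ l Δ ^ 2) := by
  have hDm : 0 ≤ feedbackGain (Δ / 3) (w - m) * m ^ 2 :=
    mul_nonneg H.dwellGain_pos.le (sq_nonneg m)
  have hgain : 4 * crossWeight m w κ l Δ - 4 * (Δ / 3)
      - feedbackGain (w - m) (Δ / 3) * crossWeight m w κ l Δ ^ 2 ≤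
        4 * crossWeight m w κ l Δ := by
    linarith [mul_nonneg H.sectorGain_pos.le (sq_nonneg (crossWeight m w κ l Δ)), H.Δ_pos]
  linarith [H.one_lt_seriesGain_mul, mul_le_mul_of_nonneg_left hgain hDm,
    mul_le_mul_of_nonneg_left H.crossWeight_loss_le H.m_pos.le]

theorem eq_zero_of_broadcast_eq_zero (H : GainBounds m w κ l Δ) {y h η e : ℝ}
    (hle : modeDissipation m (w - m) (κ + l / 2) (5 / (8 * Δ)) (Δ / 3) (crossWeight m w κ l Δ) l
      y h η e 0 ≤ 0) : y = 0 ∧ h = 0 ∧ η = 0 ∧ e = 0 := by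
  have hm := H.m_pos
  have hΔ := H.Δ_pos
  refine eq_zero_of_modeDissipation_nonpos_of_broadcast_eq_zero H.w_sub_m_pos hm.le (by positivity)
    H.sub_mul_third_lt_one (add_pos H.add_half_pos H.dwellRate_pos) ?_ ?_ ?_
    H.one_add_crossWeight_mul_sq_lt hle
  · unfold crossWeight
    linarith [H.Δ_le_inv]
  · linarith [mul_le_mul_of_nonneg_right H.sectorGain_le H.crossWeight_pos.le,
      H.crossWeight_mul_sub_le]
  · linarith [mul_le_mul_of_nonneg_right H.dwellGain_mul_m_le hm.le,
      seriesGain_pos H.add_half_pos H.dwellRate_pos]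

theorem crossWeight_mul_crossGain (H : GainBounds m w κ l Δ) :
    crossWeight m w κ l Δ * crossGain m w κ l = 1 + 0.85 * (Δ * crossGain m w κ l) := by
  have := H.crossGain_pos.ne'
  unfold crossWeight
  field_simp

theorem le_crossGain_mul_outputGain (H : GainBounds m w κ l Δ) :
    0.354 * (m * crossGain m w κ l) + 0.8 * l ^ 2 ≤
      crossGain m w κ l *
        outputGain m l (crossWeight m w κ l Δ) (feedbackGain (Δ / 3) (w - m)) := by
  have hg := H.crossGain_pos
  have hl := H.l_nonneg
  have hA : 0.41 * m + l / 2 - 1 / crossGain m w κ l * l ≤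
      outputGain m l (crossWeight m w κ l Δ) (feedbackGain (Δ / 3) (w - m)) := by
    unfold outputGain crossWeight
    linarith [mul_le_mul_of_nonneg_right H.dwellGain_le (sq_nonneg (m + l)), H.dwell_mul_drift_le]
  have hsub : (w - m) ^ 2 ≤ 4 * m * κ :=
    (pow_le_pow_left₀ H.w_sub_m_pos.le (by linarith [H.m_pos]) 2).trans H.sq_le
  have hmg : m * (3.6 * κ) ≤ m * crossGain m w κ l :=
    mul_le_mul_of_nonneg_left (by linarith [H.crossGain_ge]) H.m_pos.le
  have hlg : l * (l - 0.2 * (w - m)) ≤ l * (crossGain m w κ l / 2 - 1) :=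
    mul_le_mul_of_nonneg_left (by unfold crossGain; linarith [H.half_le]) hl
  calc 0.354 * (m * crossGain m w κ l) + 0.8 * l ^ 2
      ≤ 0.41 * (m * crossGain m w κ l) + l * (crossGain m w κ l / 2 - 1) := by
        linarith [sq_nonneg (l - 0.5 * (w - m)), mul_pos H.m_pos hg]
    _ = crossGain m w κ l * (0.41 * m + l / 2 - 1 / crossGain m w κ l * l) := by
        field_simp
        ring
    _ ≤ _ := mul_le_mul_of_nonneg_left hA hg.le

theorem outputGain_pos (H : GainBounds m w κ l Δ) :
    0 < outputGain m l (crossWeight m w κ l Δ) (feedbackGain (Δ / 3) (w - m)) := by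
  have hg := H.crossGain_pos
  refine pos_of_mul_pos_right (a := crossGain m w κ l) ?_ hg.le
  linarith [H.le_crossGain_mul_outputGain, mul_pos H.m_pos hg, sq_nonneg l]

theorem one_add_mul_seriesGain (H : GainBounds m w κ l Δ) :
    (1 + 1.6 * ((κ + l / 2) * Δ)) * seriesGain (κ + l / 2) (5 / (8 * Δ)) = κ + l / 2 := by
  have hΔ := H.Δ_pos
  have hK := H.add_half_pos
  generalize κ + l / 2 = K at hK ⊢
  unfold seriesGain
  field_simp
  ring

theorem le_one_add_mul_errorGain (H : GainBounds m w κ l Δ) :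
    0.6 * κ ≤ (1 + 1.6 * ((κ + l / 2) * Δ)) *
      errorGain (seriesGain (κ + l / 2) (5 / (8 * Δ))) l (feedbackGain (Δ / 3) (w - m)) := by
  have hΔ := H.Δ_pos.le
  have hl := H.l_nonneg
  have hκ := H.κ_pos
  have : 0 ≤ (κ + l / 2) * Δ := mul_nonneg H.add_half_pos.le hΔ
  have hD : (1 + 1.6 * ((κ + l / 2) * Δ)) * (feedbackGain (Δ / 3) (w - m) * l ^ 2) ≤
      (1 + 1.6 * ((κ + l / 2) * Δ)) * (0.342 * Δ * l ^ 2) := by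
    gcongr
    exact H.dwellGain_le
  have hlΔ : (κ + l / 2) * Δ * l * (Δ * l) ≤ (κ + l / 2) * Δ * l * 0.14 :=
    mul_le_mul_of_nonneg_left H.dwell_mul_l_le (by positivity)
  unfold errorGain
  linarith [H.one_add_mul_seriesGain, H.dwell_mul_error_le, mul_nonneg hκ.le (mul_nonneg hΔ hl),
    mul_nonneg hΔ (sq_nonneg l)]

theorem couplingGain_mul_crossGain_le (H : GainBounds m w κ l Δ) :
    couplingGain m l (crossWeight m w κ l Δ) (feedbackGain (Δ / 3) (w - m)) *
        crossGain m w κ l ≤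
      l * (1 + Δ * crossGain m w κ l * (0.85 + 0.684 * (m + l))) := by
  have hm := H.m_pos
  have hl := H.l_nonneg
  have hg := H.crossGain_pos
  have hD : feedbackGain (Δ / 3) (w - m) * (l * (m + l) * crossGain m w κ l) ≤
      0.342 * Δ * (l * (m + l) * crossGain m w κ l) :=
    mul_le_mul_of_nonneg_right H.dwellGain_le (by positivity)
  unfold couplingGain
  linear_combination l * H.crossWeight_mul_crossGain + 2 * hD

theorem couplingGain_sq_le (H : GainBounds m w κ l Δ) :
    (1 + 1.6 * ((κ + l / 2) * Δ)) *
        (couplingGain m l (crossWeight m w κ l Δ) (feedbackGain (Δ / 3) (w - m)) *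
          crossGain m w κ l) ^ 2 ≤
      (1 + Δ * crossGain m w κ l * (4.5 + 3.27 * (m + l))) * l ^ 2 := by
  have hm := H.m_pos
  have hl := H.l_nonneg
  have hg := H.crossGain_pos
  have hΔ := H.Δ_pos
  have hu : 0 ≤ Δ * crossGain m w κ l := (mul_pos hΔ hg).le
  have hcoupling : 0 ≤ couplingGain m l (crossWeight m w κ l Δ) (feedbackGain (Δ / 3) (w - m)) := by
    have := H.crossWeight_pos
    have := H.dwellGain_pos
    unfold couplingGain
    positivity
  have hK : 1.6 * ((κ + l / 2) * Δ) ≤ 0.4445 * (Δ * crossGain m w κ l) := by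
    linarith [mul_le_mul_of_nonneg_left H.crossGain_ge hΔ.le, mul_nonneg hΔ.le hl]
  calc _ ≤ (1 + 0.4445 * (Δ * crossGain m w κ l)) *
        (l * (1 + Δ * crossGain m w κ l * (0.85 + 0.684 * (m + l)))) ^ 2 :=
        mul_le_mul (by linarith)
          (pow_le_pow_left₀ (by positivity) H.couplingGain_mul_crossGain_le 2) (by positivity)
          (by positivity)
    _ = (1 + 0.4445 * (Δ * crossGain m w κ l)) *
        (1 + Δ * crossGain m w κ l * (0.85 + 0.684 * (m + l))) ^ 2 * l ^ 2 := by ring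
    _ ≤ (1 + Δ * crossGain m w κ l * (0.4445 + 4.768 * (0.85 + 0.684 * (m + l)))) * l ^ 2 := by
        gcongr
        exact one_add_mul_one_add_mul_sq_le hu H.dwell_mul_crossGain_le (by positivity)
          H.dwell_mul_crossGain_mul_add_le
    _ ≤ _ := by
        gcongr ?_ * l ^ 2
        linarith [mul_nonneg hu (add_nonneg hm.le hl)]

theorem couplingGain_sq_lt (H : GainBounds m w κ l Δ) :
    couplingGain m l (crossWeight m w κ l Δ) (feedbackGain (Δ / 3) (w - m)) ^ 2 <
      4 * outputGain m l (crossWeight m w κ l Δ) (feedbackGain (Δ / 3) (w - m)) *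
        errorGain (seriesGain (κ + l / 2) (5 / (8 * Δ))) l (feedbackGain (Δ / 3) (w - m)) := by
  have hm := H.m_pos
  have hl := H.l_nonneg
  have hg := H.crossGain_pos
  have hΔ := H.Δ_pos
  have hκ := H.κ_pos
  have hsq := H.couplingGain_sq_le
  have hout := H.le_crossGain_mul_outputGain
  have herr := H.le_one_add_mul_errorGain
  set g := crossGain m w κ l
  set A := outputGain m l (crossWeight m w κ l Δ) (feedbackGain (Δ / 3) (w - m))
  set C := errorGain (seriesGain (κ + l / 2) (5 / (8 * Δ))) l (feedbackGain (Δ / 3) (w - m))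
  set x := 1.6 * ((κ + l / 2) * Δ)
  have : 0 < 1 + x := by positivity
  have hκg : 0.9 + l ≤ κ * g := by
    linarith [mul_le_mul_of_nonneg_left H.crossGain_ge hκ.le,
      mul_le_mul_of_nonneg_right H.half_le (by positivity : 0 ≤ 3.6 * κ + 2 * l), H.half_le]
  have hgC : 2.4 * (0.9 + l) ≤ 4 * (g * ((1 + x) * C)) := by
    linarith [mul_le_mul_of_nonneg_left herr hg.le]
  refine lt_of_mul_lt_mul_left (a := (1 + x) * g ^ 2) ?_ (by positivity)
  calc (1 + x) * g ^ 2 * _ = (1 + x) * (_ * g) ^ 2 := by ring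
    _ < 2.4 * (0.9 + l) * (0.354 * (m * g) + 0.8 * l ^ 2) :=
        hsq.trans_lt H.one_add_dwell_mul_coupling_lt
    _ ≤ 4 * (g * ((1 + x) * C)) * (g * A) :=
        mul_le_mul hgC hout (by positivity) (by linarith)
    _ = (1 + x) * g ^ 2 * (4 * A * C) := by ring

theorem eq_zero_of_integrator_eq_zero (H : GainBounds m w κ l Δ) {y h e z : ℝ}
    (hle : modeDissipation m (w - m) (κ + l / 2) (5 / (8 * Δ)) (Δ / 3) (crossWeight m w κ l Δ) l
      y h 0 e z ≤ 0) : y = 0 ∧ h = 0 ∧ e = 0 ∧ z = 0 :=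
  eq_zero_of_modeDissipation_nonpos_of_integrator_eq_zero H.w_sub_m_pos H.sub_mul_third_lt_one
    (add_pos H.add_half_pos H.dwellRate_pos) H.outputGain_pos H.couplingGain_sq_lt hle

end GainBounds

/-- The mode dissipation as a quadratic form in the coordinates `(y, h, η, e, z)`. -/
noncomputable def modeDissipationForm (m p K ρ ν b l : ℝ) :
    QuadraticForm ℝ (EuclideanSpace ℝ (Fin 5)) :=
  QuadraticMap.ofPolar
    (fun x => modeDissipation m p K ρ ν b l (x 0) (x 1) (x 2) (x 3) (x 4))
    (fun a x => by
      simp only [modeDissipation, PiLp.smul_apply, smul_eq_mul]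
      ring)
    (fun x x' y => by
      simp only [QuadraticMap.polar, modeDissipation, PiLp.add_apply]
      ring)
    (fun a x y => by
      simp only [QuadraticMap.polar, modeDissipation, PiLp.add_apply, PiLp.smul_apply, smul_eq_mul]
      ring)

theorem GainBounds.exists_mode_decrease {m w κ l Δ κ' : ℝ} (H : GainBounds m w κ l Δ)
    (hκ : κ ≤ κ') :
    ∃ c : ℝ, ∃ δ > 0, ∀ y h η e z : ℝ,
      c * (η * z) + δ * (y ^ 2 + h ^ 2 + η ^ 2 + e ^ 2 + z ^ 2) ≤
        modeDissipation m (w - m) (κ' + l / 2) (5 / (8 * Δ)) (Δ / 3) (crossWeight m w κ l Δ) l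
          y h η e z := by
  let coord (i : Fin 5) : EuclideanSpace ℝ (Fin 5) →ₗ[ℝ] ℝ := (EuclideanSpace.proj i).toLinearMap
  obtain ⟨c, δ, hδ, hc⟩ := exists_mul_add_norm_sq_le_of_posDef_ker
    (Q := modeDissipationForm m (w - m) (κ + l / 2) (5 / (8 * Δ)) (Δ / 3) (crossWeight m w κ l Δ) l)
    (u := coord 2) (v := coord 4)
    (fun x hx hne => by
      contrapose! hne
      obtain ⟨hy, hh, he, hz⟩ := H.eq_zero_of_integrator_eq_zero
        (hne.trans_eq' (by rw [← show x 2 = 0 from hx]; rfl))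
      ext i
      fin_cases i <;> assumption)
    (fun x hx hne => by
      contrapose! hne
      obtain ⟨hy, hh, hη, he⟩ := H.eq_zero_of_broadcast_eq_zero
        (hne.trans_eq' (by rw [← show x 4 = 0 from hx]; rfl))
      ext i
      fin_cases i <;> assumption)
    ⟨!₂[0, 0, 1, 0, 1], by simp [coord]⟩ ⟨!₂[0, 0, 1, 0, -1], by simp [coord]⟩
  refine ⟨c, δ, hδ, fun y h η e z => ?_⟩
  have hnorm : ‖!₂[y, h, η, e, z]‖ ^ 2 = y ^ 2 + h ^ 2 + η ^ 2 + e ^ 2 + z ^ 2 := by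
    rw [EuclideanSpace.real_norm_sq_eq, Fin.sum_univ_five]
    rfl
  rw [← hnorm]
  exact (hc !₂[y, h, η, e, z]).trans (modeDissipation_le_of_le (by gcongr) ..)

theorem binary_le_of_le_modeDissipation {m p K ρ ν b l c δ : ℝ} (hl : 0 ≤ l) (hδ : 0 ≤ δ)
    (hν : 0 ≤ ν)
    (H : ∀ y h η e z : ℝ, c * (η * z) + δ * (y ^ 2 + h ^ 2 + η ^ 2 + e ^ 2 + z ^ 2) ≤
      modeDissipation m p K ρ ν b l y h η e z) (y η : ℝ) :
    δ * (y ^ 2 + η ^ 2) ≤ (m + (1 - b) * l) * y ^ 2 + (1 + b * m - c) * y * η + b * η ^ 2 := by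
  have hyη := H y 0 η 0 y
  have hν' : 0 ≤ ν * (0 + m * y + η + l * y) ^ 2 := by positivity
  have hl' : 0 ≤ l / 2 * y ^ 2 := by positivity
  have hδ' : 0 ≤ δ * y ^ 2 := by positivity
  unfold modeDissipation at hyη
  simp only [zero_pow two_ne_zero, zero_div, mul_zero, sub_self, add_zero] at hyη
  linarith

theorem pos_and_sq_lt_of_mul_sq_add_sq_le {A B C δ : ℝ} (hδ : 0 < δ)
    (h : ∀ x y : ℝ, δ * (x ^ 2 + y ^ 2) ≤ A * x ^ 2 + B * x * y + C * y ^ 2) :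
    0 < A ∧ 0 < C ∧ B ^ 2 < 4 * A * C := by
  have hA : 0 < A := by linarith [h 1 0]
  refine ⟨hA, by linarith [h 0 1], ?_⟩
  have hdiscrim := discrim_lt_zero hA.ne' fun x => show 0 < A * (x * x) + B * x + C by
    linarith [h x 1, mul_nonneg hδ.le (sq_nonneg x)]
  unfold discrim at hdiscrim
  linarith

theorem sq_lt_div_add_of_sq_lt {m b l c : ℝ} (hl : 0 < l) (hA : 0 < m + (1 - b) * l) (hb : 0 < b)
    (hdisc : (1 + b * m - c) ^ 2 < 4 * (m + (1 - b) * l) * b) : b ^ 2 < c / l + b := by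
  by_contra! hle
  have hc : c ≤ (b ^ 2 - b) * l := by
    rw [← div_le_iff₀ hl]
    linarith
  have hAb : 0 < (m + (1 - b) * l) * b := mul_pos hA hb
  have hsq : (1 + (m + (1 - b) * l) * b) ^ 2 ≤ (1 + b * m - c) ^ 2 :=
    pow_le_pow_left₀ (by linarith) (by linarith) 2
  linarith [sq_nonneg (1 - (m + (1 - b) * l) * b)]

theorem exists_mode_lower_bound {m p K ρ ν b l c δ : ℝ} (hl : 0 < l) (hδ : 0 < δ) (hν : 0 ≤ ν)
    (H : ∀ y h η e z : ℝ, c * (η * z) + δ * (y ^ 2 + h ^ 2 + η ^ 2 + e ^ 2 + z ^ 2) ≤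
      modeDissipation m p K ρ ν b l y h η e z) :
    ∃ μ > 0, ∀ y η : ℝ,
      μ * (y ^ 2 + η ^ 2) ≤ 1 / 2 * y ^ 2 + b * y * η + (c / l + b) / 2 * η ^ 2 := by
  obtain ⟨hA, hb, hdisc⟩ :=
    pos_and_sq_lt_of_mul_sq_add_sq_le hδ (binary_le_of_le_modeDissipation hl.le hδ.le hν H)
  refine exists_mul_sq_add_sq_le one_half_pos ?_
  linarith [sq_lt_div_add_of_sq_lt hl hA hb hdisc]

theorem epsilon_mul_le {ξ : ℝ} (hξ : 0 < ξ) : epsilon ξ * (2 * √2 * ξ) ≤ 1 := by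
  have hsqrt : √2 * ξ ≤ √(2 * (ξ ^ 2 + (ξ - 1) ^ 2)) := by
    refine Real.le_sqrt_of_sq_le ?_
    rw [mul_pow, Real.sq_sqrt zero_le_two]
    linarith [sq_nonneg (ξ - 1)]
  have hpos : 0 < √2 * ξ := by positivity
  unfold epsilon
  rw [one_div_mul_eq_div, div_le_one (by linarith)]
  linarith

theorem tauZero_mul_le {w Λ ε : ℝ} (hw : 0 < w) (hΛ : 0 ≤ Λ) (hε : 0 ≤ ε) :
    tauZero w Λ ε * (1 + w + √2 * Λ) ≤ ε := by
  set d := w + 1 + √2 * Λ + √2 * Λ * ε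
  have hx : 0 ≤ (w + 1) * ε / d := by positivity
  have hlog : Real.log (1 + (w + 1) * ε / d) ≤ (w + 1) * ε / d :=
    (Real.log_le_sub_one_of_pos (by linarith)).trans_eq (by ring)
  calc tauZero w Λ ε * (1 + w + √2 * Λ)
      ≤ 1 / (w + 1) * ((w + 1) * ε / d) * (1 + w + √2 * Λ) := by
        unfold tauZero
        gcongr
    _ = ε * (1 + w + √2 * Λ) / d := by field_simp
    _ ≤ ε * d / d := by
        gcongr
        linarith [show 0 ≤ √2 * Λ * ε by positivity]
    _ = ε := mul_div_cancel_right₀ ε (by positivity)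

theorem dwell_mul_dwellPoly_le {m w l Λ ξ Δ : ℝ} (hm : 0 ≤ m) (hw : 0 < w) (hl : 0 ≤ l)
    (hlΛ : l ≤ Λ) (hξ0 : 0 < ξ) (hξ : 4 * w ^ 2 + 2 * Λ ^ 2 + 1 ≤ 8 * m * ξ) (hΔ : 0 ≤ Δ)
    (hΔ' : Δ ≤ tauZero w Λ (epsilon ξ)) : Δ * dwellPoly w l ≤ 2.83 * m := by
  have hΛ : 0 ≤ Λ := hl.trans hlΛ
  have hε : 0 ≤ epsilon ξ := by
    unfold epsilon
    positivity
  have hsqrt_le : √2 ≤ 1.415 := (Real.sqrt_le_left (by norm_num)).2 (by norm_num)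
  have hle_sqrt : 1.4 ≤ √2 := Real.le_sqrt_of_sq_le (by norm_num)
  have hsqrt : √2 * √2 = 2 := Real.mul_self_sqrt zero_le_two
  calc Δ * dwellPoly w l
      ≤ Δ * ((4 * w ^ 2 + 2 * Λ ^ 2 + 1) * (1 + w + √2 * Λ)) := by
        have hsq : l ^ 2 ≤ Λ ^ 2 := pow_le_pow_left₀ hl hlΛ 2
        unfold dwellPoly
        gcongr ?_ * (?_ * ?_)
        · linarith
        · gcongr
    _ = Δ * (1 + w + √2 * Λ) * (4 * w ^ 2 + 2 * Λ ^ 2 + 1) := by ring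
    _ ≤ epsilon ξ * (8 * m * ξ) := by
        gcongr
        exact (by gcongr : Δ * (1 + w + √2 * Λ) ≤ _).trans (tauZero_mul_le hw hΛ hε)
    _ = epsilon ξ * (2 * √2 * ξ) * (2 * √2 * m) := by
        linear_combination (-4 * epsilon ξ * m * ξ) * hsqrt
    _ ≤ 1 * (2 * √2 * m) := by
        gcongr
        exact epsilon_mul_le hξ0
    _ ≤ 2.83 * m := by linarith [mul_le_mul_of_nonneg_right hsqrt_le hm]

theorem exists_gainBounds {w m₀ Λ ξ Δ κ : ℝ} (hm₀ : 0 < m₀) (hmw : m₀ ≤ w)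
    (hξ : (4 * w ^ 2 + 2 * Λ ^ 2 + 1) / (8 * m₀) < ξ) (hΔ : 0 < Δ)
    (hΔ' : Δ ≤ tauZero w Λ (epsilon ξ)) (hκ : max (w ^ 2 / (4 * m₀)) (1 / 2) < κ) :
    ∃ m κ₀, m < m₀ ∧ κ₀ ≤ κ ∧ ∀ l, 0 ≤ l → l ≤ Λ → GainBounds m w κ₀ l Δ := by
  have hw : 0 < w := hm₀.trans_le hmw
  obtain ⟨hκ₀, hκ_half⟩ := max_lt_iff.1 hκ
  have hκ0 : 0 < κ := one_half_pos.trans hκ_half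
  have hξ0 : 0 < ξ := lt_trans (by positivity) hξ
  set m := max (w ^ 2 / (4 * κ)) ((4 * w ^ 2 + 2 * Λ ^ 2 + 1) / (8 * ξ))
  have hm0 : 0 < m := lt_max_of_lt_left (by positivity)
  have hmκ : w ^ 2 ≤ m * (4 * κ) := (div_le_iff₀ (by positivity)).1 (le_max_left _ _)
  have hmξ : 4 * w ^ 2 + 2 * Λ ^ 2 + 1 ≤ m * (8 * ξ) :=
    (div_le_iff₀ (by positivity)).1 (le_max_right _ _)
  have hmm₀ : m < m₀ := by
    rw [div_lt_iff₀ (by positivity)] at hκ₀ hξ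
    refine max_lt ?_ ?_ <;>
    · rw [div_lt_iff₀ (by positivity)]
      linarith
  refine ⟨m, max (1 / 2) (w ^ 2 / (4 * m)), hmm₀, max_le hκ_half.le ?_, fun l hl hlΛ => ?_⟩
  · rw [div_le_iff₀ (by positivity)]
    linarith
  · have hκw : w ^ 2 ≤ max (1 / 2) (w ^ 2 / (4 * m)) * (4 * m) :=
      (div_le_iff₀ (by positivity)).1 (le_max_right _ _)
    refine ⟨hm0, hmm₀.trans_le hmw, le_max_left _ _, by linarith, ?_, hl, hΔ,
      dwell_mul_dwellPoly_le hm0.le hw hl hlΛ hξ0 (by linarith) hΔ.le hΔ'⟩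
    refine (max_choice (1 / 2) (w ^ 2 / (4 * m))).imp_right fun h => ?_
    rw [h]
    field_simp

/-! ### Laplacian modes -/

namespace IsConnectedAdjacency

variable {N q : ℕ} {a : Matrix (Fin N) (Fin N) ℝ}
  {E : Type*} [NormedAddCommGroup E] [InnerProductSpace ℝ E]

theorem outDegree_eq_row_sum (ha : IsConnectedAdjacency a) (i : Fin N) :
    outDegree a i = ∑ j, a i j :=
  Finset.sum_congr rfl fun j _ => ha.symm.apply i j

theorem outDegree_nonneg (ha : IsConnectedAdjacency a) (i : Fin N) : 0 ≤ outDegree a i :=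
  Finset.sum_nonneg fun j _ => ha.nonneg j i

theorem laplacian_mulVec_apply (ha : IsConnectedAdjacency a) (y : Fin N → ℝ) (i : Fin N) :
    (laplacian a).mulVec y i = ∑ j, a i j * (y i - y j) := by
  rw [laplacian, Matrix.sub_mulVec, Pi.sub_apply, Matrix.mulVec_diagonal, ha.outDegree_eq_row_sum,
    Finset.sum_mul, Matrix.mulVec, dotProduct, ← Finset.sum_sub_distrib]
  exact Finset.sum_congr rfl fun j _ => by ring

theorem isHermitian_laplacian (ha : IsConnectedAdjacency a) : (laplacian a).IsHermitian := by
  refine (Matrix.isHermitian_diagonal _).sub ?_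
  rw [Matrix.IsHermitian, Matrix.conjTranspose_eq_transpose_of_trivial]
  exact ha.symm

theorem sum_inner_laplacian (ha : IsConnectedAdjacency a) (x y : Fin N → E) :
    ∑ i, inner ℝ (x i) (∑ j, a i j • (y i - y j)) =
      1 / 2 * ∑ i, ∑ j, a i j * inner ℝ (x i - x j) (y i - y j) := by
  have hswap : ∑ i, ∑ j, a i j * inner ℝ (x j) (y i - y j) =
      -∑ i, ∑ j, a i j * inner ℝ (x i) (y i - y j) := by
    rw [Finset.sum_comm]
    simp only [← Finset.sum_neg_distrib, ← mul_neg, ← inner_neg_right, neg_sub, ha.symm.apply]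
  simp only [inner_sum, inner_smul_right, inner_sub_left, mul_sub,
    Finset.sum_sub_distrib] at hswap ⊢
  linarith

theorem sum_inner_laplacian_comm (ha : IsConnectedAdjacency a) (x y : Fin N → E) :
    ∑ i, inner ℝ (x i) (∑ j, a i j • (y i - y j)) =
      ∑ i, inner ℝ (y i) (∑ j, a i j • (x i - x j)) := by
  simp only [ha.sum_inner_laplacian, real_inner_comm]

theorem sum_sum_mul_norm_sub_sq_le (ha : IsConnectedAdjacency a) (x : Fin N → E) :
    ∑ i, ∑ j, a i j * ‖x i - x j‖ ^ 2 ≤ 4 * ∑ i, outDegree a i * ‖x i‖ ^ 2 := by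
  have hedge (i j : Fin N) :
      a i j * ‖x i - x j‖ ^ 2 ≤ 2 * (a i j * ‖x i‖ ^ 2) + 2 * (a i j * ‖x j‖ ^ 2) := by
    have hpar := parallelogram_law_with_norm ℝ (x i) (x j)
    nlinarith [ha.nonneg i j, mul_nonneg (ha.nonneg i j) (sq_nonneg ‖x i + x j‖)]
  have hrow : ∑ i, ∑ j, a i j * ‖x i‖ ^ 2 = ∑ i, outDegree a i * ‖x i‖ ^ 2 := by
    simp only [ha.outDegree_eq_row_sum, Finset.sum_mul]
  have hcol : ∑ i, ∑ j, a i j * ‖x j‖ ^ 2 = ∑ i, outDegree a i * ‖x i‖ ^ 2 := by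
    rw [Finset.sum_comm]
    simp only [outDegree, Finset.sum_mul]
  have hsum := Finset.sum_le_sum fun i (_ : i ∈ Finset.univ) =>
    Finset.sum_le_sum fun j (_ : j ∈ Finset.univ) => hedge i j
  simp only [Finset.sum_add_distrib, ← Finset.mul_sum] at hsum
  linarith

theorem eq_of_sum_sum_mul_norm_sub_sq_eq_zero (ha : IsConnectedAdjacency a) {F : Type*}
    [NormedAddCommGroup F] {x : Fin N → F} (h : ∑ i, ∑ j, a i j * ‖x i - x j‖ ^ 2 = 0)
    (i j : Fin N) : x i = x j := by
  have hterm (i j : Fin N) : 0 ≤ a i j * ‖x i - x j‖ ^ 2 :=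
    mul_nonneg (ha.nonneg i j) (sq_nonneg _)
  have hedge (i j : Fin N) (hij : 0 < a i j) : x i = x j := by
    have hrow := (Finset.sum_eq_zero_iff_of_nonneg fun i _ =>
      Finset.sum_nonneg fun j _ => hterm i j).1 h i (Finset.mem_univ i)
    have hzero := (Finset.sum_eq_zero_iff_of_nonneg fun j _ => hterm i j).1 hrow j
      (Finset.mem_univ j)
    simpa [hij.ne', sub_eq_zero] using hzero
  obtain ⟨p⟩ := ha.connected.preconnected i j
  induction p with
  | nil => rfl
  | cons hadj _ ih =>
    rcases ((SimpleGraph.fromRel_adj ..).1 hadj).2 with huv | hvu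
    · exact (hedge _ _ huv).trans ih
    · exact (hedge _ _ hvu).symm.trans ih

/-- The eigenvalues of the Laplacian, counted with multiplicity. -/
noncomputable abbrev eigenvalue (ha : IsConnectedAdjacency a) : Fin N → ℝ :=
  ha.isHermitian_laplacian.eigenvalues

/-- An orthonormal basis of eigenvectors of the Laplacian. -/
noncomputable abbrev eigenbasis (ha : IsConnectedAdjacency a) :
    OrthonormalBasis (Fin N) ℝ (Vec N) :=
  ha.isHermitian_laplacian.eigenvectorBasis

theorem laplacian_eigenbasis (ha : IsConnectedAdjacency a) (k i : Fin N) :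
    ∑ j, a i j * (ha.eigenbasis k i - ha.eigenbasis k j) =
      ha.eigenvalue k * ha.eigenbasis k i := by
  rw [← ha.laplacian_mulVec_apply]
  exact congrFun (ha.isHermitian_laplacian.mulVec_eigenvectorBasis k) i

theorem eigenvalue_eq_sum (ha : IsConnectedAdjacency a) (k : Fin N) :
    ha.eigenvalue k =
      1 / 2 * ∑ i, ∑ j, a i j * ‖ha.eigenbasis k i - ha.eigenbasis k j‖ ^ 2 := by
  have hnorm : ∑ i, ha.eigenbasis k i ^ 2 = 1 := by
    rw [← EuclideanSpace.real_norm_sq_eq, ha.eigenbasis.orthonormal.1 k, one_pow]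
  have hquad := ha.sum_inner_laplacian (ha.eigenbasis k ·) (ha.eigenbasis k ·)
  simp only [smul_eq_mul, ha.laplacian_eigenbasis, real_inner_self_eq_norm_sq] at hquad
  calc ha.eigenvalue k = ∑ i, ha.eigenvalue k * ha.eigenbasis k i ^ 2 := by
        rw [← Finset.mul_sum, hnorm, mul_one]
    _ = _ := by
        rw [← hquad]
        exact Finset.sum_congr rfl fun i _ => by
          simp only [RCLike.inner_apply, conj_trivial]
          ring

theorem eigenvalue_nonneg (ha : IsConnectedAdjacency a) (k : Fin N) : 0 ≤ ha.eigenvalue k := by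
  rw [ha.eigenvalue_eq_sum]
  exact mul_nonneg one_half_pos.le <| Finset.sum_nonneg fun i _ => Finset.sum_nonneg fun j _ =>
    mul_nonneg (ha.nonneg i j) (sq_nonneg _)

theorem eigenvalue_le_max (ha : IsConnectedAdjacency a) (k : Fin N) :
    ha.eigenvalue k ≤ maxLaplacianEigenvalue a :=
  le_csSup Matrix.finite_real_spectrum.bddAbove
    (ha.isHermitian_laplacian.eigenvalues_mem_spectrum_real k)

theorem eigenbasis_const_of_eigenvalue_eq_zero (ha : IsConnectedAdjacency a) {k : Fin N}
    (hk : ha.eigenvalue k = 0) (i j : Fin N) : ha.eigenbasis k i = ha.eigenbasis k j :=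
  ha.eq_of_sum_sum_mul_norm_sub_sq_eq_zero (by linarith [ha.eigenvalue_eq_sum k]) i j

/-- The `r`-th coordinate of the component of a family of vectors along the `k`-th eigenvector of
the Laplacian. -/
noncomputable def modeCoord (ha : IsConnectedAdjacency a) (k : Fin N) (r : Fin q) :
    (Fin N → Vec q) →L[ℝ] ℝ :=
  ∑ i, ha.eigenbasis k i • (EuclideanSpace.proj r ∘L ContinuousLinearMap.proj i)

theorem modeCoord_apply (ha : IsConnectedAdjacency a) (k : Fin N) (r : Fin q)
    (X : Fin N → Vec q) : ha.modeCoord k r X = ∑ i, ha.eigenbasis k i * X i r := by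
  simp [modeCoord]

theorem sum_modeCoord_mul (ha : IsConnectedAdjacency a) (X Y : Fin N → Vec q) :
    ∑ k, ∑ r, ha.modeCoord k r X * ha.modeCoord k r Y = ∑ i, inner ℝ (X i) (Y i) := by
  have hparseval (r : Fin q) :
      ∑ k, ha.modeCoord k r X * ha.modeCoord k r Y = ∑ i, X i r * Y i r := by
    have h := ha.eigenbasis.sum_inner_mul_inner (WithLp.toLp 2 (X · r)) (WithLp.toLp 2 (Y · r))
    simp only [PiLp.inner_apply, RCLike.inner_apply, conj_trivial] at h
    simp only [modeCoord_apply]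
    simpa only [mul_comm] using h
  rw [Finset.sum_comm]
  simp only [hparseval, PiLp.inner_apply, RCLike.inner_apply, conj_trivial, mul_comm]
  exact Finset.sum_comm

theorem sum_modeCoord_sq (ha : IsConnectedAdjacency a) (X : Fin N → Vec q) :
    ∑ k, ∑ r, ha.modeCoord k r X ^ 2 = ∑ i, ‖X i‖ ^ 2 := by
  simp only [sq, ha.sum_modeCoord_mul, real_inner_self_eq_norm_mul_norm]

theorem modeCoord_laplacian (ha : IsConnectedAdjacency a) (k : Fin N) (r : Fin q)
    (X : Fin N → Vec q) :
    ha.modeCoord k r (fun i => ∑ j, a i j • (X i - X j)) =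
      ha.eigenvalue k * ha.modeCoord k r X := by
  have hcomm := ha.sum_inner_laplacian_comm (X · r) (ha.eigenbasis k ·)
  simp only [smul_eq_mul, ha.laplacian_eigenbasis, RCLike.inner_apply, conj_trivial] at hcomm
  simp only [modeCoord_apply, Finset.mul_sum]
  convert hcomm.symm using 2 with i _ i _
  · simp [mul_comm]
  · ring

theorem sum_eigenvalue_mul_modeCoord_sq (ha : IsConnectedAdjacency a) (X : Fin N → Vec q) :
    ∑ k, ∑ r, ha.eigenvalue k * ha.modeCoord k r X ^ 2 =
      1 / 2 * ∑ i, ∑ j, a i j * ‖X i - X j‖ ^ 2 := by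
  calc _ = ∑ k, ∑ r, ha.modeCoord k r X *
          ha.modeCoord k r (fun i => ∑ j, a i j • (X i - X j)) := by
        simp only [modeCoord_laplacian, sq, mul_left_comm]
    _ = _ := by
        simp only [ha.sum_modeCoord_mul, ha.sum_inner_laplacian, real_inner_self_eq_norm_sq]

theorem modeCoord_eq_zero_of_sum_eq_zero (ha : IsConnectedAdjacency a) {k : Fin N}
    (hk : ha.eigenvalue k = 0) {X : Fin N → Vec q} (hX : ∑ i, X i = 0) (r : Fin q) :
    ha.modeCoord k r X = 0 := by
  have hsum : ∑ i, X i r = 0 := by simpa using congrArg (EuclideanSpace.proj (𝕜 := ℝ) r) hX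
  rw [modeCoord_apply, Finset.sum_congr rfl fun i _ =>
    congrArg (· * X i r) (ha.eigenbasis_const_of_eigenvalue_eq_zero hk i k), ← Finset.mul_sum,
    hsum, mul_zero]

end IsConnectedAdjacency

/-- The Lyapunov function of a single mode, for the output error `y` and the integrator state
`η`. -/
noncomputable def modeEnergy (b g y η : ℝ) : ℝ := y ^ 2 / 2 + b * (y * η) + g / 2 * η ^ 2

/-- The derivative of `modeEnergy` along a curve with velocity `(y', η')`. -/
def modeEnergyDeriv (b g y η y' η' : ℝ) : ℝ :=
  y * y' + b * (y' * η + y * η') + g * (η * η')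

theorem hasDerivWithinAt_modeEnergy {y η : ℝ → ℝ} {y' η' t : ℝ} {s : Set ℝ} (b g : ℝ)
    (hy : HasDerivWithinAt y y' s t) (hη : HasDerivWithinAt η η' s t) :
    HasDerivWithinAt (fun t => modeEnergy b g (y t) (η t))
      (modeEnergyDeriv b g (y t) (η t) y' η') s t := by
  refine ((((hy.fun_pow 2).div_const 2).fun_add ((hy.fun_mul hη).const_mul b)).fun_add
    ((hη.fun_pow 2).const_mul (g / 2))).congr_deriv ?_
  unfold modeEnergyDeriv
  push_cast
  ring

theorem modeEnergy_le (b g y η : ℝ) :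
    modeEnergy b g y η ≤ (1 + |b| + |g|) * (y ^ 2 + η ^ 2) := by
  have hcross : b * (y * η) ≤ |b| * (y ^ 2 + η ^ 2) := by
    refine (le_abs_self _).trans ?_
    rw [abs_mul]
    refine mul_le_mul_of_nonneg_left (abs_le.2 ⟨?_, ?_⟩) (abs_nonneg b) <;>
      nlinarith [sq_nonneg (y + η), sq_nonneg (y - η)]
  have hη : g / 2 * η ^ 2 ≤ |g| * (y ^ 2 + η ^ 2) :=
    mul_le_mul (by linarith [le_abs_self g, abs_nonneg g]) (le_add_of_nonneg_left (sq_nonneg y))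
      (sq_nonneg η) (abs_nonneg g)
  unfold modeEnergy
  linarith [sq_nonneg y, sq_nonneg η]

theorem modeEnergyDeriv_eq (m p κ ρ ν l b g y h η e z : ℝ) :
    modeEnergyDeriv b g y η (-(h + m * y) - l * z - η) (l * z) +
        (-ρ * (z - y - e) ^ 2 + ν * (-(h + m * y) - l * z - η) ^ 2) =
      (g - b) * l * (η * z) - modeDissipation m p (κ + l / 2) ρ ν b l y h η e z +
        (h ^ 2 / p - y * h) - (l * z ^ 2 / 2 - κ * e ^ 2 - l * e ^ 2 / 2) := by
  unfold modeEnergyDeriv modeDissipation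
  ring

/-- Weights `b k`, `g k` for which the mode energies are positive definite and decrease. The
integrator states sum to zero, so in a mode with eigenvalue zero only `η = 0` matters. -/
structure LyapunovWeights {N : ℕ} {a : Matrix (Fin N) (Fin N) ℝ} (ha : IsConnectedAdjacency a)
    (m p κ ρ ν : ℝ) (b g : Fin N → ℝ) (δ : ℝ) : Prop where
  δ_pos : 0 < δ
  decrease : ∀ k y h η e z, (ha.eigenvalue k = 0 → η = 0) →
    (g k - b k) * ha.eigenvalue k * (η * z) + δ * (y ^ 2 + h ^ 2 + η ^ 2 + e ^ 2 + z ^ 2) ≤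
      modeDissipation m p (κ + ha.eigenvalue k / 2) ρ ν (b k) (ha.eigenvalue k) y h η e z
  lower : ∀ k y η, (ha.eigenvalue k = 0 → η = 0) →
    δ * (y ^ 2 + η ^ 2) ≤ modeEnergy (b k) (g k) y η

namespace LyapunovWeights

variable {N q : ℕ} {a : Matrix (Fin N) (Fin N) ℝ} {ha : IsConnectedAdjacency a}
  {m p κ ρ ν δ : ℝ} {b g : Fin N → ℝ}

theorem modeEnergyDeriv_le (W : LyapunovWeights ha m p κ ρ ν b g δ) {k : Fin N} {η : ℝ}
    (hη : ha.eigenvalue k = 0 → η = 0) (y h e z : ℝ) :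
    modeEnergyDeriv (b k) (g k) y η (-(h + m * y) - ha.eigenvalue k * z - η)
          (ha.eigenvalue k * z) +
        (-ρ * (z - y - e) ^ 2 + ν * (-(h + m * y) - ha.eigenvalue k * z - η) ^ 2) ≤
      -(δ / 4) * (y ^ 2 + η ^ 2 + (z - y - e) ^ 2) + (h ^ 2 / p - y * h) -
        (ha.eigenvalue k * z ^ 2 / 2 - κ * e ^ 2 - ha.eigenvalue k * e ^ 2 / 2) := by
  have hdwell : y ^ 2 + η ^ 2 + (z - y - e) ^ 2 ≤
      4 * (y ^ 2 + h ^ 2 + η ^ 2 + e ^ 2 + z ^ 2) := by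
    linarith [sq_nonneg (z + y), sq_nonneg (z + e), sq_nonneg (y - e), sq_nonneg h, sq_nonneg η,
      sq_nonneg y, sq_nonneg e, sq_nonneg z]
  rw [modeEnergyDeriv_eq m p κ]
  linarith [W.decrease k y h η e z hη, mul_le_mul_of_nonneg_left hdwell W.δ_pos.le]

end LyapunovWeights

namespace IsConnectedAdjacency

variable {N q : ℕ} {a : Matrix (Fin N) (Fin N) ℝ}

/-- The sum of the mode energies of the output errors `Y` and the integrator states `E`, with
weights `b k`, `g k` in the `k`-th Laplacian mode. -/
noncomputable def modalEnergy (ha : IsConnectedAdjacency a) (b g : Fin N → ℝ)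
    (Y E : Fin N → Vec q) : ℝ :=
  ∑ k, ∑ r, modeEnergy (b k) (g k) (ha.modeCoord k r Y) (ha.modeCoord k r E)

/-- The derivative of `modalEnergy` along a curve with velocity `(Y', E')`. -/
noncomputable def modalEnergyDeriv (ha : IsConnectedAdjacency a) (b g : Fin N → ℝ)
    (Y E Y' E' : Fin N → Vec q) : ℝ :=
  ∑ k, ∑ r, modeEnergyDeriv (b k) (g k) (ha.modeCoord k r Y) (ha.modeCoord k r E)
    (ha.modeCoord k r Y') (ha.modeCoord k r E')

theorem hasDerivWithinAt_modalEnergy (ha : IsConnectedAdjacency a) (b g : Fin N → ℝ)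
    {Y E : ℝ → Fin N → Vec q} {Y' E' : Fin N → Vec q} {s : Set ℝ} {t : ℝ}
    (hY : HasDerivWithinAt Y Y' s t) (hE : HasDerivWithinAt E E' s t) :
    HasDerivWithinAt (fun t => ha.modalEnergy b g (Y t) (E t))
      (ha.modalEnergyDeriv b g (Y t) (E t) Y' E') s t :=
  HasDerivWithinAt.fun_sum fun k _ => HasDerivWithinAt.fun_sum fun r _ =>
    hasDerivWithinAt_modeEnergy (b k) (g k)
      ((ha.modeCoord k r).hasFDerivAt.comp_hasDerivWithinAt t hY)
      ((ha.modeCoord k r).hasFDerivAt.comp_hasDerivWithinAt t hE)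

theorem continuous_modalEnergy (ha : IsConnectedAdjacency a) (b g : Fin N → ℝ) :
    Continuous fun X : (Fin N → Vec q) × (Fin N → Vec q) => ha.modalEnergy b g X.1 X.2 := by
  unfold modalEnergy modeEnergy
  fun_prop

theorem modalEnergy_le (ha : IsConnectedAdjacency a) {b g : Fin N → ℝ} {C : ℝ}
    (hC : ∀ k, 1 + |b k| + |g k| ≤ C) (Y E : Fin N → Vec q) :
    ha.modalEnergy b g Y E ≤ C * ∑ i, (‖Y i‖ ^ 2 + ‖E i‖ ^ 2) := by
  rw [Finset.sum_add_distrib, ← ha.sum_modeCoord_sq, ← ha.sum_modeCoord_sq]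
  simp only [← Finset.sum_add_distrib, Finset.mul_sum]
  refine Finset.sum_le_sum fun k _ => Finset.sum_le_sum fun r _ => ?_
  exact (modeEnergy_le _ _ _ _).trans (mul_le_mul_of_nonneg_right (hC k) (by positivity))

theorem sum_modeCoord_sector_nonpos (ha : IsConnectedAdjacency a) {p : ℝ} (hp : 0 < p)
    {Y H : Fin N → Vec q} (hH : ∀ i, ‖H i‖ ^ 2 ≤ p * inner ℝ (Y i) (H i)) :
    ∑ k, ∑ r, (ha.modeCoord k r H ^ 2 / p - ha.modeCoord k r Y * ha.modeCoord k r H) ≤ 0 := by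
  simp only [Finset.sum_sub_distrib, ← Finset.sum_div]
  rw [ha.sum_modeCoord_sq, ha.sum_modeCoord_mul, sub_nonpos, div_le_iff₀' hp, Finset.mul_sum]
  exact Finset.sum_le_sum fun i _ => hH i

theorem sum_modeCoord_threshold_nonneg (ha : IsConnectedAdjacency a) {κ : ℝ}
    {B z : Fin N → Vec q}
    (hB : ∀ i, 4 * (outDegree a i + κ) * ‖B i‖ ^ 2 ≤ ∑ j, a i j * ‖z i - z j‖ ^ 2) :
    0 ≤ ∑ k, ∑ r, (ha.eigenvalue k * ha.modeCoord k r z ^ 2 / 2 -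
      κ * ha.modeCoord k r B ^ 2 - ha.eigenvalue k * ha.modeCoord k r B ^ 2 / 2) := by
  simp only [Finset.sum_sub_distrib, ← Finset.sum_div, ← Finset.mul_sum (a := κ)]
  rw [ha.sum_eigenvalue_mul_modeCoord_sq, ha.sum_eigenvalue_mul_modeCoord_sq, ha.sum_modeCoord_sq]
  have hsum : 4 * ∑ i, outDegree a i * ‖B i‖ ^ 2 + 4 * (κ * ∑ i, ‖B i‖ ^ 2) ≤
      ∑ i, ∑ j, a i j * ‖z i - z j‖ ^ 2 := by
    refine le_trans (le_of_eq ?_) (Finset.sum_le_sum fun i _ => hB i)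
    simp only [mul_add, add_mul, Finset.sum_add_distrib, Finset.mul_sum, mul_assoc]
  linarith [ha.sum_sum_mul_norm_sub_sq_le B]

end IsConnectedAdjacency

namespace LyapunovWeights

variable {N q : ℕ} {a : Matrix (Fin N) (Fin N) ℝ} {ha : IsConnectedAdjacency a}
  {m p κ ρ ν δ : ℝ} {b g : Fin N → ℝ}

theorem mul_sum_norm_sq_le_modalEnergy (W : LyapunovWeights ha m p κ ρ ν b g δ)
    (Y : Fin N → Vec q) {E : Fin N → Vec q} (hE : ∑ i, E i = 0) :
    δ * ∑ i, ‖Y i‖ ^ 2 ≤ ha.modalEnergy b g Y E := by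
  simp only [← ha.sum_modeCoord_sq, Finset.mul_sum]
  refine Finset.sum_le_sum fun k _ => Finset.sum_le_sum fun r _ => ?_
  exact (mul_le_mul_of_nonneg_left (le_add_of_nonneg_right (sq_nonneg _)) W.δ_pos.le).trans
    (W.lower k _ _ fun hk => ha.modeCoord_eq_zero_of_sum_eq_zero hk hE r)

theorem modalEnergyDeriv_add_le (W : LyapunovWeights ha m p κ ρ ν b g δ) (hp : 0 < p)
    {Y H E A B z v : Fin N → Vec q} (hz : z = Y + A + B)
    (hv : v = -(H + m • Y) - (fun i => ∑ j, a i j • (z i - z j)) - E)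
    (hH : ∀ i, ‖H i‖ ^ 2 ≤ p * inner ℝ (Y i) (H i))
    (hB : ∀ i, 4 * (outDegree a i + κ) * ‖B i‖ ^ 2 ≤ ∑ j, a i j * ‖z i - z j‖ ^ 2)
    (hE : ∑ i, E i = 0) :
    ha.modalEnergyDeriv b g Y E v (fun i => ∑ j, a i j • (z i - z j)) +
        ∑ i, (-ρ * ‖A i‖ ^ 2 + ν * ‖v i‖ ^ 2) ≤
      -(δ / 4) * ∑ i, (‖Y i‖ ^ 2 + ‖E i‖ ^ 2 + ‖A i‖ ^ 2) := by
  have hvc (k : Fin N) (r : Fin q) : ha.modeCoord k r v =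
      -(ha.modeCoord k r H + m * ha.modeCoord k r Y) - ha.eigenvalue k * ha.modeCoord k r z -
        ha.modeCoord k r E := by
    rw [hv, map_sub, map_sub, map_neg, map_add, map_smul, smul_eq_mul, ha.modeCoord_laplacian]
  have hAc (k : Fin N) (r : Fin q) : ha.modeCoord k r A =
      ha.modeCoord k r z - ha.modeCoord k r Y - ha.modeCoord k r B := by
    rw [hz, map_add, map_add]
    ring
  have hmode (k : Fin N) (r : Fin q) :=
    W.modeEnergyDeriv_le (k := k) (fun hk => ha.modeCoord_eq_zero_of_sum_eq_zero hk hE r)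
      (ha.modeCoord k r Y) (ha.modeCoord k r H) (ha.modeCoord k r B) (ha.modeCoord k r z)
  simp only [← hvc, ← hAc] at hmode
  simp only [← ha.modeCoord_laplacian] at hmode
  have hsum := Finset.sum_le_sum fun k (_ : k ∈ Finset.univ) =>
    Finset.sum_le_sum fun r (_ : r ∈ Finset.univ) => hmode k r
  have hsector := ha.sum_modeCoord_sector_nonpos hp hH
  have hthreshold := ha.sum_modeCoord_threshold_nonneg hB
  unfold IsConnectedAdjacency.modalEnergyDeriv
  simp only [Finset.sum_add_distrib, Finset.sum_sub_distrib, ← Finset.mul_sum,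
    ha.sum_modeCoord_sq] at hsum hsector hthreshold ⊢
  linarith

end LyapunovWeights

/-! ### Dwell intervals -/

section DwellWeight

variable {Δ s : ℝ}

/-- The weight of the squared broadcast error at time `s` after a broadcast that is followed by a
dwell interval of length `Δ`. It solves the Riccati inequality `φ' + φ² / (Δ / 3) ≤ -5 / (8 Δ)` on
`[0, Δ]` and vanishes at `s = Δ`. -/
noncomputable def dwellWeight (Δ s : ℝ) : ℝ := 5 / 8 * ((1 - s / Δ) / (1 - 0.9 * (1 - s / Δ) ^ 2))

/-- The derivative of `dwellWeight Δ` on `[0, Δ]`. -/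
noncomputable def dwellWeightDeriv (Δ s : ℝ) : ℝ :=
  -(5 / (8 * Δ)) * ((1 + 0.9 * (1 - s / Δ) ^ 2) / (1 - 0.9 * (1 - s / Δ) ^ 2) ^ 2)

theorem one_sub_div_mem_Icc (hΔ : 0 < Δ) (hs : s ∈ Set.Icc 0 Δ) : 1 - s / Δ ∈ Set.Icc 0 1 :=
  ⟨sub_nonneg.2 ((div_le_one hΔ).2 hs.2), sub_le_self _ (div_nonneg hs.1 hΔ.le)⟩

theorem dwellWeight_denom_ge {u : ℝ} (hu : u ∈ Set.Icc 0 1) : 0.1 ≤ 1 - 0.9 * u ^ 2 := by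
  linarith [pow_le_one₀ (n := 2) hu.1 hu.2]

theorem dwellWeight_nonneg (hΔ : 0 < Δ) (hs : s ∈ Set.Icc 0 Δ) : 0 ≤ dwellWeight Δ s := by
  have hu := one_sub_div_mem_Icc hΔ hs
  have hdenom := dwellWeight_denom_ge hu
  exact mul_nonneg (by norm_num) (div_nonneg hu.1 (by linarith))

theorem dwellWeight_le (hΔ : 0 < Δ) (hs : s ∈ Set.Icc 0 Δ) : dwellWeight Δ s ≤ 7 := by
  have hu := one_sub_div_mem_Icc hΔ hs
  have hdenom := dwellWeight_denom_ge hu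
  have hquot : (1 - s / Δ) / (1 - 0.9 * (1 - s / Δ) ^ 2) ≤ 10 := by
    rw [div_le_iff₀ (by linarith)]
    linarith [hu.2]
  unfold dwellWeight
  linarith

theorem hasDerivAt_dwellWeight (hΔ : 0 < Δ) (hs : s ∈ Set.Icc 0 Δ) :
    HasDerivAt (dwellWeight Δ) (dwellWeightDeriv Δ s) s := by
  have hne : 1 - 0.9 * (1 - s / Δ) ^ 2 ≠ 0 := by
    linarith [dwellWeight_denom_ge (one_sub_div_mem_Icc hΔ hs)]
  have hfrac : HasDerivAt (fun s => 1 - s / Δ) (-(1 / Δ)) s := by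
    simpa using ((hasDerivAt_id s).div_const Δ).const_sub 1
  have hdenom := ((hfrac.pow 2).const_mul 0.9).const_sub 1
  refine ((hfrac.div hdenom hne).const_mul (5 / 8)).congr_deriv ?_
  simp only [dwellWeightDeriv, Pi.pow_apply]
  clear hdenom hfrac
  generalize 1 - s / Δ = u at hne ⊢
  push_cast
  field_simp
  ring

theorem dwellWeightDeriv_add_sq_div_le (hΔ : 0 < Δ) (hs : s ∈ Set.Icc 0 Δ) :
    dwellWeightDeriv Δ s + dwellWeight Δ s ^ 2 / (Δ / 3) ≤ -(5 / (8 * Δ)) := by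
  have hu := one_sub_div_mem_Icc hΔ hs
  unfold dwellWeightDeriv dwellWeight
  generalize 1 - s / Δ = u at hu ⊢
  have hdenom : 0 < 1 - 0.9 * u ^ 2 := by linarith [dwellWeight_denom_ge hu]
  have hriccati : 1 + 15 / 8 * (u / (1 - 0.9 * u ^ 2)) ^ 2 ≤
      (1 + 0.9 * u ^ 2) / (1 - 0.9 * u ^ 2) ^ 2 := by
    rw [div_pow, le_div_iff₀ (by positivity), add_mul, mul_assoc (15 / 8),
      div_mul_cancel₀ _ (by positivity)]
    nlinarith [mul_nonneg (sq_nonneg u) (sub_nonneg.2 (pow_le_one₀ (n := 2) hu.1 hu.2))]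
  calc _ = -(5 / (8 * Δ)) * ((1 + 0.9 * u ^ 2) / (1 - 0.9 * u ^ 2) ^ 2 -
        15 / 8 * (u / (1 - 0.9 * u ^ 2)) ^ 2) := by
        field_simp
        ring
    _ ≤ -(5 / (8 * Δ)) * 1 :=
        mul_le_mul_of_nonpos_left (by linarith) (neg_nonpos.2 (by positivity))
    _ = _ := mul_one _

theorem dwellWeight_dissipation {E : Type*} [NormedAddCommGroup E] [InnerProductSpace ℝ E]
    (hΔ : 0 < Δ) (hs : s ∈ Set.Icc 0 Δ) (e v : E) :
    dwellWeightDeriv Δ s * ‖e‖ ^ 2 + dwellWeight Δ s * (2 * inner ℝ e (-v)) ≤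
      -(5 / (8 * Δ)) * ‖e‖ ^ 2 + Δ / 3 * ‖v‖ ^ 2 := by
  have hriccati := mul_le_mul_of_nonneg_right (dwellWeightDeriv_add_sq_div_le hΔ hs)
    (sq_nonneg ‖e‖)
  generalize dwellWeight Δ s = φ at hriccati ⊢
  have hsquare : 0 ≤ Δ / 3 * ‖(φ / (Δ / 3)) • e + v‖ ^ 2 := by positivity
  have hexpand : Δ / 3 * ‖(φ / (Δ / 3)) • e + v‖ ^ 2 =
      φ ^ 2 / (Δ / 3) * ‖e‖ ^ 2 + φ * (2 * inner ℝ e v) + Δ / 3 * ‖v‖ ^ 2 := by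
    rw [norm_add_sq_real, real_inner_smul_left, norm_smul, mul_pow, Real.norm_eq_abs, sq_abs]
    field_simp
  rw [inner_neg_right]
  linarith

end DwellWeight

/-- Broadcast instants of one agent, with `∞` standing for a broadcast that never happens;
consecutive ones are at least `Δ` apart. -/
structure IsDwellSequence (Δ : ℝ) (T : ℕ → ℝ≥0∞) : Prop where
  zero : T 0 = 0
  add_le : ∀ k, T k + ENNReal.ofReal Δ ≤ T (k + 1)

/-- The number of the last broadcast up to time `t`. -/
noncomputable def lastIndex (T : ℕ → ℝ≥0∞) (t : ℝ) : ℕ := sSup {k | T k ≤ ENNReal.ofReal t}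

namespace IsDwellSequence

variable {Δ t u : ℝ} {T : ℕ → ℝ≥0∞}

theorem monotone (H : IsDwellSequence Δ T) : Monotone T :=
  monotone_nat_of_le_succ fun k => le_self_add.trans (H.add_le k)

theorem ofReal_nat_mul_le (H : IsDwellSequence Δ T) (k : ℕ) : ENNReal.ofReal (k * Δ) ≤ T k := by
  induction k with
  | zero => simp
  | succ k ih =>
    rw [Nat.cast_succ, add_one_mul]
    exact ENNReal.ofReal_add_le.trans ((add_le_add_left ih _).trans (H.add_le k))

theorem finite_setOf_le (H : IsDwellSequence Δ T) (hΔ : 0 < Δ) (b : ℝ) :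
    {k | T k ≤ ENNReal.ofReal b}.Finite := by
  refine (Set.finite_Iic ⌊|b| / Δ⌋₊).subset fun k hk => Nat.le_floor ((le_div_iff₀ hΔ).2 ?_)
  exact (ENNReal.ofReal_le_ofReal_iff (abs_nonneg b)).1
    ((H.ofReal_nat_mul_le k).trans (hk.trans (ENNReal.ofReal_le_ofReal (le_abs_self b))))

theorem isGreatest_lastIndex (H : IsDwellSequence Δ T) (hΔ : 0 < Δ) (t : ℝ) :
    IsGreatest {k | T k ≤ ENNReal.ofReal t} (lastIndex T t) :=
  have hbdd := (H.finite_setOf_le hΔ t).bddAbove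
  ⟨Nat.sSup_mem ⟨0, H.zero.trans_le zero_le⟩ hbdd, fun _ hk => le_csSup hbdd hk⟩

theorem lastIndex_le (H : IsDwellSequence Δ T) (hΔ : 0 < Δ) (t : ℝ) :
    T (lastIndex T t) ≤ ENNReal.ofReal t :=
  (H.isGreatest_lastIndex hΔ t).1

theorem lt_lastIndex_succ (H : IsDwellSequence Δ T) (hΔ : 0 < Δ) (t : ℝ) :
    ENNReal.ofReal t < T (lastIndex T t + 1) := by
  by_contra! hle
  exact absurd ((H.isGreatest_lastIndex hΔ t).2 hle) (Nat.not_succ_le_self _)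

theorem lastIndex_eq (H : IsDwellSequence Δ T) {k : ℕ} (hk : T k ≤ ENNReal.ofReal t)
    (hk' : ENNReal.ofReal t < T (k + 1)) : lastIndex T t = k :=
  IsGreatest.csSup_eq ⟨hk, fun _ hl =>
    Nat.lt_succ_iff.1 (H.monotone.reflect_lt (lt_of_le_of_lt hl hk'))⟩

theorem eventually_nhdsGE_lastIndex_eq (H : IsDwellSequence Δ T) (hΔ : 0 < Δ) (t : ℝ) :
    ∀ᶠ u in 𝓝[≥] t, lastIndex T u = lastIndex T t := by
  have hlt : ∀ᶠ u in 𝓝 t, ENNReal.ofReal u < T (lastIndex T t + 1) :=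
    ENNReal.continuous_ofReal.continuousAt.eventually_lt continuousAt_const
      (H.lt_lastIndex_succ hΔ t)
  filter_upwards [nhdsWithin_le_nhds hlt, self_mem_nhdsWithin] with u hu htu
  exact H.lastIndex_eq ((H.lastIndex_le hΔ t).trans (ENNReal.ofReal_le_ofReal htu)) hu

theorem eventually_nhds_lastIndex_eq (H : IsDwellSequence Δ T) (hΔ : 0 < Δ)
    (ht : T (lastIndex T t) < ENNReal.ofReal t) :
    ∀ᶠ u in 𝓝 t, lastIndex T u = lastIndex T t := by
  filter_upwards [continuousAt_const.eventually_lt ENNReal.continuous_ofReal.continuousAt ht,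
    ENNReal.continuous_ofReal.continuousAt.eventually_lt continuousAt_const
      (H.lt_lastIndex_succ hΔ t)] with u hu hu'
  exact H.lastIndex_eq hu.le hu'

end IsDwellSequence

/-- The gap after the `k`-th broadcast is as short as the dwell time permits. -/
def IsDwelling (Δ : ℝ) (T : ℕ → ℝ≥0∞) (k : ℕ) : Prop := T (k + 1) = T k + ENNReal.ofReal Δ

theorem IsDwelling.sub_mem_Icc {Δ t : ℝ} {T : ℕ → ℝ≥0∞} {k : ℕ} (hd : IsDwelling Δ T k)
    (ht : 0 ≤ t) (hk : T k ≤ ENNReal.ofReal t) (hk' : ENNReal.ofReal t < T (k + 1)) :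
    t - (T k).toReal ∈ Set.Icc 0 Δ := by
  refine ⟨sub_nonneg.2 (ENNReal.toReal_le_of_le_ofReal ht hk), ?_⟩
  have hfin : T k ≠ ∞ := ne_top_of_le_ne_top ENNReal.ofReal_ne_top hk
  have hsub : ENNReal.ofReal t - T k < ENNReal.ofReal Δ :=
    ENNReal.sub_lt_of_lt_add hk (by rwa [add_comm, ← hd])
  rw [← ENNReal.ofReal_toReal hfin, ← ENNReal.ofReal_sub _ ENNReal.toReal_nonneg] at hsub
  exact (ENNReal.ofReal_lt_ofReal_iff'.1 hsub).1.le

section DwellStorage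

variable {E : Type*} [NormedAddCommGroup E] {Δ t : ℝ} {T : ℕ → ℝ≥0∞} {y : ℝ → E} {k : ℕ}

open Classical in
/-- The part of the broadcast error `y (T k) - y t` that is not controlled by a threshold, because
the gap after the `k`-th broadcast is a dwell interval. -/
noncomputable def dwellError (Δ : ℝ) (T : ℕ → ℝ≥0∞) (y : ℝ → E) (k : ℕ) (t : ℝ) : E :=
  if IsDwelling Δ T k then y (T k).toReal - y t else 0

/-- The storage function that pays for the dwell error. -/
noncomputable def dwellStorage (Δ : ℝ) (T : ℕ → ℝ≥0∞) (y : ℝ → E) (k : ℕ) (t : ℝ) : ℝ :=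
  dwellWeight Δ (t - (T k).toReal) * ‖dwellError Δ T y k t‖ ^ 2

theorem dwellError_of_isDwelling (hd : IsDwelling Δ T k) (t : ℝ) :
    dwellError Δ T y k t = y (T k).toReal - y t :=
  if_pos hd

theorem dwellError_of_not_isDwelling (hd : ¬IsDwelling Δ T k) (t : ℝ) :
    dwellError Δ T y k t = 0 :=
  if_neg hd

theorem dwellStorage_of_not_isDwelling (hd : ¬IsDwelling Δ T k) : dwellStorage Δ T y k = 0 :=
  funext fun t => by simp [dwellStorage, dwellError_of_not_isDwelling hd]

theorem dwellStorage_nonneg (hΔ : 0 < Δ) (ht : 0 ≤ t) (hk : T k ≤ ENNReal.ofReal t)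
    (hk' : ENNReal.ofReal t < T (k + 1)) : 0 ≤ dwellStorage Δ T y k t := by
  by_cases hd : IsDwelling Δ T k
  · exact mul_nonneg (dwellWeight_nonneg hΔ (hd.sub_mem_Icc ht hk hk')) (sq_nonneg _)
  · rw [dwellStorage_of_not_isDwelling hd, Pi.zero_apply]

theorem dwellStorage_le (hΔ : 0 < Δ) (ht : 0 ≤ t) (hk : T k ≤ ENNReal.ofReal t)
    (hk' : ENNReal.ofReal t < T (k + 1)) :
    dwellStorage Δ T y k t ≤ 7 * ‖dwellError Δ T y k t‖ ^ 2 := by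
  by_cases hd : IsDwelling Δ T k
  · exact mul_le_mul_of_nonneg_right (dwellWeight_le hΔ (hd.sub_mem_Icc ht hk hk')) (sq_nonneg _)
  · simp [dwellStorage, dwellError_of_not_isDwelling hd]

theorem dwellStorage_toReal (k : ℕ) : dwellStorage Δ T y k (T k).toReal = 0 := by
  have herror : dwellError Δ T y k (T k).toReal = 0 := by
    rw [dwellError, sub_self, ite_self]
  rw [dwellStorage, herror, norm_zero, zero_pow two_ne_zero, mul_zero]

theorem continuousAt_dwellStorage (hΔ : 0 < Δ) (ht : 0 ≤ t) (hk : T k ≤ ENNReal.ofReal t)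
    (hk' : ENNReal.ofReal t < T (k + 1)) (hy : ContinuousAt y t) :
    ContinuousAt (dwellStorage Δ T y k) t := by
  by_cases hd : IsDwelling Δ T k
  · have hweight := (hasDerivAt_dwellWeight hΔ (hd.sub_mem_Icc ht hk hk')).comp_sub_const t
      (T k).toReal
    unfold dwellStorage
    simp only [dwellError_of_isDwelling hd]
    exact hweight.continuousAt.mul ((continuousAt_const.sub hy).norm.pow 2)
  · rw [dwellStorage_of_not_isDwelling hd]
    exact continuousAt_const

theorem IsDwellSequence.lowerSemicontinuousOn_dwellStorage (H : IsDwellSequence Δ T) (hΔ : 0 < Δ)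
    (hy : ContinuousOn y (Set.Ici 0)) :
    LowerSemicontinuousOn (fun t => dwellStorage Δ T y (lastIndex T t) t) (Set.Ici 0) := by
  intro t ht
  have hk := H.lastIndex_le hΔ t
  rcases hk.lt_or_eq with hlt | heq
  · have hpos : 0 < t := ENNReal.ofReal_pos.1 (pos_of_gt hlt)
    have hcont : ContinuousAt (dwellStorage Δ T y (lastIndex T t)) t :=
      continuousAt_dwellStorage hΔ ht hk (H.lt_lastIndex_succ hΔ t)
        (hy.continuousAt (Ici_mem_nhds hpos))
    refine (hcont.congr ?_).lowerSemicontinuousAt.lowerSemicontinuousWithinAt _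
    filter_upwards [H.eventually_nhds_lastIndex_eq hΔ hlt] with u hu
    rw [hu]
  · have hzero : dwellStorage Δ T y (lastIndex T t) t = 0 := by
      convert dwellStorage_toReal (lastIndex T t) using 2
      rw [heq, ENNReal.toReal_ofReal ht]
    intro r hr
    filter_upwards [self_mem_nhdsWithin] with u hu
    exact (hr.trans_eq hzero).trans_le
      (dwellStorage_nonneg hΔ hu (H.lastIndex_le hΔ u) (H.lt_lastIndex_succ hΔ u))

variable [InnerProductSpace ℝ E] {v : E}

/-- The derivative of `dwellStorage` along a curve with velocity `v`. -/
noncomputable def dwellStorageDeriv (Δ : ℝ) (T : ℕ → ℝ≥0∞) (y : ℝ → E) (v : E) (k : ℕ) (t : ℝ) :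
    ℝ :=
  dwellWeightDeriv Δ (t - (T k).toReal) * ‖dwellError Δ T y k t‖ ^ 2 +
    dwellWeight Δ (t - (T k).toReal) * (2 * inner ℝ (dwellError Δ T y k t) (-v))

theorem hasDerivWithinAt_dwellStorage (hΔ : 0 < Δ) (ht : 0 ≤ t) (hk : T k ≤ ENNReal.ofReal t)
    (hk' : ENNReal.ofReal t < T (k + 1)) {s : Set ℝ} (hy : HasDerivWithinAt y v s t) :
    HasDerivWithinAt (dwellStorage Δ T y k) (dwellStorageDeriv Δ T y v k t) s t := by
  by_cases hd : IsDwelling Δ T k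
  · have hweight := (hasDerivAt_dwellWeight hΔ (hd.sub_mem_Icc ht hk hk')).comp_sub_const t
      (T k).toReal
    unfold dwellStorageDeriv dwellStorage
    simp only [dwellError_of_isDwelling hd]
    exact hweight.hasDerivWithinAt.mul (hy.const_sub _).norm_sq
  · simp only [dwellStorage_of_not_isDwelling hd, dwellStorageDeriv,
      dwellError_of_not_isDwelling hd, norm_zero, inner_zero_left, ne_eq, OfNat.ofNat_ne_zero,
      not_false_eq_true, zero_pow, mul_zero, add_zero]
    exact hasDerivWithinAt_const ..

theorem IsDwellSequence.hasDerivWithinAt_dwellStorage_lastIndex (H : IsDwellSequence Δ T)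
    (hΔ : 0 < Δ) (ht : 0 ≤ t) (hy : HasDerivWithinAt y v (Set.Ici t) t) :
    HasDerivWithinAt (fun u => dwellStorage Δ T y (lastIndex T u) u)
      (dwellStorageDeriv Δ T y v (lastIndex T t) t) (Set.Ici t) t := by
  refine (hasDerivWithinAt_dwellStorage hΔ ht (H.lastIndex_le hΔ t) (H.lt_lastIndex_succ hΔ t)
    hy).congr_of_eventuallyEq ?_ rfl
  filter_upwards [H.eventually_nhdsGE_lastIndex_eq hΔ t] with u hu
  rw [hu]

theorem dwellStorageDeriv_le (hΔ : 0 < Δ) (ht : 0 ≤ t) (hk : T k ≤ ENNReal.ofReal t)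
    (hk' : ENNReal.ofReal t < T (k + 1)) (y : ℝ → E) (v : E) :
    dwellStorageDeriv Δ T y v k t ≤
      -(5 / (8 * Δ)) * ‖dwellError Δ T y k t‖ ^ 2 + Δ / 3 * ‖v‖ ^ 2 := by
  by_cases hd : IsDwelling Δ T k
  · exact dwellWeight_dissipation hΔ (hd.sub_mem_Icc ht hk hk') _ v
  · have : 0 ≤ Δ / 3 * ‖v‖ ^ 2 := by positivity
    simpa [dwellStorageDeriv, dwellError_of_not_isDwelling hd]

end DwellStorage

/-! ### The closed loop -/

theorem sum_disagreement_eq_zero {N q : ℕ} {a : Matrix (Fin N) (Fin N) ℝ} (ha : a.IsSymm)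
    (yhat : Fin N → ℝ → Vec q) (t : ℝ) : ∑ i, disagreement a yhat i t = 0 := by
  have hneg : ∑ i, disagreement a yhat i t = -∑ i, disagreement a yhat i t := by
    simp only [disagreement, ← Finset.sum_neg_distrib, ← smul_neg, neg_sub]
    rw [Finset.sum_comm]
    simp only [ha.apply]
  have := IsAddTorsionFree.of_isTorsionFree ℝ (Vec q)
  exact self_eq_neg.1 hneg

namespace IsEventTriggeredRun

variable {N q : ℕ} {S : Agents N q} {f : Fin N → Vec q → ℝ} {a : Matrix (Fin N) (Fin N) ℝ}
  {Kα : (i : Fin N) → Matrix (Fin (S.p i)) (Fin (S.n i)) ℝ}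
  {Kβ : (i : Fin N) → Matrix (Fin (S.p i)) (Fin q) ℝ} {κ Δ : ℝ}
  {x : (i : Fin N) → ℝ → Vec (S.n i)} {η yhat : Fin N → ℝ → Vec q} {T : Fin N → ℕ → ℝ≥0∞}

theorem isDwellSequence (h : IsEventTriggeredRun S f a Kα Kβ κ Δ x η yhat T) (i : Fin N) :
    IsDwellSequence Δ (T i) where
  zero := h.T_zero i
  add_le k := by
    by_cases hk : T i k = ∞
    · exact (h.T_top i k hk).symm ▸ le_top
    · obtain ⟨τ, -, hsucc⟩ := h.T_succ i k hk
      rw [hsucc]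
      exact add_le_add_right (le_max_right ..) _

theorem continuousOn_output (h : IsEventTriggeredRun S f a Kα Kβ κ Δ x η yhat T) (i : Fin N) :
    ContinuousOn (S.output x i) (Set.Ici 0) :=
  (LinearMap.continuous_of_finiteDimensional _).comp_continuousOn (h.x_cont i)

theorem hasDerivWithinAt_output (h : IsEventTriggeredRun S f a Kα Kβ κ Δ x η yhat T)
    (hKα : ∀ i, S.C i * S.B i * Kα i = S.C i * S.A i) (hKβ : ∀ i, S.C i * S.B i * Kβ i = 1)
    (i : Fin N) {t : ℝ} (ht : 0 ≤ t) :
    HasDerivWithinAt (S.output x i)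
      (-gradient (f i) (S.output x i t) - disagreement a yhat i t - η i t) (Set.Ici t) t := by
  have hcomp := (Matrix.toEuclideanLin (S.C i)).toContinuousLinearMap.hasFDerivAt
    |>.comp_hasDerivWithinAt t (h.x_deriv i t ht)
  refine hcomp.congr_deriv ?_
  rw [LinearMap.coe_toContinuousLinearMap', control]
  generalize -gradient (f i) (S.output x i t) - disagreement a yhat i t - η i t = g
  have hcancel : Matrix.toEuclideanLin (S.C i) (Matrix.toEuclideanLin (S.B i)
      (Matrix.toEuclideanLin (Kα i) (x i t))) =
      Matrix.toEuclideanLin (S.C i) (Matrix.toEuclideanLin (S.A i) (x i t)) := by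
    simpa [Matrix.toEuclideanLin, Matrix.toLpLin_mul_same] using
      congrArg (Matrix.toEuclideanLin · (x i t)) (hKα i)
  have hinput : Matrix.toEuclideanLin (S.C i) (Matrix.toEuclideanLin (S.B i)
      (Matrix.toEuclideanLin (Kβ i) g)) = g := by
    simpa [Matrix.toEuclideanLin, Matrix.toLpLin_mul_same] using
      congrArg (Matrix.toEuclideanLin · g) (hKβ i)
  simp only [map_add, map_neg, hcancel, hinput]
  abel

theorem yhat_eq (h : IsEventTriggeredRun S f a Kα Kβ κ Δ x η yhat T) (hΔ : 0 < Δ) (i : Fin N)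
    {t : ℝ} (ht : 0 ≤ t) :
    yhat i t = S.output x i (T i (lastIndex (T i) t)).toReal :=
  have H := h.isDwellSequence i
  h.hold i _ t ht (H.lastIndex_le hΔ t) (H.lt_lastIndex_succ hΔ t)

theorem norm_sq_le_of_not_isDwelling (h : IsEventTriggeredRun S f a Kα Kβ κ Δ x η yhat T)
    (ha : ∀ i j, 0 ≤ a i j) {i : Fin N} (hd : 0 < outDegree a i + κ) {k : ℕ} {t : ℝ} (ht : 0 ≤ t)
    (hk : T i k ≤ ENNReal.ofReal t) (hk' : ENNReal.ofReal t < T i (k + 1))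
    (hdwell : ¬IsDwelling Δ (T i) k) :
    4 * (outDegree a i + κ) * ‖yhat i t - S.output x i t‖ ^ 2 ≤
      ∑ j, a i j * ‖yhat i t - yhat j t‖ ^ 2 := by
  have hfin : T i k ≠ ∞ := ne_top_of_le_ne_top ENNReal.ofReal_ne_top hk
  obtain ⟨τ, ⟨hbefore, -⟩, hsucc⟩ := h.T_succ i k hfin
  have hmax : max τ (ENNReal.ofReal Δ) = τ :=
    (max_choice ..).resolve_right fun hΔ => hdwell (by rw [IsDwelling, hsucc, hΔ])
  rw [hmax] at hsucc
  rw [h.hold i k t ht hk hk']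
  rcases (ENNReal.toReal_le_of_le_ofReal ht hk).eq_or_lt with heq | hlt
  · rw [heq, sub_self, norm_zero, zero_pow two_ne_zero, mul_zero]
    exact Finset.sum_nonneg fun j _ => mul_nonneg (ha i j) (sq_nonneg _)
  · have hτ : ENNReal.ofReal (t - (T i k).toReal) < τ := by
      rw [ENNReal.ofReal_sub _ ENNReal.toReal_nonneg, ENNReal.ofReal_toReal hfin]
      exact ENNReal.sub_lt_of_lt_add hk (by rwa [add_comm, ← hsucc])
    have hlt := (hbefore t hlt hτ).le
    rwa [threshold, one_div_mul_eq_div, le_div_iff₀' (by positivity)] at hlt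

theorem norm_sub_dwellError_sq_le (h : IsEventTriggeredRun S f a Kα Kβ κ Δ x η yhat T)
    (ha : ∀ i j, 0 ≤ a i j) (hΔ : 0 < Δ) {i : Fin N} (hd : 0 < outDegree a i + κ) {t : ℝ}
    (ht : 0 ≤ t) :
    4 * (outDegree a i + κ) *
        ‖yhat i t - S.output x i t - dwellError Δ (T i) (S.output x i) (lastIndex (T i) t) t‖ ^ 2 ≤
      ∑ j, a i j * ‖yhat i t - yhat j t‖ ^ 2 := by
  have H := h.isDwellSequence i
  by_cases hdwell : IsDwelling Δ (T i) (lastIndex (T i) t)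
  · rw [dwellError_of_isDwelling hdwell, ← h.yhat_eq hΔ i ht, sub_self, norm_zero,
      zero_pow two_ne_zero, mul_zero]
    exact Finset.sum_nonneg fun j _ => mul_nonneg (ha i j) (sq_nonneg _)
  · rw [dwellError_of_not_isDwelling hdwell, sub_zero]
    exact h.norm_sq_le_of_not_isDwelling ha hd ht (H.lastIndex_le hΔ t) (H.lt_lastIndex_succ hΔ t)
      hdwell

theorem sum_eta_eq_zero (h : IsEventTriggeredRun S f a Kα Kβ κ Δ x η yhat T) (ha : a.IsSymm)
    {t : ℝ} (ht : 0 ≤ t) : ∑ i, η i t = 0 := by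
  have hderiv : ∀ s ∈ Set.Ico 0 t, HasDerivWithinAt (fun s => ∑ i, η i s) 0 (Set.Ici s) s :=
    fun s hs => by
      simpa only [sum_disagreement_eq_zero ha] using
        HasDerivWithinAt.fun_sum (u := Finset.univ) fun i _ => h.η_deriv i s hs.1
  have hconst := constant_of_has_deriv_right_zero
    (continuousOn_finsetSum _ fun i _ => (h.η_cont i).mono Set.Icc_subset_Ici_self) hderiv t
    ⟨ht, le_rfl⟩
  simpa only [h.η_zero, Finset.sum_const_zero] using hconst

end IsEventTriggeredRun

theorem norm_le_sqrt_mul_exp_of_lyapunov {X : Type*} [NormedAddCommGroup X] {Y : ℝ → X}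
    {V V' : ℝ → ℝ} {γ δ : ℝ} (hδ : 0 < δ) (hV : LowerSemicontinuousOn V (Set.Ici 0))
    (hd : ∀ t, 0 ≤ t → HasDerivWithinAt V (V' t) (Set.Ici t) t)
    (hle : ∀ t, 0 ≤ t → V' t ≤ -γ * V t) (hY : ∀ t, 0 ≤ t → δ * ‖Y t‖ ^ 2 ≤ V t) {t : ℝ}
    (ht : 0 ≤ t) : ‖Y t‖ ≤ √(V 0 / δ) * Real.exp (-(γ / 2) * t) := by
  have hdecay : V t ≤ V 0 * Real.exp (-γ * t) :=
    le_mul_exp_of_right_deriv_le (hV.mono Set.Icc_subset_Ici_self) (fun s hs => hd s hs.1)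
      (fun s hs => hle s hs.1) ⟨ht, le_rfl⟩
  have hV0 : 0 ≤ V 0 := (by positivity : 0 ≤ δ * ‖Y 0‖ ^ 2).trans (hY 0 le_rfl)
  refine le_of_sq_le_sq ?_ (by positivity)
  rw [mul_pow, Real.sq_sqrt (by positivity), ← Real.exp_nat_mul, div_mul_eq_mul_div,
    le_div_iff₀' hδ]
  convert (hY t ht).trans hdecay using 3
  push_cast
  ring

section ClosedLoop

variable {N q : ℕ}

/-- The deviation of the outputs from the optimum `ystar`. -/
noncomputable def outputError (S : Agents N q) (x : (i : Fin N) → ℝ → Vec (S.n i))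
    (ystar : Vec q) (t : ℝ) : Fin N → Vec q :=
  fun i => S.output x i t - ystar

/-- The deviation of the integrator states from their equilibrium values `-∇f_i(ystar)`. -/
noncomputable def integratorError (f : Fin N → Vec q → ℝ) (η : Fin N → ℝ → Vec q)
    (ystar : Vec q) (t : ℝ) : Fin N → Vec q :=
  fun i => η i t + gradient (f i) ystar

/-- The right derivative of the outputs along the closed loop. -/
noncomputable def outputVelocity (S : Agents N q) (f : Fin N → Vec q → ℝ)
    (a : Matrix (Fin N) (Fin N) ℝ) (x : (i : Fin N) → ℝ → Vec (S.n i)) (η yhat : Fin N → ℝ → Vec q)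
    (t : ℝ) : Fin N → Vec q :=
  fun i => -gradient (f i) (S.output x i t) - disagreement a yhat i t - η i t

/-- The Lyapunov function of the closed loop: the modal energy of the deviation from equilibrium
plus the storage of the dwell errors. -/
noncomputable def lyapunov {a : Matrix (Fin N) (Fin N) ℝ} (ha : IsConnectedAdjacency a)
    (b g : Fin N → ℝ) (S : Agents N q) (f : Fin N → Vec q → ℝ) (Δ : ℝ)
    (x : (i : Fin N) → ℝ → Vec (S.n i)) (η : Fin N → ℝ → Vec q) (T : Fin N → ℕ → ℝ≥0∞)
    (ystar : Vec q) (t : ℝ) : ℝ :=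
  ha.modalEnergy b g (outputError S x ystar t) (integratorError f η ystar t) +
    ∑ i, dwellStorage Δ (T i) (S.output x i) (lastIndex (T i) t) t

/-- The right derivative of `lyapunov` along the closed loop. -/
noncomputable def lyapunovDeriv {a : Matrix (Fin N) (Fin N) ℝ} (ha : IsConnectedAdjacency a)
    (b g : Fin N → ℝ) (S : Agents N q) (f : Fin N → Vec q → ℝ) (Δ : ℝ)
    (x : (i : Fin N) → ℝ → Vec (S.n i)) (η yhat : Fin N → ℝ → Vec q) (T : Fin N → ℕ → ℝ≥0∞)
    (ystar : Vec q) (t : ℝ) : ℝ :=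
  ha.modalEnergyDeriv b g (outputError S x ystar t) (integratorError f η ystar t)
      (outputVelocity S f a x η yhat t) (fun i => disagreement a yhat i t) +
    ∑ i, dwellStorageDeriv Δ (T i) (S.output x i) (outputVelocity S f a x η yhat t i)
      (lastIndex (T i) t) t

end ClosedLoop

namespace IsEventTriggeredRun

variable {N q : ℕ} {S : Agents N q} {f : Fin N → Vec q → ℝ} {a : Matrix (Fin N) (Fin N) ℝ}
  {Kα : (i : Fin N) → Matrix (Fin (S.p i)) (Fin (S.n i)) ℝ}
  {Kβ : (i : Fin N) → Matrix (Fin (S.p i)) (Fin q) ℝ} {κ Δ : ℝ}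
  {x : (i : Fin N) → ℝ → Vec (S.n i)} {η yhat : Fin N → ℝ → Vec q} {T : Fin N → ℕ → ℝ≥0∞}
  {m p ρ ν δ C t : ℝ} {b g : Fin N → ℝ} {ystar : Vec q}

theorem sum_integratorError_eq_zero (h : IsEventTriggeredRun S f a Kα Kβ κ Δ x η yhat T)
    (ha : a.IsSymm) (hsum : ∑ i, gradient (f i) ystar = 0) (ht : 0 ≤ t) :
    ∑ i, integratorError f η ystar t i = 0 := by
  simp only [integratorError, Finset.sum_add_distrib, h.sum_eta_eq_zero ha ht, hsum, add_zero]

theorem hasDerivWithinAt_lyapunov (h : IsEventTriggeredRun S f a Kα Kβ κ Δ x η yhat T)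
    (ha : IsConnectedAdjacency a) (hΔ : 0 < Δ)
    (hKα : ∀ i, S.C i * S.B i * Kα i = S.C i * S.A i) (hKβ : ∀ i, S.C i * S.B i * Kβ i = 1)
    (b g : Fin N → ℝ) (ystar : Vec q) (ht : 0 ≤ t) :
    HasDerivWithinAt (lyapunov ha b g S f Δ x η T ystar)
      (lyapunovDeriv ha b g S f Δ x η yhat T ystar t) (Set.Ici t) t := by
  have houtput (i : Fin N) := h.hasDerivWithinAt_output hKα hKβ i ht
  refine (ha.hasDerivWithinAt_modalEnergy b g ?_ ?_).fun_add
    (HasDerivWithinAt.fun_sum fun i _ =>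
      (h.isDwellSequence i).hasDerivWithinAt_dwellStorage_lastIndex hΔ ht (houtput i))
  · exact hasDerivWithinAt_pi.2 fun i => (houtput i).sub_const ystar
  · exact hasDerivWithinAt_pi.2 fun i => (h.η_deriv i t ht).add_const _

theorem lowerSemicontinuousOn_lyapunov (h : IsEventTriggeredRun S f a Kα Kβ κ Δ x η yhat T)
    (ha : IsConnectedAdjacency a) (hΔ : 0 < Δ) (b g : Fin N → ℝ) (ystar : Vec q) :
    LowerSemicontinuousOn (lyapunov ha b g S f Δ x η T ystar) (Set.Ici 0) := by
  have hY : ContinuousOn (outputError S x ystar) (Set.Ici 0) :=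
    continuousOn_pi.2 fun i => (h.continuousOn_output i).sub continuousOn_const
  have hE : ContinuousOn (integratorError f η ystar) (Set.Ici 0) :=
    continuousOn_pi.2 fun i => (h.η_cont i).add continuousOn_const
  exact ((ha.continuous_modalEnergy b g).comp_continuousOn
    (hY.prodMk hE)).lowerSemicontinuousOn.add (lowerSemicontinuousOn_sum fun i _ =>
      (h.isDwellSequence i).lowerSemicontinuousOn_dwellStorage hΔ (h.continuousOn_output i))

theorem mul_sum_norm_sq_le_lyapunov (h : IsEventTriggeredRun S f a Kα Kβ κ Δ x η yhat T)
    {ha : IsConnectedAdjacency a} (hΔ : 0 < Δ) (W : LyapunovWeights ha m p κ ρ ν b g δ)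
    (hsum : ∑ i, gradient (f i) ystar = 0) (ht : 0 ≤ t) :
    δ * ∑ i, ‖outputError S x ystar t i‖ ^ 2 ≤ lyapunov ha b g S f Δ x η T ystar t :=
  le_add_of_le_of_nonneg
    (W.mul_sum_norm_sq_le_modalEnergy _ (h.sum_integratorError_eq_zero ha.symm hsum ht))
    (Finset.sum_nonneg fun i _ =>
      have H := h.isDwellSequence i
      dwellStorage_nonneg hΔ ht (H.lastIndex_le hΔ t) (H.lt_lastIndex_succ hΔ t))

theorem lyapunov_le (h : IsEventTriggeredRun S f a Kα Kβ κ Δ x η yhat T)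
    (ha : IsConnectedAdjacency a) (hΔ : 0 < Δ) (hC₇ : 7 ≤ C) (hC : ∀ k, 1 + |b k| + |g k| ≤ C)
    (ystar : Vec q) (ht : 0 ≤ t) :
    lyapunov ha b g S f Δ x η T ystar t ≤
      C * ∑ i, (‖outputError S x ystar t i‖ ^ 2 + ‖integratorError f η ystar t i‖ ^ 2 +
        ‖dwellError Δ (T i) (S.output x i) (lastIndex (T i) t) t‖ ^ 2) := by
  rw [Finset.sum_add_distrib, mul_add]
  refine add_le_add (ha.modalEnergy_le hC _ _) ?_
  rw [Finset.mul_sum]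
  refine Finset.sum_le_sum fun i _ => ?_
  have H := h.isDwellSequence i
  exact (dwellStorage_le hΔ ht (H.lastIndex_le hΔ t) (H.lt_lastIndex_succ hΔ t)).trans
    (mul_le_mul_of_nonneg_right hC₇ (sq_nonneg _))

theorem lyapunovDeriv_le (h : IsEventTriggeredRun S f a Kα Kβ κ Δ x η yhat T)
    {ha : IsConnectedAdjacency a} (hΔ : 0 < Δ) (hκ : 0 < κ) (hp : 0 < p)
    (W : LyapunovWeights ha m p κ (5 / (8 * Δ)) (Δ / 3) b g δ)
    (hsum : ∑ i, gradient (f i) ystar = 0)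
    (hsec : ∀ i u, ‖gradient (f i) u - gradient (f i) ystar - m • (u - ystar)‖ ^ 2 ≤
      p * inner ℝ (u - ystar) (gradient (f i) u - gradient (f i) ystar - m • (u - ystar)))
    (ht : 0 ≤ t) :
    lyapunovDeriv ha b g S f Δ x η yhat T ystar t ≤
      -(δ / 4) * ∑ i, (‖outputError S x ystar t i‖ ^ 2 + ‖integratorError f η ystar t i‖ ^ 2 +
        ‖dwellError Δ (T i) (S.output x i) (lastIndex (T i) t) t‖ ^ 2) := by
  set A : Fin N → Vec q := fun i => dwellError Δ (T i) (S.output x i) (lastIndex (T i) t) t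
  set z : Fin N → Vec q := fun i => yhat i t - ystar with hz
  have hstorage : ∑ i, dwellStorageDeriv Δ (T i) (S.output x i)
      (outputVelocity S f a x η yhat t i) (lastIndex (T i) t) t ≤
      ∑ i, (-(5 / (8 * Δ)) * ‖A i‖ ^ 2 + Δ / 3 * ‖outputVelocity S f a x η yhat t i‖ ^ 2) :=
    Finset.sum_le_sum fun i _ =>
      have H := h.isDwellSequence i
      dwellStorageDeriv_le hΔ ht (H.lastIndex_le hΔ t) (H.lt_lastIndex_succ hΔ t) _ _
  have hdisagreement : (fun i => disagreement a yhat i t) =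
      fun i => ∑ j, a i j • (z i - z j) := by
    simp only [hz, sub_sub_sub_cancel_right, disagreement]
  unfold lyapunovDeriv
  rw [hdisagreement]
  refine (add_le_add_right hstorage _).trans (W.modalEnergyDeriv_add_le hp
    (H := fun i => gradient (f i) (S.output x i t) - gradient (f i) ystar -
      m • (S.output x i t - ystar))
    (B := fun i => yhat i t - S.output x i t - A i) ?_ ?_ (fun i => hsec i _) (fun i => ?_)
    (h.sum_integratorError_eq_zero ha.symm hsum ht))
  · ext1 i
    simp only [hz, outputError, Pi.add_apply]
    abel
  · rw [← hdisagreement]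
    ext1 i
    simp only [outputVelocity, integratorError, outputError, Pi.sub_apply, Pi.neg_apply,
      Pi.add_apply, Pi.smul_apply]
    abel
  · simpa only [hz, sub_sub_sub_cancel_right] using h.norm_sub_dwellError_sq_le ha.nonneg hΔ
      (add_pos_of_nonneg_of_pos (ha.outDegree_nonneg i) hκ) ht

theorem exists_norm_output_sub_le (h : IsEventTriggeredRun S f a Kα Kβ κ Δ x η yhat T)
    {ha : IsConnectedAdjacency a} (hΔ : 0 < Δ) (hκ : 0 < κ) (hp : 0 < p)
    (hKα : ∀ i, S.C i * S.B i * Kα i = S.C i * S.A i) (hKβ : ∀ i, S.C i * S.B i * Kβ i = 1)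
    (W : LyapunovWeights ha m p κ (5 / (8 * Δ)) (Δ / 3) b g δ) (hC₇ : 7 ≤ C)
    (hC : ∀ k, 1 + |b k| + |g k| ≤ C) (hsum : ∑ i, gradient (f i) ystar = 0)
    (hsec : ∀ i u, ‖gradient (f i) u - gradient (f i) ystar - m • (u - ystar)‖ ^ 2 ≤
      p * inner ℝ (u - ystar) (gradient (f i) u - gradient (f i) ystar - m • (u - ystar))) :
    ∃ M, ∀ i t, 0 ≤ t → ‖S.output x i t - ystar‖ ≤ M * Real.exp (-(δ / (4 * C) / 2) * t) := by
  have hδ := W.δ_pos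
  have : 0 < C := by linarith
  refine ⟨√(lyapunov ha b g S f Δ x η T ystar 0 / δ), fun i t ht => ?_⟩
  refine norm_le_sqrt_mul_exp_of_lyapunov (Y := fun t => outputError S x ystar t i) hδ
    (h.lowerSemicontinuousOn_lyapunov ha hΔ b g ystar)
    (fun s hs => h.hasDerivWithinAt_lyapunov ha hΔ hKα hKβ b g ystar hs) (fun s hs => ?_)
    (fun s hs => ?_) ht
  · refine (h.lyapunovDeriv_le hΔ hκ hp W hsum hsec hs).trans ?_
    have hupper := mul_le_mul_of_nonneg_left (h.lyapunov_le ha hΔ hC₇ hC ystar hs)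
      (by positivity : 0 ≤ δ / (4 * C))
    rw [← mul_assoc, show δ / (4 * C) * C = δ / 4 by field_simp] at hupper
    linarith
  · refine le_trans ?_ (h.mul_sum_norm_sq_le_lyapunov hΔ W hsum hs)
    exact mul_le_mul_of_nonneg_left (Finset.single_le_sum
      (f := fun i => ‖outputError S x ystar s i‖ ^ 2) (fun _ _ => sq_nonneg _)
      (Finset.mem_univ i)) hδ.le

end IsEventTriggeredRun

theorem exists_pos_forall_le {ι : Type*} [Finite ι] {g : ι → ℝ} (hg : ∀ k, 0 < g k) :
    ∃ δ > 0, ∀ k, δ ≤ g k := by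
  rcases isEmpty_or_nonempty ι with hempty | _
  · exact ⟨1, one_pos, hempty.elim⟩
  · obtain ⟨k, hk⟩ := Finite.exists_min g
    exact ⟨g k, hg k, hk⟩

theorem GainBounds.exists_modeWeights {m w κ₀ κ l Δ : ℝ} (H : GainBounds m w κ₀ l Δ)
    (hκ : κ₀ ≤ κ) :
    ∃ b g, ∃ δ > 0, (∀ y h η e z, (l = 0 → η = 0) →
        (g - b) * l * (η * z) + δ * (y ^ 2 + h ^ 2 + η ^ 2 + e ^ 2 + z ^ 2) ≤
          modeDissipation m (w - m) (κ + l / 2) (5 / (8 * Δ)) (Δ / 3) b l y h η e z) ∧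
      ∀ y η, (l = 0 → η = 0) → δ * (y ^ 2 + η ^ 2) ≤ modeEnergy b g y η := by
  obtain ⟨c, δ, hδ, hdec⟩ := H.exists_mode_decrease hκ
  rcases H.l_nonneg.eq_or_lt with rfl | hl
  · refine ⟨crossWeight m w κ₀ 0 Δ, 0, min δ (1 / 2), lt_min hδ (by norm_num),
      fun y h η e z hη => ?_, fun y η hη => ?_⟩
    · have hle := mul_le_mul_of_nonneg_right (min_le_left δ (1 / 2))
        (by positivity : 0 ≤ y ^ 2 + h ^ 2 + η ^ 2 + e ^ 2 + z ^ 2)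
      have hmode := hdec y h η e z
      rw [hη rfl, zero_mul, mul_zero, zero_add] at hmode ⊢
      rw [hη rfl] at hle
      exact hle.trans hmode
    · have hle := mul_le_mul_of_nonneg_right (min_le_right δ (1 / 2)) (sq_nonneg y)
      rw [hη rfl, modeEnergy]
      linarith
  · have := H.Δ_pos
    obtain ⟨μ, hμ, hlow⟩ := exists_mode_lower_bound hl hδ (by positivity) hdec
    refine ⟨crossWeight m w κ₀ l Δ, c / l + crossWeight m w κ₀ l Δ, min δ μ, lt_min hδ hμ,
      fun y h η e z _ => ?_, fun y η _ => ?_⟩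
    · rw [add_sub_cancel_right, div_mul_cancel₀ c hl.ne']
      exact (add_le_add_right (mul_le_mul_of_nonneg_right (min_le_left δ μ) (by positivity))
        _).trans (hdec y h η e z)
    · refine (mul_le_mul_of_nonneg_right (min_le_right δ μ) (by positivity)).trans
        ((hlow y η).trans_eq ?_)
      unfold modeEnergy
      ring

theorem exists_lyapunovWeights {N : ℕ} {a : Matrix (Fin N) (Fin N) ℝ}
    (ha : IsConnectedAdjacency a) {m w κ₀ κ Δ : ℝ}
    (H : ∀ k, GainBounds m w κ₀ (ha.eigenvalue k) Δ) (hκ : κ₀ ≤ κ) :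
    ∃ b g δ, LyapunovWeights ha m (w - m) κ (5 / (8 * Δ)) (Δ / 3) b g δ := by
  choose b g δ hδ hdec hlow using fun k => (H k).exists_modeWeights hκ
  obtain ⟨δ₀, hδ₀, hle⟩ := exists_pos_forall_le hδ
  refine ⟨b, g, δ₀, hδ₀, fun k y h η e z hη => ?_, fun k y η hη => ?_⟩
  · exact (add_le_add_right (mul_le_mul_of_nonneg_right (hle k) (by positivity)) _).trans
      (hdec k y h η e z hη)
  · exact (mul_le_mul_of_nonneg_right (hle k) (by positivity)).trans (hlow k y η hη)

section Rate

variable {N q : ℕ} {S : Agents N q} {f : Fin N → Vec q → ℝ} {a : Matrix (Fin N) (Fin N) ℝ}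
  {w m : Fin N → ℝ} {Kα : (i : Fin N) → Matrix (Fin (S.p i)) (Fin (S.n i)) ℝ}
  {Kβ : (i : Fin N) → Matrix (Fin (S.p i)) (Fin q) ℝ} {ξ Δ κ : ℝ} {ystar : Vec q}

theorem exists_decay_rate_of_lyapunovWeights {ha : IsConnectedAdjacency a} (hΔ : 0 < Δ)
    (hκ : 0 < κ) {m p δ : ℝ} (hp : 0 < p) {b g : Fin N → ℝ}
    (W : LyapunovWeights ha m p κ (5 / (8 * Δ)) (Δ / 3) b g δ)
    (hKα : ∀ i, S.C i * S.B i * Kα i = S.C i * S.A i) (hKβ : ∀ i, S.C i * S.B i * Kβ i = 1)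
    (hsum : ∑ i, gradient (f i) ystar = 0)
    (hsec : ∀ i u, ‖gradient (f i) u - gradient (f i) ystar - m • (u - ystar)‖ ^ 2 ≤
      p * inner ℝ (u - ystar) (gradient (f i) u - gradient (f i) ystar - m • (u - ystar))) :
    ∃ c > 0, ∀ (x : (i : Fin N) → ℝ → Vec (S.n i)) (η yhat : Fin N → ℝ → Vec q)
      (T : Fin N → ℕ → ℝ≥0∞), IsEventTriggeredRun S f a Kα Kβ κ Δ x η yhat T →
        ∃ M, ∀ i t, 0 ≤ t → ‖S.output x i t - ystar‖ ≤ M * Real.exp (-c * t) := by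
  set C := 7 + ∑ k, (1 + |b k| + |g k|) with hCdef
  have hnonneg (k : Fin N) : 0 ≤ 1 + |b k| + |g k| := by positivity
  have hC₇ : 7 ≤ C := le_add_of_nonneg_right (Finset.sum_nonneg fun k _ => hnonneg k)
  have hC (k : Fin N) : 1 + |b k| + |g k| ≤ C :=
    le_add_of_nonneg_of_le (by norm_num)
      (Finset.single_le_sum (fun k _ => hnonneg k) (Finset.mem_univ k))
  have := W.δ_pos
  exact ⟨δ / (4 * C) / 2, by positivity, fun x η yhat T h =>
    h.exists_norm_output_sub_le hΔ hκ hp hKα hKβ W hC₇ hC hsum hsec⟩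

theorem exists_decay_rate [Nontrivial (Vec q)] (ha : IsConnectedAdjacency a)
    (hf : ∀ i, Differentiable ℝ (f i))
    (hLip : ∀ i u v, ‖gradient (f i) u - gradient (f i) v‖ ≤ w i * ‖u - v‖)
    (hm : ∀ i, 0 < m i)
    (hconv : ∀ i u v, m i * ‖u - v‖ ^ 2 ≤ inner ℝ (u - v) (gradient (f i) u - gradient (f i) v))
    (hKα : ∀ i, S.C i * S.B i * Kα i = S.C i * S.A i) (hKβ : ∀ i, S.C i * S.B i * Kβ i = 1)
    (hξ : (4 * (⨆ i, w i) ^ 2 + 2 * maxLaplacianEigenvalue a ^ 2 + 1) / (8 * ⨅ i, m i) < ξ)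
    (hΔ : 0 < Δ) (hΔ' : Δ ≤ tauZero (⨆ i, w i) (maxLaplacianEigenvalue a) (epsilon ξ))
    (hκ : max ((⨆ i, w i) ^ 2 / (4 * ⨅ i, m i)) (1 / 2) < κ)
    (hsum : ∑ i, gradient (f i) ystar = 0) :
    ∃ c > 0, ∀ (x : (i : Fin N) → ℝ → Vec (S.n i)) (η yhat : Fin N → ℝ → Vec q)
      (T : Fin N → ℕ → ℝ≥0∞), IsEventTriggeredRun S f a Kα Kβ κ Δ x η yhat T →
        ∃ M, ∀ i t, 0 ≤ t → ‖S.output x i t - ystar‖ ≤ M * Real.exp (-c * t) := by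
  have hne : Nonempty (Fin N) := ha.connected.nonempty
  have hmin_le (i : Fin N) : ⨅ i, m i ≤ m i := ciInf_le (Finite.bddBelow_range m) i
  have hle_max (i : Fin N) : w i ≤ ⨆ i, w i := le_ciSup (Finite.bddAbove_range w) i
  have hmin : 0 < ⨅ i, m i := by
    obtain ⟨δ, hδ, hle⟩ := exists_pos_forall_le hm
    exact hδ.trans_le (le_ciInf hle)
  have hmin_le_max : ⨅ i, m i ≤ ⨆ i, w i := by
    obtain ⟨i⟩ := hne
    exact (hmin_le i).trans
      ((le_of_strongly_monotone_of_lipschitz (hconv i) (hLip i)).trans (hle_max i))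
  obtain ⟨m', κ₀, hm', hκ₀, hgain⟩ := exists_gainBounds hmin hmin_le_max hξ hΔ hΔ' hκ
  have hm'_lt : m' < ⨆ i, w i := hm'.trans_le hmin_le_max
  obtain ⟨b, g, δ, W⟩ := exists_lyapunovWeights ha
    (fun k => hgain _ (ha.eigenvalue_nonneg k) (ha.eigenvalue_le_max k)) hκ₀
  have hstrong (i : Fin N) (u v : Vec q) :
      m' * ‖u - v‖ ^ 2 ≤ inner ℝ (u - v) (gradient (f i) u - gradient (f i) v) :=
    (mul_le_mul_of_nonneg_right (hm'.le.trans (hmin_le i)) (sq_nonneg _)).trans (hconv i u v)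
  have hsmooth (i : Fin N) (u v : Vec q) :
      inner ℝ (u - v) (gradient (f i) u - gradient (f i) v) ≤ (⨆ i, w i) * ‖u - v‖ ^ 2 :=
    (inner_le_of_lipschitz (hLip i) u v).trans
      (mul_le_mul_of_nonneg_right (hle_max i) (sq_nonneg _))
  exact exists_decay_rate_of_lyapunovWeights hΔ
    (one_half_pos.trans ((le_max_right _ _).trans_lt hκ)) (sub_pos.2 hm'_lt) W hKα hKβ hsum
    fun i u => sector_of_strongly_monotone (fun x => (hf i x).hasGradientAt) hm'_lt (hstrong i)
      (hsmooth i) u ystar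

end Rate

end OptimalConsensus

open OptimalConsensus in
theorem theorem3_general {N q : ℕ} (S : Agents N q) {f : Fin N → Vec q → ℝ}
    {a : Matrix (Fin N) (Fin N) ℝ} {w m : Fin N → ℝ} {ξ Δ κ : ℝ} (ha : IsConnectedAdjacency a)
    (hf : ∀ i, Differentiable ℝ (f i))
    (hLip : ∀ i u v, ‖gradient (f i) u - gradient (f i) v‖ ≤ w i * ‖u - v‖)
    (hm : ∀ i, 0 < m i)
    (hconv : ∀ i u v, m i * ‖u - v‖ ^ 2 ≤ inner ℝ (u - v) (gradient (f i) u - gradient (f i) v))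
    {Kα : (i : Fin N) → Matrix (Fin (S.p i)) (Fin (S.n i)) ℝ}
    (hKα : ∀ i, S.C i * S.B i * Kα i = S.C i * S.A i)
    {Kβ : (i : Fin N) → Matrix (Fin (S.p i)) (Fin q) ℝ} (hKβ : ∀ i, S.C i * S.B i * Kβ i = 1)
    (hξ : (4 * (⨆ i, w i) ^ 2 + 2 * maxLaplacianEigenvalue a ^ 2 + 1) / (8 * ⨅ i, m i) < ξ)
    (hΔ : 0 < Δ) (hΔ' : Δ ≤ tauZero (⨆ i, w i) (maxLaplacianEigenvalue a) (epsilon ξ))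
    (hκ : max ((⨆ i, w i) ^ 2 / (4 * ⨅ i, m i)) (1 / 2) < κ) :
    ∃ ystar : Vec q,
      IsOptimalConsensus f (fun _ => ystar) ∧
      (∀ Y, IsOptimalConsensus f Y → Y = fun _ => ystar) ∧
      ∃ c > 0, ∀ (x : (i : Fin N) → ℝ → Vec (S.n i)) (η yhat : Fin N → ℝ → Vec q)
        (T : Fin N → ℕ → ENNReal),
        IsEventTriggeredRun S f a Kα Kβ κ Δ x η yhat T →
          (∃ M, ∀ i t, 0 ≤ t → ‖S.output x i t - ystar‖ ≤ M * Real.exp (-c * t)) ∧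
          (∀ i k, T i k + ENNReal.ofReal Δ ≤ T i (k + 1)) ∧
          (∀ i (b : ℝ), {k | T i k ≤ ENNReal.ofReal b}.Finite) := by
  have : Nonempty (Fin N) := ha.connected.nonempty
  have hm_sum : 0 < ∑ i, m i := Finset.sum_pos (fun i _ => hm i) Finset.univ_nonempty
  obtain ⟨ystar, hsum⟩ := exists_sum_gradient_eq_zero hf hm_sum hconv
  have hopt := isOptimalConsensus_iff_of_sum_gradient_eq_zero hf hm_sum hconv hsum
  refine ⟨ystar, (hopt _).2 rfl, fun Y => (hopt Y).1, ?_⟩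
  rcases subsingleton_or_nontrivial (Vec q) with hq | hq
  · refine ⟨1, one_pos, fun x η yhat T h => ⟨⟨0, fun i t _ => ?_⟩,
      fun i => (h.isDwellSequence i).add_le, fun i => (h.isDwellSequence i).finite_setOf_le hΔ⟩⟩
    rw [Subsingleton.elim (S.output x i t - ystar) 0, norm_zero, zero_mul]
  · obtain ⟨c, hc, hdecay⟩ := exists_decay_rate ha hf hLip hm hconv hKα hKβ hξ hΔ hΔ' hκ hsum
    exact ⟨c, hc, fun x η yhat T h => ⟨hdecay x η yhat T h,
      fun i => (h.isDwellSequence i).add_le, fun i => (h.isDwellSequence i).finite_setOf_le hΔ⟩⟩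

open OptimalConsensus in
theorem theorem3 {N q : ℕ} (hN : 0 < N) (S : Agents N q) (f : Fin N → Vec q → ℝ)
    (a : Matrix (Fin N) (Fin N) ℝ)
    (ha : IsConnectedAdjacency a)
    (w : Fin N → ℝ) (hw : ∀ i, 0 < w i)
    (hf : ∀ i, Differentiable ℝ (f i))
    (hLip : ∀ i u v, ‖gradient (f i) u - gradient (f i) v‖ ≤ w i * ‖u - v‖)
    (m : Fin N → ℝ) (hm : ∀ i, 0 < m i)
    (hconv : ∀ i u v, m i * ‖u - v‖ ^ 2 ≤ inner ℝ (u - v) (gradient (f i) u - gradient (f i) v))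
    (hctrl : ∀ i, IsControllable (S.A i) (S.B i))
    (hrank : ∀ i, (S.C i * S.B i).rank = q)
    (Kα : (i : Fin N) → Matrix (Fin (S.p i)) (Fin (S.n i)) ℝ)
    (hKα : ∀ i, S.C i * S.B i * Kα i = S.C i * S.A i)
    (Kβ : (i : Fin N) → Matrix (Fin (S.p i)) (Fin q) ℝ)
    (hKβ : ∀ i, S.C i * S.B i * Kβ i = 1)
    (ξ : ℝ)
    (hξ : (4 * (⨆ i, w i) ^ 2 + 2 * maxLaplacianEigenvalue a ^ 2 + 1) / (8 * ⨅ i, m i) < ξ)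
    (Δ : ℝ) (hΔ : 0 < Δ)
    (hΔ' : Δ ≤ tauZero (⨆ i, w i) (maxLaplacianEigenvalue a) (epsilon ξ))
    (κ : ℝ) (hκ : max ((⨆ i, w i) ^ 2 / (4 * ⨅ i, m i)) (1 / 2) < κ) :
    ∃ ystar : Vec q,
      IsOptimalConsensus f (fun _ => ystar) ∧
      (∀ Y, IsOptimalConsensus f Y → Y = fun _ => ystar) ∧
      ∃ c > 0, ∀ (x : (i : Fin N) → ℝ → Vec (S.n i)) (η yhat : Fin N → ℝ → Vec q)
        (T : Fin N → ℕ → ENNReal),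
        IsEventTriggeredRun S f a Kα Kβ κ Δ x η yhat T →
          (∃ M, ∀ i t, 0 ≤ t → ‖S.output x i t - ystar‖ ≤ M * Real.exp (-c * t)) ∧
          (∀ i k, T i k + ENNReal.ofReal Δ ≤ T i (k + 1)) ∧
          (∀ i (b : ℝ), {k | T i k ≤ ENNReal.ofReal b}.Finite) :=
  theorem3_general S ha hf hLip hm hconv hKα hKβ hξ hΔ hΔ' hκ
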